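/- **Setting.** Let $n,K\ge 1$, $N=n^2$, and write $H=\sum_{i+j\le n+1}\lambda_{ij}x^iy^j$ for bivariate polynomials of degree at most $n+1$, with homogeneous coordinates $\lambda=(\lambda_{ij})$ on the projective space $P\mathbb C_{n+1}[x,y]$; put $\Gamma_H=\{H=0\}\subset\mathbb C^2$ and $\sigma=\{x=0\}$. The basic forms are $\omega_{ij}=x^{i-1}y^j\,dx$, $1\le i,j\le n$, enumerated as $\omega_1,\dots,\omega_N$. Iterated integrals are $\int_\gamma\omega_1\cdots\omega_k=\int_0^1\bigl(\int_0^{s_1}\omega_2\cdots\omega_k\bigr)\gamma^*\omega_1$, where the integral of the empty word is $1$. Suppose that $H$ has degree exactly $n+1$ and its principal homogeneous part has no multiple linear factors (this holds for every Morse-plus polynomial), that $\Gamma_H$ is smooth, and that $\Gamma_H$ intersects $\sigma$ transversally. Let $\delta_1,\dots,\delta_N$ be loops on $\Gamma_H$ with a common base point $(0,p)\in\Gamma_H\cap\sigma$ whose homology classes form a basis of $H_1(\Gamma_H,\mathbb Z)$, extended continuously to loops on the curves of the polynomials $\lambda$ near $H$, with base points $(0,p(\lambda))$ on $\sigma$ (all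 loops piecewise $C^1$). Let $$S_K(\lambda)=\Bigl\{\oint_{\delta_{j_1}\cdots\delta_{j_k}}\omega_{i_1}\cdots\omega_{i_l}\Bigr\}_{k,l=0}^K,$$ a square matrix of order $N_K=\sum_{k=0}^K N^k$, with rows indexed by the words $\omega_{i_1}\cdots\omega_{i_l}$ and columns by the words $\delta_{j_1}\cdots\delta_{j_k}$. The norm $\|P\|$ of an integer polynomial is the sum of the absolute values of its coefficients. The size (respectively the degree) of a rational function $R$ over $\mathbb Q$ is the minimum of $\|P\|+\|Q\|$ (respectively of $\deg P+\deg Q$) over all representations $R=P/Q$ by integer polynomials; the size of a matrix one-form is the sum of the sizes of all coefficients of all its entries. Coefficients of one-forms on projective spaces are taken here in homogeneous coordinates; restricting to a standard affine chart does not increase degrees and sizes. Let $B_n=P\widetilde{\mathbb C}_{n+1}[x,y]\times\mathbb CP^1$, where $\widetilde{\mathbb C}_{n+1}[x,y]$ is the space of polynomials of degree at most $n+1$ vanishing at the origin; the coordinates on $B_n$ are $\tilde\lambda=(\lambda_{ij})_{(i,j)\ne(0,0)}$ and $y$. Let $\mathrm{ev}:B_n\to P\mathbb C_{n+1}[x,y]$,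 $\mathrm{ev}(H,y)=H-H(0,y)$. **Statement.** There is an absolute constant $C$ such that for all $n,K\ge1$ there exists an $N_K\times N_K$ matrix $\Omega_K(\lambda,p)$ of one-forms on $P\mathbb C_{n+1}[x,y]$, with coefficients that are rational in $\lambda$ (over $\mathbb Q$) and polynomial in $p$, with the following properties. 1. For all $H$ and $\delta_1,\dots,\delta_N$ as above, $S_K$ is holomorphic near $H$ and satisfies there the Picard–Fuchs system $$dS_K(\lambda)=\Omega_K(\lambda,p(\lambda))\,S_K(\lambda)$$ (an identity of meromorphic forms, i.e. at all points where the coefficients of $\Omega_K$ have no pole). 2. The coefficients of $\Omega_K(\lambda,p)$ have degree at most $C\,nK$ in $p$ and degree at most $C\,K^6n^7$ in $\lambda$, and the size of $\Omega_K$ is at most $(Kn+1)^{C K^6n^5}$. 3. The pull-back $\widetilde\Omega_K=\mathrm{ev}^*\Omega_K$, with $p=y$, is a matrix of rational one-forms on $B_n$; the lifted matrix $\widetilde S_K=S_K\circ\mathrm{ev}$ is holomorphic near the point $(H-H(0,0),p)$ of $B_n$ and satisfies there $d\widetilde S_K=\widetilde\Omega_K\widetilde S_K$ (again as meromorphic forms).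 The coefficients of $\widetilde\Omega_K$ have degree at most $C\,K^6n^8$, and the size of $\widetilde\Omega_K$ is at most $(Kn+1)^{C K^6n^7}$. -/

import Mathlib

open Topology

namespace PicardFuchs

noncomputable section

/-! ## Rational functions over `ℚ`: degree, size, values -/

/-- The field `ℚ(σ)` of rational functions over `ℚ` in the variables `σ`, as fractions of integer
polynomials. -/
abbrev QRat (σ : Type) : Type := FractionRing (MvPolynomial σ ℤ)

variable {σ : Type}

/-- `r = P / Q` with integer polynomials `P`, `Q`, `Q ≠ 0`. -/
def IsQuot (r : QRat σ) (P Q : MvPolynomial σ ℤ) : Prop :=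
  Q ≠ 0 ∧ r = algebraMap (MvPolynomial σ ℤ) (QRat σ) P / algebraMap (MvPolynomial σ ℤ) (QRat σ) Q

/-- The norm of an integer polynomial: the sum of the absolute values of its coefficients. -/
def polyNorm (P : MvPolynomial σ ℤ) : ℕ := ∑ m ∈ P.support, (P.coeff m).natAbs

/-- The size of a rational function: the minimum of `‖P‖ + ‖Q‖` over all its representations
`P / Q` with integer polynomials `P`, `Q`. -/
def ratSize (r : QRat σ) : ℕ :=
  sInf {s | ∃ P Q : MvPolynomial σ ℤ, IsQuot r P Q ∧ s = polyNorm P + polyNorm Q}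

/-- The degree of a rational function with respect to the weights `ω` of the variables: the minimum
of `deg P + deg Q` over all its representations `P / Q`. -/
def ratWDegree (ω : σ → ℕ) (r : QRat σ) : ℕ :=
  sInf {s | ∃ P Q : MvPolynomial σ ℤ, IsQuot r P Q ∧
    s = MvPolynomial.weightedTotalDegree ω P + MvPolynomial.weightedTotalDegree ω Q}

/-- The degree of a rational function (all variables have weight one). -/
def ratDegree (r : QRat σ) : ℕ := ratWDegree (fun _ => 1) r

/-- `r` has no pole at the complex point `z`. -/
def RegularAt (r : QRat σ) (z : σ → ℂ) : Prop :=
  ∃ P Q : MvPolynomial σ ℤ, IsQuot r P Q ∧ MvPolynomial.aeval z Q ≠ 0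

open Classical in
/-- The value of `r` at a complex point `z` where `r` is regular (zero at other points). -/
def ratVal (r : QRat σ) (z : σ → ℂ) : ℂ :=
  if h : RegularAt r z then
    MvPolynomial.aeval z h.choose / MvPolynomial.aeval z h.choose_spec.choose
  else 0

/-- The value of a rational function does not depend on the representation. -/
theorem ratVal_eq {r : QRat σ} {z : σ → ℂ} {P Q : MvPolynomial σ ℤ}
    (h : IsQuot r P Q) (hz : MvPolynomial.aeval z Q ≠ 0) :
    ratVal r z = MvPolynomial.aeval z P / MvPolynomial.aeval z Q := by
  have hr : RegularAt r z := ⟨P, Q, h, hz⟩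
  obtain ⟨h1, h2⟩ := hr.choose_spec.choose_spec
  rw [ratVal, dif_pos hr]
  generalize hr.choose_spec.choose = Q' at h1 h2 ⊢
  generalize hr.choose = P' at h1 ⊢
  have hinj := IsFractionRing.injective (MvPolynomial σ ℤ) (QRat σ)
  have e : P' * Q = P * Q' := by
    apply hinj
    have a1 : algebraMap (MvPolynomial σ ℤ) (QRat σ) Q ≠ 0 :=
      fun h0 => h.1 (hinj (by rw [h0, map_zero]))
    have a2 : algebraMap (MvPolynomial σ ℤ) (QRat σ) Q' ≠ 0 :=
      fun h0 => h1.1 (hinj (by rw [h0, map_zero]))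
    have := h1.2.symm.trans h.2
    rw [div_eq_div_iff a2 a1] at this
    simpa using this
  rw [div_eq_div_iff h2 hz, ← map_mul, ← map_mul, e]

/-- `r` is zero or a quotient of forms `P`, `Q` with `deg P + 1 = deg Q`. -/
def IsHomogNegOne (r : QRat σ) : Prop :=
  ∃ (d : ℕ) (P Q : MvPolynomial σ ℤ), IsQuot r P Q ∧ P.IsHomogeneous d ∧ Q.IsHomogeneous (d + 1)

/-! ## Hamiltonians and their zero level curves -/

/-- Indices `(i, j)`, `i + j ≤ n + 1`, of the coefficients of a Hamiltonian of degree `≤ n + 1`. -/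
abbrev Idx (n : ℕ) : Type :=
  {α : Fin (n + 2) × Fin (n + 2) // (α.1 : ℕ) + (α.2 : ℕ) ≤ n + 1}

/-- The index of the constant term. -/
def idx00 (n : ℕ) : Idx n := ⟨(0, 0), by simp⟩

/-- The Hamiltonian `H = ∑ a_{ij} x^i y^j`; `x` and `y` are the variables `0` and `1`. -/
def ham {n : ℕ} (a : Idx n → ℂ) : MvPolynomial (Fin 2) ℂ :=
  ∑ α : Idx n, MvPolynomial.C (a α) *
    (MvPolynomial.X 0 ^ (α.1.1 : ℕ) * MvPolynomial.X 1 ^ (α.1.2 : ℕ))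

/-- The value at a point of `ℂ²`. -/
def evalAt (F : MvPolynomial (Fin 2) ℂ) (q : ℂ × ℂ) : ℂ := MvPolynomial.eval ![q.1, q.2] F

/-- The affine curve `Γ_H = {H = 0} ⊂ ℂ²`. -/
def curve {n : ℕ} (a : Idx n → ℂ) : Set (ℂ × ℂ) := {q | evalAt (ham a) q = 0}

/-- `H` has degree `n + 1` and its principal homogeneous part has no multiple linear factors. -/
def TransversalToInfinity {n : ℕ} (a : Idx n → ℂ) : Prop :=
  Squarefree (MvPolynomial.homogeneousComponent (n + 1) (ham a))

/-- The curve `{H = 0}` is smooth. -/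
def SmoothCurve {n : ℕ} (a : Idx n → ℂ) : Prop :=
  ∀ q ∈ curve a, ¬ (evalAt (MvPolynomial.pderiv 0 (ham a)) q = 0 ∧
    evalAt (MvPolynomial.pderiv 1 (ham a)) q = 0)

/-- The curve `{H = 0}` intersects the line `{x = 0}` transversally. -/
def TransversalToAxis {n : ℕ} (a : Idx n → ℂ) : Prop :=
  ∀ y : ℂ, (0, y) ∈ curve a → evalAt (MvPolynomial.pderiv 1 (ham a)) (0, y) ≠ 0

/-! ## Iterated integrals -/

/-- Iterated integral over the part `[0, s]` of a parameterized curve `c`: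
`∫ ω₁ ω₂ ⋯ ω_k = ∫_0^s (∫_0^{s₁} ω₂ ⋯ ω_k) c^* ω₁`, and the integral of the empty word is `1`. -/
def iterInt (c : ℝ → ℂ × ℂ) : List (ℂ × ℂ → (ℂ × ℂ →L[ℂ] ℂ)) → ℝ → ℂ
  | [], _ => 1
  | ω :: l, s => ∫ u in (0 : ℝ)..s, ω (c u) (deriv c u) * iterInt c l u

/-- The basic forms `x^{i-1} y^j dx`, `1 ≤ i, j ≤ n` (here `b = (i - 1, j - 1)`). -/
def basicForm {n : ℕ} (b : Fin n × Fin n) (q : ℂ × ℂ) : ℂ × ℂ →L[ℂ] ℂ :=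
  (q.1 ^ (b.1 : ℕ) * q.2 ^ ((b.2 : ℕ) + 1)) • ContinuousLinearMap.fst ℂ ℂ ℂ

/-- Words of length at most `K` in an alphabet of `N = n ^ 2` letters. -/
abbrev Word (n K : ℕ) : Type := Σ k : Fin (K + 1), (Fin (k : ℕ) → Fin n × Fin n)

/-- The word as a list of letters. -/
def Word.letters {n K : ℕ} (w : Word n K) : List (Fin n × Fin n) := List.ofFn w.2

/-- The path is piecewise continuously differentiable. -/
def PiecewiseC1 {q q' : ℂ × ℂ} (γ : Path q q') : Prop :=
  ∃ (m : ℕ) (t : ℕ → ℝ), Monotone t ∧ t 0 = 0 ∧ t m = 1 ∧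
    ∀ i < m, ContDiffOn ℝ 1 γ.extend (Set.Icc (t i) (t (i + 1)))

/-- The product of loops along a list of letters. -/
def loopProd {ι : Type} {q : ℂ × ℂ} (γ : ι → Path q q) : List ι → Path q q
  | [] => Path.refl q
  | j :: l => (γ j).trans (loopProd γ l)

/-- A loop in `ℂ²` that lies on `X`, as a loop of the space `X`. -/
def loopIn {X : Set (ℂ × ℂ)} {q : ℂ × ℂ} (hq : q ∈ X) (γ : Path q q) (h : ∀ t, γ t ∈ X) :
    Path (⟨q, hq⟩ : X) ⟨q, hq⟩ where
  toFun t := ⟨γ t, h t⟩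
  continuous_toFun := γ.continuous.subtype_mk h
  source' := by simp
  target' := by simp

/-- The first homology group `H₁(X, ℤ)` of a path connected space: the abelianized fundamental
group, written additively. -/
abbrev H1 {X : Set (ℂ × ℂ)} {q : ℂ × ℂ} (hq : q ∈ X) : Type :=
  Additive (Abelianization (FundamentalGroup X (⟨q, hq⟩ : X)))

/-- The homology class of a loop lying on `X`. -/
def homologyClass {X : Set (ℂ × ℂ)} {q : ℂ × ℂ} (hq : q ∈ X) (γ : Path q q)
    (h : ∀ t, γ t ∈ X) : H1 hq :=
  Additive.ofMul (Abelianization.of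
    (FundamentalGroup.fromPath (Path.Homotopic.Quotient.mk (loopIn hq γ h))))

/-- Loops `δ_1, …, δ_N`, `N = n ^ 2`, on the curve `{H = 0}`, based at a point of its intersection
with the line `{x = 0}`, whose homology classes form a basis of `H₁`, together with their continuous
extension to the curves of the Hamiltonians near `H`. -/
structure CycleFamily {n : ℕ} (a : Idx n → ℂ) where
  /-- the neighborhood of `H` -/
  U : Set (Idx n → ℂ)
  isOpen_U : IsOpen U
  mem_U : a ∈ U
  /-- the base point `(0, p)` as a function of the Hamiltonian -/
  base : (Idx n → ℂ) → ℂ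
  /-- the loops -/
  loop : Fin n × Fin n → (b : Idx n → ℂ) → Path ((0 : ℂ), base b) ((0 : ℂ), base b)
  base_mem : ∀ b ∈ U, ((0 : ℂ), base b) ∈ curve b
  loop_mem : ∀ j, ∀ b ∈ U, ∀ t, loop j b t ∈ curve b
  continuousOn_loop : ∀ j, ContinuousOn
    (fun z : (Idx n → ℂ) × unitInterval => loop j z.1 z.2) (U ×ˢ Set.univ)
  piecewiseC1_loop : ∀ j, ∀ b ∈ U, PiecewiseC1 (loop j b)
  linearIndependent_loop :
    LinearIndependent ℤ
      (fun j => homologyClass (base_mem a mem_U) (loop j a) (loop_mem j a mem_U))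
  span_loop :
    Submodule.span ℤ (Set.range fun j =>
      homologyClass (base_mem a mem_U) (loop j a) (loop_mem j a mem_U)) = ⊤

/-- The matrix `S_K` of basic iterated integrals of length at most `K`: the entry in the row
`ω_{i_1} ⋯ ω_{i_l}` and the column `δ_{j_1} ⋯ δ_{j_k}` is the integral of the former over the
latter. -/
def CycleFamily.S {n : ℕ} {a : Idx n → ℂ} (F : CycleFamily a) (K : ℕ) (b : Idx n → ℂ) :
    Matrix (Word n K) (Word n K) ℂ :=
  Matrix.of fun w v =>
    iterInt (loopProd (fun j => F.loop j b) v.letters).extend (w.letters.map basicForm) 1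

/-! ## Matrix one-forms in `λ`, rational in `λ` and polynomial in `p` -/

/-- Matrix one-forms `∑ Ω_α dλ_α` in the coefficients `λ` of the Hamiltonian; the entries of the
`Ω_α` are polynomials in `p` over `ℚ(λ)`. -/
abbrev MatForm (n K : ℕ) : Type :=
  Idx n → Matrix (Word n K) (Word n K) (Polynomial (QRat (Idx n)))

/-- The form is (the pull-back to the space of nonzero Hamiltonians of) a form on its
projectivization: its coefficients are homogeneous of degree `-1` in `λ` and its contraction with
the Euler field `∑ λ_α ∂/∂λ_α` vanishes. -/
def MatForm.IsProjective {n K : ℕ} (Ω : MatForm n K) : Prop :=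
  (∀ α w u k, IsHomogNegOne ((Ω α w u).coeff k)) ∧
  ∀ w u, ∑ α : Idx n, Polynomial.C (algebraMap (MvPolynomial (Idx n) ℤ) (QRat (Idx n))
    (MvPolynomial.X α)) * Ω α w u = 0

/-- The coefficients of the form have no pole at `b`. -/
def MatForm.Regular {n K : ℕ} (Ω : MatForm n K) (b : Idx n → ℂ) : Prop :=
  ∀ α w u k, RegularAt ((Ω α w u).coeff k) b

/-- The value of a polynomial in `p` over `ℚ(λ)` at complex `λ = b` and `p`. -/
def polyVal {n : ℕ} (f : Polynomial (QRat (Idx n))) (b : Idx n → ℂ) (p : ℂ) : ℂ :=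
  f.sum fun k r => ratVal r b * p ^ k

/-- The inclusion `ℚ(λ) → ℚ(λ, p)`; the variable `p` is `none`. -/
def inclRat (n : ℕ) : QRat (Idx n) →+* QRat (Option (Idx n)) :=
  IsFractionRing.map
    (j := (MvPolynomial.rename (R := ℤ) (some : Idx n → Option (Idx n))).toRingHom)
    (MvPolynomial.rename_injective _ (Option.some_injective _))

/-- The inclusion `ℚ(λ)[p] → ℚ(λ, p)`. -/
def toRat (n : ℕ) : Polynomial (QRat (Idx n)) →+* QRat (Option (Idx n)) :=
  Polynomial.eval₂RingHom (inclRat n)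
    (algebraMap (MvPolynomial (Option (Idx n)) ℤ) _ (MvPolynomial.X none))

/-- The weights counting the degree in `λ` only. -/
def lamWeight (n : ℕ) : Option (Idx n) → ℕ := fun o => if o = none then 0 else 1

/-- The degree in `λ` of an element of `ℚ(λ)[p]`. -/
def lamDegree {n : ℕ} (f : Polynomial (QRat (Idx n))) : ℕ := ratWDegree (lamWeight n) (toRat n f)

/-- The size of a matrix form: the sum of the sizes of the coefficients of its entries. -/
def MatForm.size {n K : ℕ} (Ω : MatForm n K) : ℕ :=
  ∑ α, ∑ w, ∑ u, ratSize (toRat n (Ω α w u))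

/-! ## Lifting to `B_n` -/

/-- The coordinates on `B_n`: the coefficients `λ̃` of a Hamiltonian vanishing at the origin
(homogeneous coordinates), and the coordinate `y`, which is `none`, on the line `{x = 0}`. -/
abbrev BIdx (n : ℕ) : Type := Option {α : Idx n // α ≠ idx00 n}

/-- The components of the map `ev : (H, y) ↦ H - H(0, y)`. -/
def evPoly {n : ℕ} (α : Idx n) : MvPolynomial (BIdx n) ℤ :=
  if h : α = idx00 n then
    - ∑ γ : {γ : Idx n // γ ≠ idx00 n}, if (γ.1.1.1 : ℕ) = 0 then
        MvPolynomial.X (some γ) * MvPolynomial.X none ^ (γ.1.1.2 : ℕ) else 0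
  else MvPolynomial.X (some ⟨α, h⟩)

/-- The map `ev : (H, y) ↦ H - H(0, y)` on points. -/
def ev {n : ℕ} (z : BIdx n → ℂ) : Idx n → ℂ := fun α => MvPolynomial.aeval z (evPoly α)

/-- The point `(H - H(0, 0), p)` of `B_n`. -/
def liftPoint {n : ℕ} (a : Idx n → ℂ) (p : ℂ) : BIdx n → ℂ
  | none => p
  | some α => a α.1

/-- Substitution of `ev` in polynomials. -/
def evHom (n : ℕ) : MvPolynomial (Idx n) ℤ →ₐ[ℤ] MvPolynomial (BIdx n) ℤ :=
  MvPolynomial.aeval evPoly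

theorem evHom_injective (n : ℕ) : Function.Injective (evHom n) := by
  rw [injective_iff_map_eq_zero]
  intro P hP
  let e : Idx n := ⟨(0, 1), by simp⟩
  have he : e ≠ idx00 n := by
    intro h
    have := congrArg (fun α : Idx n => (α.1.2 : ℕ)) h
    simp [e, idx00] at this
  have key : ∀ a : Idx n → ℂ, a e ≠ 0 → MvPolynomial.aeval a P = 0 := by
    intro a ha
    let h : Polynomial ℂ := Polynomial.C (a (idx00 n)) +
      ∑ γ : {γ : Idx n // γ ≠ idx00 n}, if (γ.1.1.1 : ℕ) = 0 then
        Polynomial.C (a γ.1) * Polynomial.X ^ (γ.1.1.2 : ℕ) else 0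
    have hc : h.coeff 1 = a e := by
      simp only [h, Polynomial.coeff_add, Polynomial.finsetSum_coeff, Polynomial.coeff_C]
      rw [Finset.sum_eq_single ⟨e, he⟩]
      · simp [e]
      · intro γ _ hγ
        split_ifs with h0
        · rw [Polynomial.coeff_C_mul_X_pow, if_neg]
          intro h1
          apply hγ
          apply Subtype.ext
          apply Subtype.ext
          apply Prod.ext
          · apply Fin.ext
            simpa [e] using h0
          · apply Fin.ext
            simpa [e] using h1.symm
        · simp
      · simp
    have hd : h.degree ≠ 0 := by
      intro h0
      apply ha
      rw [← hc]
      exact Polynomial.coeff_eq_zero_of_degree_lt (by rw [h0]; norm_num)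
    obtain ⟨y, hy⟩ := IsAlgClosed.exists_root h hd
    have hev : ev (liftPoint a y) = a := by
      funext α
      by_cases hα : α = idx00 n
      · subst hα
        have : a (idx00 n) + ∑ γ : {γ : Idx n // γ ≠ idx00 n}, (if (γ.1.1.1 : ℕ) = 0 then
            a γ.1 * y ^ (γ.1.1.2 : ℕ) else 0) = 0 := by
          have := hy
          simp only [h, Polynomial.IsRoot.def, Polynomial.eval_add, Polynomial.eval_C,
            Polynomial.eval_finsetSum] at this
          refine Eq.trans ?_ this
          congr 1
          apply Finset.sum_congr rfl
          intro γ _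
          by_cases h0 : (γ.1.1.1 : ℕ) = 0
          · rw [if_pos h0, if_pos h0]
            simp
          · rw [if_neg h0, if_neg h0]
            simp
        rw [ev, evPoly, dif_pos rfl, map_neg, map_sum, eq_comm, ← add_eq_zero_iff_eq_neg, ← this]
        congr 1
        apply Finset.sum_congr rfl
        intro γ _
        split_ifs <;> simp [liftPoint]
      · simp [ev, evPoly, hα, liftPoint]
    have h2 : MvPolynomial.aeval (liftPoint a y) (evHom n P) = MvPolynomial.aeval a P := by
      have : (MvPolynomial.aeval (liftPoint a y)).comp (evHom n) =
          (MvPolynomial.aeval a : MvPolynomial (Idx n) ℤ →ₐ[ℤ] ℂ) := by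
        apply MvPolynomial.algHom_ext
        intro α
        simp only [AlgHom.comp_apply, evHom, MvPolynomial.aeval_X]
        exact congrFun hev α
      exact DFunLike.congr_fun this P
    rw [← h2, hP, map_zero]
  have hz : P * MvPolynomial.X e = 0 := by
    apply MvPolynomial.map_injective (Int.castRingHom ℂ) Int.cast_injective
    rw [map_zero]
    apply MvPolynomial.funext
    intro a
    rw [map_zero, MvPolynomial.eval_map, MvPolynomial.eval₂_mul, MvPolynomial.eval₂_X]
    by_cases ha : a e = 0
    · rw [ha, mul_zero]
    · have := key a ha
      rw [MvPolynomial.aeval_def] at this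
      have h3 : algebraMap ℤ ℂ = Int.castRingHom ℂ := rfl
      rw [← h3, this, zero_mul]
  rcases mul_eq_zero.mp hz with h | h
  · exact h
  · exact absurd h (MvPolynomial.X_ne_zero e)

/-- Substitution of `ev` in rational functions of `λ`. -/
def evRat (n : ℕ) : QRat (Idx n) →+* QRat (BIdx n) :=
  IsFractionRing.map (j := (evHom n).toRingHom) (evHom_injective n)

/-- Substitution of `ev` for `λ` and of `y` for the base point `p`. -/
def evCoeff (n : ℕ) : Polynomial (QRat (Idx n)) →+* QRat (BIdx n) :=
  Polynomial.eval₂RingHom (evRat n)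
    (algebraMap (MvPolynomial (BIdx n) ℤ) _ (MvPolynomial.X none))

/-- Matrix one-forms on `B_n` with rational coefficients. -/
abbrev MatFormB (n K : ℕ) : Type :=
  BIdx n → Matrix (Word n K) (Word n K) (QRat (BIdx n))

/-- The pull-back `ev^* Ω`: `dλ_α` is replaced by `∑_β (∂ ev_α / ∂ z_β) dz_β`. -/
def MatForm.pullback {n K : ℕ} (Ω : MatForm n K) : MatFormB n K := fun β =>
  Matrix.of fun w u => ∑ α : Idx n,
    evCoeff n (Ω α w u) * algebraMap _ _ (MvPolynomial.pderiv β (evPoly α))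

/-- The coefficients of the form have no pole at `z`. -/
def MatFormB.Regular {n K : ℕ} (Θ : MatFormB n K) (z : BIdx n → ℂ) : Prop :=
  ∀ β w u, RegularAt (Θ β w u) z

/-- The size of a matrix form: the sum of the sizes of the coefficients of its entries. -/
def MatFormB.size {n K : ℕ} (Θ : MatFormB n K) : ℕ := ∑ β, ∑ w, ∑ u, ratSize (Θ β w u)

/-! ## Picard–Fuchs systems -/

/-- `S` is holomorphic near `b₀` and `dS = Ω S` there with `p = p(λ)` (at all points near `b₀` at
which the coefficients of `Ω` have no pole; these are dense). -/
def SolvesNear {n K : ℕ} (Ω : MatForm n K) (p : (Idx n → ℂ) → ℂ)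
    (S : (Idx n → ℂ) → Matrix (Word n K) (Word n K) ℂ) (b₀ : Idx n → ℂ) : Prop :=
  ∀ᶠ b in 𝓝 b₀, ∀ w v, DifferentiableAt ℂ (fun b' => S b' w v) b ∧
    (Ω.Regular b → HasFDerivAt (fun b' => S b' w v)
      (∑ α, (∑ u, polyVal (Ω α w u) b (p b) * S b u v) •
        (ContinuousLinearMap.proj α : (Idx n → ℂ) →L[ℂ] ℂ)) b)

/-- `S` is holomorphic near `z₀` and `dS = Θ S` there (at all points near `z₀` at which the
coefficients of `Θ` have no pole; these are dense). -/
def SolvesNearB {n K : ℕ} (Θ : MatFormB n K)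
    (S : (BIdx n → ℂ) → Matrix (Word n K) (Word n K) ℂ) (z₀ : BIdx n → ℂ) : Prop :=
  ∀ᶠ z in 𝓝 z₀, ∀ w v, DifferentiableAt ℂ (fun z' => S z' w v) z ∧
    (Θ.Regular z → HasFDerivAt (fun z' => S z' w v)
      (∑ β, (∑ u, ratVal (Θ β w u) z * S z u v) •
        (ContinuousLinearMap.proj β : (BIdx n → ℂ) →L[ℂ] ℂ)) z)

end

end PicardFuchs

open PicardFuchs

namespace PicardFuchs

noncomputable section

/-! Follow an iterated integral from the base point to a moving end point `q` of the curve over `b`.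
This gives functions `G w (b, q)`, one for each word, with `dG (i :: w) = f i dx · G w` along the
curve. One looks for coefficients `A w u q`, polynomial in `q`, such that in a direction `v` of the
parameter space the derivative of `G w` is `∑ A w u · G u` plus the contribution of the moving end
point. If `A` satisfies the linear equation in `FlatData` (flatness of the connection), the error of
this formula satisfies the same triangular system along the curve as the primitives themselves
(`hasDerivAt_chartDefect`), so it stays zero once it is zero. It is zero at the start: the base
point moves on `x = 0`, the integrals of nonempty words vanish there, and `A w []` is normalised to
vanish there. Continuation through charts along the loop (`contDiffAt_iterInt`) brings the end point
back to the base point, where `dx` contributes nothing; hence the derivative of `S w` is `∑ A w u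
(0, p) · S u`, and the connection matrix is the value of `A` at the base point.

To construct `A`, note that a tangent vector of the curve is a multiple of `(H_y, -H_x)`. Flatness
thus becomes an identity modulo `H` between polynomials, in which the bracket with `H` plays the
role of the exterior derivative and `f j · H_y` that of the basic form. The algebraic input is that
for a polynomial `h` one has `L(λ) h = ∑ c_j f_j H_y + {f, H} + q H`, with `c_j` independent of `x,
y`. Here `L` is a product of minors of matrices of linear forms in `λ`; they are chosen nonzero
because the matrices have full row rank at `x^(n+1) + y^(n+1) - 1` (`monVec_mem_fermatSpan`).
Iterating this division over a word (`exists_integral`) and recursing on the length of `w`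
(`exists_coefficients`) gives numerators for `A w u` over the denominator `L ^ expo |w|`.

The bounds come from bookkeeping. The degree in `p, x, y` grows by at most `9n` per letter, so only
right hand sides of degree at most `9nK` occur. Then `L` has degree `O((nK)^3)`, the exponent `expo
K` is at most `K^2`, and the degrees in `λ` are `O(n^3 K^5)`. Norms are powers of `Kn + 1` with
exponent `O(n^3 K^6)`.

Multiplying `H` by a constant does not move the curve, so the derivative of `S` in the direction `λ`
itself is zero. This allows the coefficient of `dλ_00` to be computed from the others, at the price
of a factor `λ_00` in the denominator, and makes the form projective. The system, proved where the
common denominator is nonzero, extends by continuity to all points where the coefficients are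
regular. On `B_n` it is the chain rule, together with `p(ev(z)) = y`, which holds because both sides
are roots of the same polynomial near a simple root. -/

section

/-! ### Integrals and primitives depending on parameters -/

open Metric in
/-- A continuous function near a compact segment times a point is uniformly bounded near it. -/
theorem exists_bound_near_segment {E V : Type} [TopologicalSpace E] [NormedAddCommGroup V]
    {G : ℂ × E → V} {e₀ : E}
    (h : ∀ s ∈ Set.Icc (0 : ℝ) 1, ContinuousAt G ((s : ℂ), e₀)) :
    ∃ C : ℝ, ∀ᶠ e in 𝓝 e₀, ∀ s ∈ Set.Icc (0 : ℝ) 1, ‖G ((s : ℂ), e)‖ ≤ C := by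
  have hc : ContinuousOn (fun s : ℝ => G ((s : ℂ), e₀)) (Set.Icc 0 1) := by
    intro s hs
    exact (ContinuousAt.comp (f := fun s : ℝ => ((s : ℂ), e₀)) (h s hs)
      (by fun_prop)).continuousWithinAt
  obtain ⟨C, hC⟩ := isCompact_Icc.exists_bound_of_continuousOn hc
  refine ⟨C + 1, ?_⟩
  apply isCompact_Icc.eventually_forall_of_forall_eventually
  intro s hs
  have h1 : ContinuousAt (fun z : E × ℝ => ‖G ((z.2 : ℂ), z.1)‖) (e₀, s) := by
    apply ContinuousAt.norm
    exact ContinuousAt.comp (f := fun z : E × ℝ => ((z.2 : ℂ), z.1)) (h s hs) (by fun_prop)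
  have h2 := h1.eventually (gt_mem_nhds (lt_of_le_of_lt (hC s hs) (lt_add_one C)))
  filter_upwards [h2] with z hz
  exact hz.le

/-- Differentiation under the integral sign gives an integral of the same kind with values in `E
→L[ℂ] V`, so the induction on `n` has to quantify over `V`. The integrand is a function of a complex
`s`, so that its smoothness is a condition over `ℂ` on an open set. -/
theorem contDiffOn_integral_segment {E : Type} [NormedAddCommGroup E] [NormedSpace ℂ E]
    {S : Set (ℂ × E)} (hS : IsOpen S) {W : Set E} (hW : IsOpen W)
    (hSW : ∀ s ∈ Set.Icc (0 : ℝ) 1, ∀ e ∈ W, ((s : ℂ), e) ∈ S) (n : ℕ) :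
    ∀ {V : Type} [NormedAddCommGroup V] [NormedSpace ℂ V] [CompleteSpace V]
      {G : ℂ × E → V}, ContDiffOn ℂ n G S →
      ContDiffOn ℂ n (fun e => ∫ s in (0 : ℝ)..1, G ((s : ℂ), e)) W := by
  have cont : ∀ {V : Type} [NormedAddCommGroup V] [NormedSpace ℂ V]
      {G : ℂ × E → V}, ContinuousOn G S → ∀ e ∈ W,
      ContinuousOn (fun s : ℝ => G ((s : ℂ), e)) (Set.uIcc 0 1) := by
    intro V _ _ G hG e he s hs
    rw [Set.uIcc_of_le zero_le_one] at hs
    exact (ContinuousAt.comp (f := fun s : ℝ => ((s : ℂ), e))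
      (hG.continuousAt (hS.mem_nhds (hSW s hs e he))) (by fun_prop)).continuousWithinAt
  induction n with
  | zero =>
    intro V _ _ _ G hG
    simp only [Nat.cast_zero, contDiffOn_zero] at hG ⊢
    intro e he
    apply ContinuousAt.continuousWithinAt
    obtain ⟨C, hC⟩ := exists_bound_near_segment (G := G) (e₀ := e)
      (fun s hs => hG.continuousAt (hS.mem_nhds (hSW s hs e he)))
    apply intervalIntegral.continuousAt_of_dominated_interval (bound := fun _ => C)
    · filter_upwards [hW.mem_nhds he] with e' he'
      exact (cont hG e' he').intervalIntegrable.def'.aestronglyMeasurable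
    · filter_upwards [hC] with e' he'
      refine Filter.Eventually.of_forall fun s hs => he' s ?_
      rw [Set.uIoc_of_le zero_le_one] at hs
      exact ⟨hs.1.le, hs.2⟩
    · exact intervalIntegrable_const
    · refine Filter.Eventually.of_forall fun s hs => ?_
      rw [Set.uIoc_of_le zero_le_one] at hs
      exact ContinuousAt.comp (f := fun e : E => ((s : ℂ), e))
        (hG.continuousAt (hS.mem_nhds (hSW s ⟨hs.1.le, hs.2⟩ e he))) (by fun_prop)
  | succ n ih =>
    intro V _ _ _ G hG
    rw [Nat.cast_add, Nat.cast_one] at hG ⊢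
    let G' : ℂ × E → (E →L[ℂ] V) := fun x => (fderiv ℂ G x).comp (ContinuousLinearMap.inr ℂ ℂ E)
    have hG' : ContDiffOn ℂ n G' S := by
      have := ((contDiffOn_succ_iff_fderiv_of_isOpen hS).1 hG).2.2
      exact this.clm_comp contDiffOn_const
    have hd : ∀ s ∈ Set.Icc (0 : ℝ) 1, ∀ e ∈ W,
        HasFDerivAt (fun e => G ((s : ℂ), e)) (G' ((s : ℂ), e)) e := by
      intro s hs e he
      have h1 : HasFDerivAt G (fderiv ℂ G ((s : ℂ), e)) ((s : ℂ), e) :=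
        ((hG.differentiableOn (by simp)).differentiableAt
          (hS.mem_nhds (hSW s hs e he))).hasFDerivAt
      exact HasFDerivAt.comp e h1 (hasFDerivAt_prodMk_right (s : ℂ) e)
    have key : ∀ e ∈ W, HasFDerivAt (fun e => ∫ s in (0 : ℝ)..1, G ((s : ℂ), e))
        (∫ s in (0 : ℝ)..1, G' ((s : ℂ), e)) e := by
      intro e he
      obtain ⟨C, hC⟩ := exists_bound_near_segment (G := G') (e₀ := e)
        (fun s hs => hG'.continuousOn.continuousAt (hS.mem_nhds (hSW s hs e he)))
      have hn := hC.and (hW.mem_nhds he)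
      refine (intervalIntegral.hasFDerivAt_integral_of_dominated_of_fderiv_le
        (F := fun e s => G ((s : ℂ), e))
        (F' := fun e s => G' ((s : ℂ), e)) (bound := fun _ => C) hn ?_ ?_ ?_ ?_ ?_ ?_)
      · filter_upwards [hW.mem_nhds he] with e' he'
        exact (cont hG.continuousOn e' he').intervalIntegrable.def'.aestronglyMeasurable
      · exact (cont hG.continuousOn e he).intervalIntegrable
      · exact (cont hG'.continuousOn e he).intervalIntegrable.def'.aestronglyMeasurable
      · refine Filter.Eventually.of_forall fun s hs e' he' => he'.1 s ?_
        rw [Set.uIoc_of_le zero_le_one] at hs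
        exact ⟨hs.1.le, hs.2⟩
      · exact intervalIntegrable_const
      · refine Filter.Eventually.of_forall fun s hs e' he' => ?_
        rw [Set.uIoc_of_le zero_le_one] at hs
        exact hd s ⟨hs.1.le, hs.2⟩ e' he'.2
    rw [contDiffOn_succ_iff_fderiv_of_isOpen hW]
    refine ⟨fun e he => (key e he).differentiableAt.differentiableWithinAt, by simp, ?_⟩
    exact (ih hG').congr fun e he => (key e he).fderiv

/-- The primitive in the last variable that vanishes at `z₀`. -/
def primitiveFrom {B : Type} (z₀ : ℂ) (F : B × ℂ → ℂ) (e : B × ℂ) : ℂ :=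
  ∫ s in (0 : ℝ)..1, (e.2 - z₀) * F (e.1, z₀ + s * (e.2 - z₀))

theorem primitiveFrom_self {B : Type} (z₀ : ℂ) (F : B × ℂ → ℂ) (b : B) :
    primitiveFrom z₀ F (b, z₀) = 0 := by simp [primitiveFrom]

theorem segment_mem_ball {R : ℝ} {z₀ z : ℂ} (h₀ : z₀ ∈ Metric.ball (0 : ℂ) R)
    (h : z ∈ Metric.ball (0 : ℂ) R) {s : ℝ} (hs : s ∈ Set.Icc (0 : ℝ) 1) :
    z₀ + s * (z - z₀) ∈ Metric.ball (0 : ℂ) R := by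
  have := (convex_ball (0 : ℂ) R).add_smul_sub_mem h₀ h hs
  simpa using this

/-- The segment from `z₀` to `z` is parameterized by the fixed interval, so the end point `z` is
just one more parameter of `contDiffOn_integral_segment`. -/
theorem contDiffOn_primitiveFrom {B : Type} [NormedAddCommGroup B] [NormedSpace ℂ B]
    {U : Set B} (hU : IsOpen U) {R : ℝ} {z₀ : ℂ} (h₀ : z₀ ∈ Metric.ball (0 : ℂ) R)
    {F : B × ℂ → ℂ} {n : ℕ} (hF : ContDiffOn ℂ n F (U ×ˢ Metric.ball 0 R)) :
    ContDiffOn ℂ n (primitiveFrom z₀ F) (U ×ˢ Metric.ball 0 R) := by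
  let φ : ℂ × (B × ℂ) → B × ℂ := fun x => (x.2.1, z₀ + x.1 * (x.2.2 - z₀))
  have hφ : ContDiff ℂ n φ := by fun_prop
  have hW : IsOpen (U ×ˢ Metric.ball (0 : ℂ) R) := hU.prod Metric.isOpen_ball
  apply contDiffOn_integral_segment (S := φ ⁻¹' (U ×ˢ Metric.ball 0 R))
    (G := fun x => (x.2.2 - z₀) * F (φ x)) (hW.preimage hφ.continuous) hW
  · rintro s hs ⟨b, z⟩ ⟨hb, hz⟩
    exact ⟨hb, segment_mem_ball h₀ hz hs⟩
  · apply ContDiffOn.mul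
    · fun_prop
    · exact hF.comp hφ.contDiffOn fun x hx => hx

/-- A holomorphic function on a disc has a primitive, and the fundamental theorem of calculus along
the segment identifies `primitiveFrom` with its increment. -/
theorem hasDerivAt_primitiveFrom {B : Type} {R : ℝ} {z₀ : ℂ} (h₀ : z₀ ∈ Metric.ball (0 : ℂ) R)
    {F : B × ℂ → ℂ} {b : B} (hF : DifferentiableOn ℂ (fun z => F (b, z)) (Metric.ball 0 R))
    {z : ℂ} (hz : z ∈ Metric.ball (0 : ℂ) R) :
    HasDerivAt (fun z => primitiveFrom z₀ F (b, z)) (F (b, z)) z := by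
  obtain ⟨Q, hQ⟩ := hF.isExactOn_ball
  have key : ∀ z ∈ Metric.ball (0 : ℂ) R, primitiveFrom z₀ F (b, z) = Q z - Q z₀ := by
    intro z hz
    have h1 : ∀ s ∈ Set.uIcc (0 : ℝ) 1, HasDerivAt (fun s : ℝ => Q (z₀ + s * (z - z₀)))
        ((z - z₀) * F (b, z₀ + s * (z - z₀))) s := by
      intro s hs
      rw [Set.uIcc_of_le zero_le_one] at hs
      have h2 := hQ _ (segment_mem_ball h₀ hz hs)
      have h3 : HasDerivAt (fun s : ℝ => z₀ + (s : ℂ) * (z - z₀)) (z - z₀) s := by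
        have := ((Complex.ofRealCLM.hasDerivAt (x := s)).mul_const (z - z₀)).const_add z₀
        simpa using this
      have := HasDerivAt.scomp s h2 h3
      simpa [mul_comm, Function.comp_def] using this
    have h4 : ContinuousOn (fun s : ℝ => (z - z₀) * F (b, z₀ + s * (z - z₀))) (Set.uIcc 0 1) := by
      apply ContinuousOn.mul continuousOn_const
      rw [Set.uIcc_of_le zero_le_one]
      exact hF.continuousOn.comp (f := fun s : ℝ => z₀ + (s : ℂ) * (z - z₀)) (by fun_prop)
        fun s hs => segment_mem_ball h₀ hz hs
    have := intervalIntegral.integral_eq_sub_of_hasDerivAt h1 h4.intervalIntegrable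
    simpa [primitiveFrom] using this
  have h5 : HasDerivAt (fun z => Q z - Q z₀) (F (b, z)) z := (hQ z hz).sub_const _
  refine h5.congr_of_eventuallyEq ?_
  filter_upwards [Metric.isOpen_ball.mem_nhds hz] with z' hz' using key z' hz'

end

section

/-! ## Charts on a family of curves -/

theorem ball_prod_ball_mem_nhds {B : Type} [NormedAddCommGroup B] {b₀ : B} {r R : ℝ} {e : B × ℂ}
    (he : e ∈ Metric.ball b₀ r ×ˢ Metric.ball (0 : ℂ) R) :
    Metric.ball b₀ r ×ˢ Metric.ball (0 : ℂ) R ∈ 𝓝 e :=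
  (Metric.isOpen_ball.prod Metric.isOpen_ball).mem_nhds he

variable {B : Type} [NormedAddCommGroup B] [NormedSpace ℂ B]

/-- The Jacobian of `(h(b, ·), ζ)` at the point `e`. -/
def chartDet (h : B × (ℂ × ℂ) → ℂ) (ζ : ℂ × ℂ →L[ℂ] ℂ) (e : B × (ℂ × ℂ)) : ℂ :=
  fderiv ℂ h e (0, (1, 0)) * ζ (0, 1) - fderiv ℂ h e (0, (0, 1)) * ζ (1, 0)

/-- Cramer's rule for two linear equations in two unknowns. -/
theorem eq_zero_of_chartDet_ne_zero {h : B × (ℂ × ℂ) → ℂ} {ζ : ℂ × ℂ →L[ℂ] ℂ}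
    {e : B × (ℂ × ℂ)} (hd : chartDet h ζ e ≠ 0) {η : ℂ × ℂ} (h1 : fderiv ℂ h e (0, η) = 0)
    (h2 : ζ η = 0) : η = 0 := by
  obtain ⟨x, y⟩ := η
  have e0 : ((x, y) : ℂ × ℂ) = x • ((1, 0) : ℂ × ℂ) + y • ((0, 1) : ℂ × ℂ) := by simp
  have e1 : ((0 : B), ((x, y) : ℂ × ℂ)) = x • ((0 : B), ((1, 0) : ℂ × ℂ)) +
      y • ((0 : B), ((0, 1) : ℂ × ℂ)) := by simp
  rw [e0, map_add, map_smul, map_smul, smul_eq_mul, smul_eq_mul] at h2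
  rw [e1, map_add, map_smul, map_smul, smul_eq_mul, smul_eq_mul] at h1
  unfold chartDet at hd
  set p := fderiv ℂ h e (0, (1, 0))
  set q := fderiv ℂ h e (0, (0, 1))
  have hx : x * (p * ζ (0, 1) - q * ζ (1, 0)) = 0 := by linear_combination ζ (0, 1) * h1 - q * h2
  have hy : y * (p * ζ (0, 1) - q * ζ (1, 0)) = 0 := by linear_combination p * h2 - ζ (1, 0) * h1
  rw [mul_eq_zero, or_iff_left hd] at hx hy
  simp [hx, hy]

/-- At a smooth point of the curve one of the functions `x`, `y` is a local coordinate. -/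
theorem exists_chartDet_ne_zero {h : B × (ℂ × ℂ) → ℂ} {e : B × (ℂ × ℂ)}
    (hd : ¬ (fderiv ℂ h e (0, (1, 0)) = 0 ∧ fderiv ℂ h e (0, (0, 1)) = 0)) :
    ∃ ζ : ℂ × ℂ →L[ℂ] ℂ, chartDet h ζ e ≠ 0 := by
  by_cases hx : fderiv ℂ h e (0, (1, 0)) = 0
  · refine ⟨ContinuousLinearMap.fst ℂ ℂ ℂ, ?_⟩
    simpa [chartDet] using fun h' => hd ⟨hx, h'⟩
  · exact ⟨ContinuousLinearMap.snd ℂ ℂ ℂ, by simpa [chartDet] using hx⟩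

/-- `σ(b, ·)` parameterizes the curve `{h(b, ·) = 0}` near `q₀` by the coordinate `ζ(q - q₀)`. -/
structure IsChart (h : B × (ℂ × ℂ) → ℂ) (ζ : ℂ × ℂ →L[ℂ] ℂ) (b₀ : B) (q₀ : ℂ × ℂ)
    (σ : B × ℂ → ℂ × ℂ) (r R : ℝ) : Prop where
  r_pos : 0 < r
  R_pos : 0 < R
  contDiffOn : ContDiffOn ℂ 3 σ (Metric.ball b₀ r ×ˢ Metric.ball 0 R)
  h_eq : ∀ e ∈ Metric.ball b₀ r ×ˢ Metric.ball (0 : ℂ) R, h (e.1, σ e) = 0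
  coord : ∀ e ∈ Metric.ball b₀ r ×ˢ Metric.ball (0 : ℂ) R, ζ (σ e - q₀) = e.2
  det : ∀ e ∈ Metric.ball b₀ r ×ˢ Metric.ball (0 : ℂ) R, chartDet h ζ (e.1, σ e) ≠ 0
  surj : ∀ᶠ e in 𝓝 (b₀, q₀), h e = 0 → e.1 ∈ Metric.ball b₀ r ∧
    ζ (e.2 - q₀) ∈ Metric.ball (0 : ℂ) R ∧ e.2 = σ (e.1, ζ (e.2 - q₀))

/-- The implicit function theorem for the pair of equations `h (b, q) = 0`, `ζ (q - q₀) = z` with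
unknown `q` and parameters `(b, z)`; its Jacobian is `chartDet`. Uniqueness of the solution becomes
the field `surj`: the chart contains every point of the nearby curves that is close to `q₀`. -/
theorem exists_isChart [CompleteSpace B] {h : B × (ℂ × ℂ) → ℂ} (hh : ContDiff ℂ 4 h)
    {ζ : ℂ × ℂ →L[ℂ] ℂ} {b₀ : B} {q₀ : ℂ × ℂ} (h0 : h (b₀, q₀) = 0)
    (hd : chartDet h ζ (b₀, q₀) ≠ 0) :
    ∃ σ r R, IsChart h ζ b₀ q₀ σ r R := by
  let F : (B × ℂ) × (ℂ × ℂ) → ℂ × ℂ := fun x => (h (x.1.1, x.2), ζ (x.2 - q₀) - x.1.2)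
  have hF : ContDiff ℂ 4 F := by
    have : ContDiff ℂ 4 (fun x : (B × ℂ) × (ℂ × ℂ) => h (x.1.1, x.2)) := by
      exact hh.comp (by fun_prop)
    fun_prop
  let u : (B × ℂ) × (ℂ × ℂ) := ((b₀, 0), q₀)
  have hFu : F u = 0 := by simp [F, u, h0]
  have cdf : ContDiffAt ℂ 4 F u := hF.contDiffAt
  let T : ℂ × ℂ →L[ℂ] ℂ × ℂ := ((fderiv ℂ h (b₀, q₀)).comp (ContinuousLinearMap.inr ℂ B (ℂ × ℂ))).prod ζ
  have hT : fderiv ℂ F u ∘L .inr ℂ (B × ℂ) (ℂ × ℂ) = T := by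
    have h1 : HasFDerivAt F (fderiv ℂ F u) u := (hF.differentiable (by simp) u).hasFDerivAt
    have h2 : HasFDerivAt (fun q => F ((b₀, 0), q)) (fderiv ℂ F u ∘L .inr ℂ (B × ℂ) (ℂ × ℂ)) q₀ :=
      HasFDerivAt.comp (g := F) q₀ h1 (hasFDerivAt_prodMk_right (b₀, (0 : ℂ)) q₀)
    have h3 : HasFDerivAt (fun q => F ((b₀, 0), q)) T q₀ := by
      apply HasFDerivAt.prodMk
      · exact HasFDerivAt.comp (g := h) q₀ (hh.differentiable (by simp) _).hasFDerivAt
          (hasFDerivAt_prodMk_right b₀ q₀)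
      · have h4 : (fun q => ζ (q - q₀) - 0) = fun q => ζ q - ζ q₀ := by
          funext q
          rw [map_sub, sub_zero]
        exact h4 ▸ ζ.hasFDerivAt.sub_const (ζ q₀)
    exact h2.unique h3
  have hinj : Function.Injective T := by
    rw [injective_iff_map_eq_zero]
    intro η hη
    have := Prod.ext_iff.1 hη
    exact eq_zero_of_chartDet_ne_zero hd this.1 this.2
  have if₂ : (fderiv ℂ F u ∘L .inr ℂ (B × ℂ) (ℂ × ℂ)).IsInvertible := by
    rw [hT]
    refine ⟨(LinearEquiv.ofInjectiveEndo (T : ℂ × ℂ →ₗ[ℂ] ℂ × ℂ) hinj).toContinuousLinearEquiv, ?_⟩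
    ext <;> rfl
  let σ := cdf.implicitFunction (by simp) if₂
  have s0 : σ (b₀, 0) = q₀ := cdf.implicitFunction_apply_self (by simp) if₂
  have s1 : ∀ᶠ x in 𝓝 (b₀, (0 : ℂ)), F (x, σ x) = 0 := by
    have := cdf.eventually_apply_implicitFunction (by simp) if₂
    rw [hFu] at this
    exact this
  have s2 : ∀ᶠ v in 𝓝 u, F v = 0 ↔ σ v.1 = v.2 := by
    have := cdf.eventually_apply_eq_iff_implicitFunction (by simp) if₂
    rw [hFu] at this
    exact this
  have s3' : ContDiffAt ℂ 4 σ (b₀, 0) := cdf.contDiffAt_implicitFunction (by simp) if₂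
  have s3 : ∀ᶠ x in 𝓝 (b₀, (0 : ℂ)), ContDiffAt ℂ 3 σ x :=
    (s3'.of_le (by norm_num)).eventually (by simp)
  have s4 : ∀ᶠ x in 𝓝 (b₀, (0 : ℂ)), chartDet h ζ (x.1, σ x) ≠ 0 := by
    have hc : Continuous (chartDet h ζ) := by
      have := hh.continuous_fderiv (by simp)
      unfold chartDet
      fun_prop
    have : ContinuousAt (fun x : B × ℂ => chartDet h ζ (x.1, σ x)) (b₀, 0) :=
      hc.continuousAt.comp (continuousAt_fst.prodMk s3'.continuousAt)
    apply this.eventually_ne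
    simpa [s0] using hd
  obtain ⟨ρ, hρ, hball⟩ := Metric.eventually_nhds_iff_ball.1 (s1.and (s3.and s4))
  rw [← ball_prod_same] at hball
  refine ⟨σ, ρ, ρ, hρ, hρ, fun x hx => (hball x hx).2.1.contDiffWithinAt, fun x hx => ?_,
    fun x hx => ?_, fun x hx => (hball x hx).2.2, ?_⟩
  · exact (Prod.ext_iff.1 (hball x hx).1).1
  · exact sub_eq_zero.1 (Prod.ext_iff.1 (hball x hx).1).2
  · have c1 : Filter.Tendsto (fun e : B × (ℂ × ℂ) => ((e.1, ζ (e.2 - q₀)), e.2)) (𝓝 (b₀, q₀))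
        (𝓝 u) := by
      have : ContinuousAt (fun e : B × (ℂ × ℂ) => ((e.1, ζ (e.2 - q₀)), e.2)) (b₀, q₀) := by
        fun_prop
      simpa [ContinuousAt, u] using this
    have c2 : ∀ᶠ v in 𝓝 u, v.1 ∈ Metric.ball b₀ ρ ×ˢ Metric.ball (0 : ℂ) ρ :=
      continuousAt_fst.eventually ((Metric.isOpen_ball.prod Metric.isOpen_ball).mem_nhds
        ⟨Metric.mem_ball_self hρ, Metric.mem_ball_self hρ⟩)
    filter_upwards [c1.eventually s2, c1.eventually c2] with e he1 he2 hhe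
    exact ⟨he2.1, he2.2, (he1.1 (by simp [F, hhe])).symm⟩

namespace IsChart

variable {h : B × (ℂ × ℂ) → ℂ} {ζ : ℂ × ℂ →L[ℂ] ℂ} {b₀ : B} {q₀ : ℂ × ℂ}
    {σ : B × ℂ → ℂ × ℂ} {r R : ℝ} (hc : IsChart h ζ b₀ q₀ σ r R)
include hc

theorem contDiffAt {e : B × ℂ} (he : e ∈ Metric.ball b₀ r ×ˢ Metric.ball (0 : ℂ) R) :
    ContDiffAt ℂ 3 σ e := hc.contDiffOn.contDiffAt (ball_prod_ball_mem_nhds he)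

theorem hasFDerivAt {e : B × ℂ} (he : e ∈ Metric.ball b₀ r ×ˢ Metric.ball (0 : ℂ) R) :
    HasFDerivAt σ (fderiv ℂ σ e) e :=
  ((hc.contDiffAt he).differentiableAt (by simp)).hasFDerivAt

/-- Derivatives of the chart are tangent to the total space. -/
theorem fderiv_h (hh : ContDiff ℂ 4 h) {e : B × ℂ}
    (he : e ∈ Metric.ball b₀ r ×ˢ Metric.ball (0 : ℂ) R) (v : B × ℂ) :
    fderiv ℂ h (e.1, σ e) (v.1, fderiv ℂ σ e v) = 0 := by
  have h1 : HasFDerivAt (fun e : B × ℂ => h (e.1, σ e)) ((fderiv ℂ h (e.1, σ e)).comp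
      ((ContinuousLinearMap.fst ℂ B ℂ).prod (fderiv ℂ σ e))) e :=
    HasFDerivAt.comp (g := h) (f := fun e : B × ℂ => (e.1, σ e)) e
      (hh.differentiable (by simp) _).hasFDerivAt (hasFDerivAt_fst.prodMk (hc.hasFDerivAt he))
  have h2 : HasFDerivAt (fun e : B × ℂ => h (e.1, σ e)) (0 : B × ℂ →L[ℂ] ℂ) e := by
    refine (hasFDerivAt_const (0 : ℂ) e).congr_of_eventuallyEq ?_
    filter_upwards [ball_prod_ball_mem_nhds he] with x hx using hc.h_eq x hx
  have := DFunLike.congr_fun (h1.unique h2) v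
  simpa using this

theorem coord_fderiv {e : B × ℂ} (he : e ∈ Metric.ball b₀ r ×ˢ Metric.ball (0 : ℂ) R)
    (v : B × ℂ) : ζ (fderiv ℂ σ e v) = v.2 := by
  have h1 : HasFDerivAt (fun e : B × ℂ => ζ (σ e - q₀)) (ζ.comp (fderiv ℂ σ e)) e :=
    ζ.hasFDerivAt.comp e ((hc.hasFDerivAt he).sub_const q₀)
  have h2 : HasFDerivAt (fun e : B × ℂ => ζ (σ e - q₀)) (ContinuousLinearMap.snd ℂ B ℂ) e := by
    refine hasFDerivAt_snd.congr_of_eventuallyEq ?_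
    filter_upwards [ball_prod_ball_mem_nhds he] with x hx using hc.coord x hx
  have := DFunLike.congr_fun (h1.unique h2) v
  simpa using this

/-- A tangent vector is determined by its projection to the base and its coordinate. -/
theorem tangent_eq (hh : ContDiff ℂ 4 h) {e : B × ℂ}
    (he : e ∈ Metric.ball b₀ r ×ˢ Metric.ball (0 : ℂ) R) {v : B} {ξ : ℂ × ℂ}
    (hξ : fderiv ℂ h (e.1, σ e) (v, ξ) = 0) : ξ = fderiv ℂ σ e (v, ζ ξ) := by
  rw [← sub_eq_zero]
  apply eq_zero_of_chartDet_ne_zero (hc.det e he)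
  · have h1 := hc.fderiv_h hh he (v, ζ ξ)
    have : ((0 : B), ξ - fderiv ℂ σ e (v, ζ ξ)) = (v, ξ) - (v, fderiv ℂ σ e (v, ζ ξ)) := by simp
    rw [this, map_sub, hξ, h1, sub_zero]
  · rw [map_sub, hc.coord_fderiv he, sub_self]

end IsChart

/-- Symmetry of the mixed derivatives. -/
theorem hasDerivAt_fderiv_swap {V : Type} [NormedAddCommGroup V] [NormedSpace ℂ V]
    {φ : B × ℂ → V} {b : B} {z : ℂ} (hφ : ContDiffAt ℂ 2 φ (b, z)) (v : B) :
    HasDerivAt (fun z => fderiv ℂ φ (b, z) (v, 0))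
      (fderiv ℂ (fun e => fderiv ℂ φ e (0, 1)) (b, z) (v, 0)) z := by
  have h1 : DifferentiableAt ℂ (fderiv ℂ φ) (b, z) :=
    (hφ.fderiv_right (m := 1) (by norm_num)).differentiableAt (by simp)
  have h2 : fderiv ℂ (fun e => fderiv ℂ φ e (0, 1)) (b, z) (v, 0) =
      fderiv ℂ (fderiv ℂ φ) (b, z) (0, 1) (v, 0) := by
    have h3 := h1.hasFDerivAt.clm_apply (hasFDerivAt_const ((0 : B), (1 : ℂ)) (b, z))
    rw [h3.fderiv]
    have := hφ.isSymmSndFDerivAt (by simp) (v, 0) (0, 1)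
    simpa using this
  rw [h2]
  have h4 : HasDerivAt (fun z : ℂ => (b, z)) ((0 : B), (1 : ℂ)) z :=
    (hasDerivAt_const z b).prodMk (hasDerivAt_id z)
  have h5 := (h1.hasFDerivAt.comp_hasDerivAt z h4).clm_apply (hasDerivAt_const z (v, (0 : ℂ)))
  simpa using h5

end

section

/-! ## Words -/

/-- The words of length at most `K`. -/
def wordsLE (ι : Type) [Fintype ι] [DecidableEq ι] : ℕ → Finset (List ι)
  | 0 => {[]}
  | K + 1 => insert [] ((Finset.univ ×ˢ wordsLE ι K).image fun x => x.1 :: x.2)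

section Words

variable {ι : Type} [Fintype ι] [DecidableEq ι]

theorem mem_wordsLE {K : ℕ} {w : List ι} : w ∈ wordsLE ι K ↔ w.length ≤ K := by
  induction K generalizing w with
  | zero => simp [wordsLE]
  | succ K ih => cases w <;> simp [wordsLE, ih]

theorem sum_wordsLE_succ {M : Type} [AddCommMonoid M] (K : ℕ) (φ : List ι → M) :
    ∑ u ∈ wordsLE ι (K + 1), φ u = φ [] + ∑ u ∈ wordsLE ι K, ∑ j, φ (j :: u) := by
  rw [wordsLE, Finset.sum_insert (by simp), Finset.sum_image, Finset.sum_product,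
    Finset.sum_comm]
  rintro ⟨a, b⟩ _ ⟨c, d⟩ _ h
  simpa using h

/-- Used when `φ` contains a derivative along the curve: differentiating the primitive of `j :: u`
gives a multiple of that of `u`, and the sum must be regrouped by `u`. Truncation at length `K` is
harmless since `φ` vanishes on longer words. -/
theorem sum_wordsLE_eq_cons {M : Type} [AddCommMonoid M] (K : ℕ) {φ : List ι → M}
    (h0 : φ [] = 0) (hK : ∀ u, K < u.length → φ u = 0) :
    ∑ u ∈ wordsLE ι K, φ u = ∑ u ∈ wordsLE ι K, ∑ j, φ (j :: u) := by
  have := sum_wordsLE_succ K φ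
  rw [h0, zero_add] at this
  rw [← this]
  apply Finset.sum_subset
  · intro u hu
    rw [mem_wordsLE] at hu ⊢
    omega
  · intro u _ hu
    rw [mem_wordsLE, not_le] at hu
    exact hK u hu

end Words

/-! ## Flat data and local families of iterated integrals -/

variable {B : Type} [NormedAddCommGroup B] [NormedSpace ℂ B] {ι : Type}

/-- Functions `A w u`, for words `w`, `u`, such that the connection with the fibrewise form
`(i :: w, w) ↦ f i dx` and the coefficient `A` in the direction `v` is flat over the curve
`{h(b, ·) = 0}`. -/
structure FlatData [Fintype ι] [DecidableEq ι] (h : B × (ℂ × ℂ) → ℂ) (f : ι → ℂ × ℂ → ℂ) (K : ℕ) (b v : B) (q₀ : ℂ × ℂ)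
    (A : List ι → List ι → ℂ × ℂ → ℂ) : Prop where
  diff : ∀ w u, Differentiable ℂ (A w u)
  nil : ∀ u q, A [] u q = 0
  supp : ∀ w u q, w.length < u.length → A w u q = 0
  base : ∀ w, A w [] q₀ = 0
  flat : ∀ i w, w.length < K → ∀ u q, h (b, q) = 0 →
    ¬ (fderiv ℂ h (b, q) (0, (1, 0)) = 0 ∧ fderiv ℂ h (b, q) (0, (0, 1)) = 0) →
    ∀ ξ η : ℂ × ℂ, fderiv ℂ h (b, q) (v, ξ) = 0 → fderiv ℂ h (b, q) (0, η) = 0 →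
    fderiv ℂ (A (i :: w) u) q η + ∑ j, A (i :: w) (j :: u) q * (f j q * η.1) =
      f i q * η.1 * A w u q +
        if u = w then fderiv ℂ (f i) q ξ * η.1 - fderiv ℂ (f i) q η * ξ.1 else 0

/-- The contribution of the end point to the derivative of an iterated integral. -/
def headTerm {α : Type} (f : ι → ℂ) (G : List ι → α → ℂ) (e : α) (x : ℂ) : List ι → ℂ
  | [] => 0
  | i :: w => f i * x * G w e

/-- The coefficient of the form `f dx` in a chart. -/
def chartCoeff (f : ι → ℂ × ℂ → ℂ) (σ : B × ℂ → ℂ × ℂ) (i : ι) (e : B × ℂ) : ℂ :=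
  f i (σ e) * (fderiv ℂ σ e (0, 1)).1

/-- Iterated primitives in a chart with initial values `c` at `z'`. -/
def chartFamily (f : ι → ℂ × ℂ → ℂ) (σ : B × ℂ → ℂ × ℂ) (z' : ℂ) (c : List ι → B → ℂ) :
    List ι → B × ℂ → ℂ
  | [] => fun _ => 1
  | i :: w => fun e =>
      primitiveFrom z' (fun e => chartCoeff f σ i e * chartFamily f σ z' c w e) e + c (i :: w) e.1

section Family

variable {h : B × (ℂ × ℂ) → ℂ} {f : ι → ℂ × ℂ → ℂ} {ζ : ℂ × ℂ →L[ℂ] ℂ} {b₀ : B}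
  {q₁ : ℂ × ℂ} {σ : B × ℂ → ℂ × ℂ} {r R : ℝ} {z' : ℂ} {c : List ι → B → ℂ}

theorem contDiffOn_chartCoeff (hf : ∀ i, ContDiff ℂ 3 (f i)) (hc : IsChart h ζ b₀ q₁ σ r R)
    (i : ι) : ContDiffOn ℂ 2 (chartCoeff f σ i) (Metric.ball b₀ r ×ˢ Metric.ball 0 R) := by
  intro e he
  have h1 := hc.contDiffAt he
  have h2 : ContDiffAt ℂ 2 (fun e => fderiv ℂ σ e (0, 1)) e :=
    (h1.fderiv_right (m := 2) (by norm_num)).clm_apply contDiffAt_const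
  have h3 : ContDiffAt ℂ 2 (fun e => f i (σ e)) e :=
    ((hf i).contDiffAt.comp e h1).of_le (by norm_num)
  exact (h3.mul (contDiffAt_fst.comp e h2)).contDiffWithinAt

/-- Each initial value is smooth only in some neighbourhood of `b₀`, so the radius in the parameter
shrinks with the word, while the disc in the fibre remains the same. -/
theorem exists_contDiffOn_chartFamily (hf : ∀ i, ContDiff ℂ 3 (f i))
    (hc : IsChart h ζ b₀ q₁ σ r R) (hz' : z' ∈ Metric.ball (0 : ℂ) R)
    (hcd : ∀ w, ContDiffAt ℂ 2 (c w) b₀) (w : List ι) :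
    ∃ ρ > 0, ρ ≤ r ∧
      ContDiffOn ℂ 2 (chartFamily f σ z' c w) (Metric.ball b₀ ρ ×ˢ Metric.ball 0 R) := by
  induction w with
  | nil => exact ⟨r, hc.r_pos, le_rfl, contDiffOn_const⟩
  | cons i w ih =>
    obtain ⟨ρ, hρ, hρr, h1⟩ := ih
    obtain ⟨ε, hε, h2⟩ := Metric.eventually_nhds_iff_ball.1
      ((hcd (i :: w)).eventually (by simp))
    refine ⟨min ρ ε, lt_min hρ hε, (min_le_left _ _).trans hρr, ?_⟩
    have s1 : Metric.ball b₀ (min ρ ε) ×ˢ Metric.ball (0 : ℂ) R ⊆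
        Metric.ball b₀ ρ ×ˢ Metric.ball (0 : ℂ) R :=
      Set.prod_mono (Metric.ball_subset_ball (min_le_left _ _)) le_rfl
    have s2 : Metric.ball b₀ ρ ×ˢ Metric.ball (0 : ℂ) R ⊆
        Metric.ball b₀ r ×ˢ Metric.ball (0 : ℂ) R :=
      Set.prod_mono (Metric.ball_subset_ball hρr) le_rfl
    apply ContDiffOn.add
    · exact contDiffOn_primitiveFrom (n := 2) Metric.isOpen_ball hz'
        ((((contDiffOn_chartCoeff hf hc i).mono s2).mul h1).mono s1)
    · intro e he
      refine ContDiffAt.contDiffWithinAt ?_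
      exact ContDiffAt.comp (g := c (i :: w)) e
        (h2 _ (Metric.ball_subset_ball (min_le_right _ _) he.1)) contDiffAt_fst

theorem hasDerivAt_chartFamily (hf : ∀ i, ContDiff ℂ 3 (f i))
    (hc : IsChart h ζ b₀ q₁ σ r R) (hz' : z' ∈ Metric.ball (0 : ℂ) R) {w : List ι} {ρ : ℝ}
    (hρ : ρ ≤ r)
    (hw : ContDiffOn ℂ 2 (chartFamily f σ z' c w) (Metric.ball b₀ ρ ×ˢ Metric.ball 0 R))
    (i : ι) {e : B × ℂ} (he : e ∈ Metric.ball b₀ ρ ×ˢ Metric.ball (0 : ℂ) R) :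
    HasDerivAt (fun z => chartFamily f σ z' c (i :: w) (e.1, z))
      (chartCoeff f σ i e * chartFamily f σ z' c w e) e.2 := by
  have h1 := (contDiffOn_chartCoeff hf hc i).mono
    (Set.prod_mono (Metric.ball_subset_ball hρ) (le_refl (Metric.ball (0 : ℂ) R)))
  have h2 : DifferentiableOn ℂ (fun e => chartCoeff f σ i e * chartFamily f σ z' c w e)
      (Metric.ball b₀ ρ ×ˢ Metric.ball 0 R) := (h1.mul hw).differentiableOn (by simp)
  have h3 : DifferentiableOn ℂ
      (fun z => chartCoeff f σ i (e.1, z) * chartFamily f σ z' c w (e.1, z)) (Metric.ball 0 R) :=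
    h2.comp (f := fun z : ℂ => (e.1, z)) (by fun_prop) fun z hz => ⟨he.1, hz⟩
  exact (hasDerivAt_primitiveFrom (F := fun e => chartCoeff f σ i e * chartFamily f σ z' c w e)
    (b := e.1) hz' h3 he.2).add_const (c (i :: w) e.1)

theorem chartFamily_initial (i : ι) (w : List ι) (b : B) :
    chartFamily f σ z' c (i :: w) (b, z') = c (i :: w) b := by
  simp [chartFamily, primitiveFrom_self]

/-- Two families of iterated primitives with the same initial values agree. -/
theorem eventually_eq_of_hasDerivAt {B : Type} [NormedAddCommGroup B] {a g₁ g₂ : B × ℂ → ℂ} {b₀ : B} {z₀ : ℂ}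
    (h1 : ∀ᶠ e in 𝓝 (b₀, z₀), HasDerivAt (fun z => g₁ (e.1, z)) (a e) e.2)
    (h2 : ∀ᶠ e in 𝓝 (b₀, z₀), HasDerivAt (fun z => g₂ (e.1, z)) (a e) e.2)
    (h0 : ∀ᶠ b in 𝓝 b₀, g₁ (b, z₀) = g₂ (b, z₀)) : ∀ᶠ e in 𝓝 (b₀, z₀), g₁ e = g₂ e := by
  obtain ⟨ρ, hρ, hball⟩ := Metric.eventually_nhds_iff_ball.1 (h1.and h2)
  rw [← ball_prod_same] at hball
  filter_upwards [continuousAt_fst.eventually h0, continuousAt_fst.eventually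
    (Metric.ball_mem_nhds b₀ hρ), continuousAt_snd.eventually (Metric.ball_mem_nhds z₀ hρ)]
    with e he he1 he2
  have hd : ∀ z ∈ Metric.ball z₀ ρ, HasDerivAt (fun z => g₁ (e.1, z) - g₂ (e.1, z)) 0 z := by
    intro z hz
    have := hball (e.1, z) ⟨he1, hz⟩
    simpa using this.1.fun_sub this.2
  have := (convex_ball z₀ ρ).is_const_of_fderivWithin_eq_zero (𝕜 := ℂ)
    (f := fun z => g₁ (e.1, z) - g₂ (e.1, z))
    (fun z hz => (hd z hz).differentiableAt.differentiableWithinAt)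
    (fun z hz => by
      rw [fderivWithin_of_isOpen Metric.isOpen_ball hz]
      ext
      simpa using (hd z hz).deriv) he2 (Metric.mem_ball_self hρ)
  simp only [he, sub_self] at this
  exact sub_eq_zero.1 this

/-- A function on a disc with vanishing derivative that vanishes at one point is zero. -/
theorem eq_zero_of_hasDerivAt_zero {φ : ℂ → ℂ} {R : ℝ}
    (hd : ∀ z ∈ Metric.ball (0 : ℂ) R, HasDerivAt φ 0 z) (hz' : z' ∈ Metric.ball (0 : ℂ) R)
    (h0 : φ z' = 0) : ∀ z ∈ Metric.ball (0 : ℂ) R, φ z = 0 := by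
  intro z hz
  rw [← h0]
  exact (convex_ball (0 : ℂ) R).is_const_of_fderivWithin_eq_zero (𝕜 := ℂ)
    (fun z hz => (hd z hz).differentiableAt.differentiableWithinAt)
    (fun z hz => by
      rw [fderivWithin_of_isOpen Metric.isOpen_ball hz]
      ext
      simpa using (hd z hz).deriv) hz hz'

variable [Fintype ι] [DecidableEq ι]

/-- The defect of the derivative formula in the direction `v`. -/
def chartDefect (f : ι → ℂ × ℂ → ℂ) (σ : B × ℂ → ℂ × ℂ) (g : List ι → B × ℂ → ℂ) (K : ℕ)
    (v : B) (A : List ι → List ι → ℂ × ℂ → ℂ) (w : List ι) (e : B × ℂ) : ℂ :=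
  fderiv ℂ (g w) e (v, 0) - headTerm (fun i => f i (σ e)) g e (fderiv ℂ σ e (v, 0)).1 w -
    ∑ u ∈ wordsLE ι K, A w u (σ e) * g u e

/-- Mixed derivatives commute, so the derivative along the curve of `∂_v g (i :: w)` is the
`v`-derivative of `chartCoeff f σ i * g w`. After the head term and the sum are subtracted, flatness
cancels everything but `chartCoeff f σ i` times the defect of `w`: the defects obey the same
triangular system as the primitives. -/
theorem hasDerivAt_chartDefect (hh : ContDiff ℂ 4 h) (hf : ∀ i, ContDiff ℂ 3 (f i))
    (hc : IsChart h ζ b₀ q₁ σ r R) (hz' : z' ∈ Metric.ball (0 : ℂ) R)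
    (hcd : ∀ w, ContDiffAt ℂ 2 (c w) b₀) {K : ℕ} {v : B} {q₀ : ℂ × ℂ}
    {A : List ι → List ι → ℂ × ℂ → ℂ} (hA : FlatData h f K b₀ v q₀ A) (i : ι) (w : List ι)
    (hw : w.length < K) {z : ℂ} (hz : z ∈ Metric.ball (0 : ℂ) R) :
    HasDerivAt (fun z => chartDefect f σ (chartFamily f σ z' c) K v A (i :: w) (b₀, z))
      (chartCoeff f σ i (b₀, z) * chartDefect f σ (chartFamily f σ z' c) K v A w (b₀, z)) z := by
  set g := chartFamily f σ z' c with hg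
  have hmem : ((b₀, z) : B × ℂ) ∈ Metric.ball b₀ r ×ˢ Metric.ball (0 : ℂ) R :=
    ⟨Metric.mem_ball_self hc.r_pos, hz⟩
  have hC : ∀ u, ContDiffAt ℂ 2 (g u) (b₀, z) := by
    intro u
    obtain ⟨ρ, hρ, -, h1⟩ := exists_contDiffOn_chartFamily hf hc hz' hcd u
    exact h1.contDiffAt (ball_prod_ball_mem_nhds ⟨Metric.mem_ball_self hρ, hz⟩)
  have hD : ∀ j u, ∀ᶠ e in 𝓝 (b₀, z), HasDerivAt (fun z => g (j :: u) (e.1, z))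
      (chartCoeff f σ j e * g u e) e.2 := by
    intro j u
    obtain ⟨ρ, hρ, hρr, h1⟩ := exists_contDiffOn_chartFamily hf hc hz' hcd u
    filter_upwards [ball_prod_ball_mem_nhds (b₀ := b₀) (r := ρ) (R := R) (e := (b₀, z))
      ⟨Metric.mem_ball_self hρ, hz⟩] with e he
    exact hasDerivAt_chartFamily hf hc hz' hρr h1 j he
  -- partial derivatives
  have hline : HasDerivAt (fun z : ℂ => (b₀, z)) ((0 : B), (1 : ℂ)) z :=
    (hasDerivAt_const z b₀).prodMk (hasDerivAt_id z)
  have hσ : HasDerivAt (fun z => σ (b₀, z)) (fderiv ℂ σ (b₀, z) (0, 1)) z :=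
    (hc.hasFDerivAt hmem).comp_hasDerivAt z hline
  have hσ2 := hasDerivAt_fderiv_swap ((hc.contDiffAt hmem).of_le (by norm_num : (2 : WithTop ℕ∞) ≤ 3)) v
  have hgw : HasDerivAt (fun z => g w (b₀, z)) (fderiv ℂ (g w) (b₀, z) (0, 1)) z :=
    ((hC w).differentiableAt (by simp)).hasFDerivAt.comp_hasDerivAt z hline
  have hfσ : HasDerivAt (fun z => f i (σ (b₀, z)))
      (fderiv ℂ (f i) (σ (b₀, z)) (fderiv ℂ σ (b₀, z) (0, 1))) z :=
    ((hf i).differentiable (by simp) _).hasFDerivAt.comp_hasDerivAt z hσ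
  -- the first term
  have t1 := hasDerivAt_fderiv_swap (hC (i :: w)) v
  have t1' : fderiv ℂ (fun e => fderiv ℂ (g (i :: w)) e (0, 1)) (b₀, z) (v, 0) =
      (fderiv ℂ (f i) (σ (b₀, z)) (fderiv ℂ σ (b₀, z) (v, 0)) * (fderiv ℂ σ (b₀, z) (0, 1)).1 +
        f i (σ (b₀, z)) * (fderiv ℂ (fun e => fderiv ℂ σ e (0, 1)) (b₀, z) (v, 0)).1) * g w (b₀, z) +
      chartCoeff f σ i (b₀, z) * fderiv ℂ (g w) (b₀, z) (v, 0) := by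
    have ev : (fun e => fderiv ℂ (g (i :: w)) e (0, 1)) =ᶠ[𝓝 (b₀, z)]
        fun e => chartCoeff f σ i e * g w e := by
      have hCe := (hC (i :: w)).eventually (by simp)
      filter_upwards [hD i w, hCe] with e he1 he2
      have hl : HasDerivAt (fun z : ℂ => (e.1, z)) ((0 : B), (1 : ℂ)) e.2 :=
        (hasDerivAt_const e.2 e.1).prodMk (hasDerivAt_id e.2)
      have := (he2.differentiableAt (by simp)).hasFDerivAt.comp_hasDerivAt e.2 hl
      exact this.unique he1
    have d1 : HasFDerivAt (fun e => f i (σ e))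
        ((fderiv ℂ (f i) (σ (b₀, z))).comp (fderiv ℂ σ (b₀, z))) (b₀, z) :=
      ((hf i).differentiable (by simp) _).hasFDerivAt.comp _ (hc.hasFDerivAt hmem)
    have d2 : HasFDerivAt (fun e => fderiv ℂ σ e (0, 1))
        (fderiv ℂ (fun e => fderiv ℂ σ e (0, 1)) (b₀, z)) (b₀, z) := by
      have h1 := (((hc.contDiffAt hmem).fderiv_right (m := 2) (by norm_num)).clm_apply
        (contDiffAt_const (c := ((0 : B), (1 : ℂ)))))
      exact (h1.differentiableAt (by simp)).hasFDerivAt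
    have d3 : HasFDerivAt (fun e => (fderiv ℂ σ e (0, 1)).1)
        ((ContinuousLinearMap.fst ℂ ℂ ℂ).comp
          (fderiv ℂ (fun e => fderiv ℂ σ e (0, 1)) (b₀, z))) (b₀, z) :=
      (ContinuousLinearMap.fst ℂ ℂ ℂ).hasFDerivAt.comp _ d2
    have d4 := (d1.mul d3).mul ((hC w).differentiableAt (by simp)).hasFDerivAt
    have d5 : HasFDerivAt (fun e => chartCoeff f σ i e * g w e) _ (b₀, z) := d4
    rw [ev.fderiv_eq, d5.fderiv]
    simp [chartCoeff]
    ring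
  rw [t1'] at t1
  -- the second term
  have t2 : HasDerivAt (fun z => f i (σ (b₀, z)) * (fderiv ℂ σ (b₀, z) (v, 0)).1 * g w (b₀, z)) _ z :=
    (hfσ.mul ((ContinuousLinearMap.fst ℂ ℂ ℂ).hasFDerivAt.comp_hasDerivAt z hσ2)).mul hgw
  -- the sum
  have t3 : HasDerivAt (fun z => ∑ u ∈ wordsLE ι K, A (i :: w) u (σ (b₀, z)) * g u (b₀, z))
      (∑ u ∈ wordsLE ι K, (fderiv ℂ (A (i :: w) u) (σ (b₀, z)) (fderiv ℂ σ (b₀, z) (0, 1)) * g u (b₀, z) +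
        A (i :: w) u (σ (b₀, z)) * fderiv ℂ (g u) (b₀, z) (0, 1))) z := by
    apply HasDerivAt.fun_sum
    intro u _
    exact ((hA.diff (i :: w) u _).hasFDerivAt.comp_hasDerivAt z hσ).mul
      (((hC u).differentiableAt (by simp)).hasFDerivAt.comp_hasDerivAt z hline)
  have hcons : ∀ j u, fderiv ℂ (g (j :: u)) (b₀, z) (0, 1) = chartCoeff f σ j (b₀, z) * g u (b₀, z) := by
    intro j u
    exact (((hC (j :: u)).differentiableAt (by simp)).hasFDerivAt.comp_hasDerivAt z hline).unique
      (hD j u).self_of_nhds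
  have hnil : fderiv ℂ (g []) (b₀, z) (0, 1) = 0 := by
    have : g [] = fun _ => 1 := rfl
    rw [this]
    simp
  -- Regrouped by `u`, the coefficient of `g u` is the left side of `FlatData.flat` for the tangent
  -- vectors `∂_v σ` and `∂_z σ`; its curvature term occurs only for `u = w`.
  have key : ∑ u ∈ wordsLE ι K, (fderiv ℂ (A (i :: w) u) (σ (b₀, z)) (fderiv ℂ σ (b₀, z) (0, 1)) * g u (b₀, z) +
        A (i :: w) u (σ (b₀, z)) * fderiv ℂ (g u) (b₀, z) (0, 1)) =
      chartCoeff f σ i (b₀, z) * ∑ u ∈ wordsLE ι K, A w u (σ (b₀, z)) * g u (b₀, z) +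
      (fderiv ℂ (f i) (σ (b₀, z)) (fderiv ℂ σ (b₀, z) (v, 0)) * (fderiv ℂ σ (b₀, z) (0, 1)).1 -
        fderiv ℂ (f i) (σ (b₀, z)) (fderiv ℂ σ (b₀, z) (0, 1)) * (fderiv ℂ σ (b₀, z) (v, 0)).1) *
        g w (b₀, z) := by
    rw [Finset.sum_add_distrib, sum_wordsLE_eq_cons K (φ := fun u => A (i :: w) u (σ (b₀, z)) *
      fderiv ℂ (g u) (b₀, z) (0, 1)) (by simp [hnil])
      (fun u hu => by rw [hA.supp _ _ _ (by simp; omega), zero_mul]), ← Finset.sum_add_distrib]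
    have e1 : ∀ u ∈ wordsLE ι K,
        fderiv ℂ (A (i :: w) u) (σ (b₀, z)) (fderiv ℂ σ (b₀, z) (0, 1)) * g u (b₀, z) +
          ∑ j, A (i :: w) (j :: u) (σ (b₀, z)) * fderiv ℂ (g (j :: u)) (b₀, z) (0, 1) =
        chartCoeff f σ i (b₀, z) * (A w u (σ (b₀, z)) * g u (b₀, z)) +
        if u = w then (fderiv ℂ (f i) (σ (b₀, z)) (fderiv ℂ σ (b₀, z) (v, 0)) *
          (fderiv ℂ σ (b₀, z) (0, 1)).1 - fderiv ℂ (f i) (σ (b₀, z)) (fderiv ℂ σ (b₀, z) (0, 1)) *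
          (fderiv ℂ σ (b₀, z) (v, 0)).1) * g w (b₀, z) else 0 := by
      intro u _
      have nd : ¬ (fderiv ℂ h (b₀, σ (b₀, z)) (0, (1, 0)) = 0 ∧
          fderiv ℂ h (b₀, σ (b₀, z)) (0, (0, 1)) = 0) := by
        rintro ⟨n1, n2⟩
        apply hc.det _ hmem
        simp [chartDet, n1, n2]
      have := hA.flat i w hw u (σ (b₀, z)) (hc.h_eq _ hmem) nd (fderiv ℂ σ (b₀, z) (v, 0))
        (fderiv ℂ σ (b₀, z) (0, 1)) (hc.fderiv_h hh hmem (v, 0)) (hc.fderiv_h hh hmem (0, 1))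
      have e2 : ∑ j, A (i :: w) (j :: u) (σ (b₀, z)) * fderiv ℂ (g (j :: u)) (b₀, z) (0, 1) =
          (∑ j, A (i :: w) (j :: u) (σ (b₀, z)) *
            (f j (σ (b₀, z)) * (fderiv ℂ σ (b₀, z) (0, 1)).1)) * g u (b₀, z) := by
        rw [Finset.sum_mul]
        refine Finset.sum_congr rfl fun j _ => ?_
        rw [hcons, chartCoeff]
        ring
      rw [e2, ← add_mul, this]
      split_ifs with hu
      · rw [hu, chartCoeff]
        ring
      · rw [chartCoeff]
        ring
    rw [Finset.sum_congr rfl e1, Finset.sum_add_distrib, ← Finset.mul_sum,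
      Finset.sum_ite_eq' , if_pos (mem_wordsLE.2 hw.le)]
  rw [key] at t3
  have t4 := (t1.sub t2).sub t3
  refine HasDerivAt.congr_deriv t4 ?_
  -- For a word `k :: w'` both sides contain the product of the two derivatives of `x`, so the
  -- derivative of `g w` from the head term of `i :: w` matches the head term in the defect of `w`.
  have hhead : fderiv ℂ (g w) (b₀, z) (0, 1) * (fderiv ℂ σ (b₀, z) (v, 0)).1 =
      (fderiv ℂ σ (b₀, z) (0, 1)).1 *
        headTerm (fun i => f i (σ (b₀, z))) g (b₀, z) (fderiv ℂ σ (b₀, z) (v, 0)).1 w := by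
    cases w with
    | nil => rw [hnil]; simp [headTerm]
    | cons k w =>
      rw [hcons, headTerm, chartCoeff]
      ring
  simp only [chartDefect, chartCoeff, Function.comp_apply, ContinuousLinearMap.coe_fst', Pi.mul_apply]
  linear_combination (-f i (σ (b₀, z))) * hhead

/-- Induction on the word: once the defect of `w` vanishes on the disc, that of `i :: w` is constant
there, and it is zero at `z'`. -/
theorem chartDefect_eq_zero (hh : ContDiff ℂ 4 h) (hf : ∀ i, ContDiff ℂ 3 (f i))
    (hc : IsChart h ζ b₀ q₁ σ r R) (hz' : z' ∈ Metric.ball (0 : ℂ) R)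
    (hcd : ∀ w, ContDiffAt ℂ 2 (c w) b₀) {K : ℕ} {v : B} {q₀ : ℂ × ℂ}
    {A : List ι → List ι → ℂ × ℂ → ℂ} (hA : FlatData h f K b₀ v q₀ A)
    (h0 : ∀ w, w.length ≤ K → chartDefect f σ (chartFamily f σ z' c) K v A w (b₀, z') = 0)
    (w : List ι) (hw : w.length ≤ K) : ∀ z ∈ Metric.ball (0 : ℂ) R,
      chartDefect f σ (chartFamily f σ z' c) K v A w (b₀, z) = 0 := by
  induction w with
  | nil =>
    intro z _
    have : chartFamily f σ z' c [] = fun _ => 1 := rfl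
    simp [chartDefect, headTerm, hA.nil, this]
  | cons i w ih =>
    rw [List.length_cons] at hw
    apply eq_zero_of_hasDerivAt_zero (z' := z') _ hz' (h0 _ (by simpa using hw))
    intro z hz
    have := hasDerivAt_chartDefect hh hf hc hz' hcd hA i w hw hz
    rwa [ih (by omega) z hz, mul_zero] at this

end Family

end

section

/-! ## Regular paths -/

/-- A continuous path, differentiable outside a countable set, with integrable derivative. -/
structure IsRegularPath (c : ℝ → ℂ × ℂ) : Prop where
  continuous : Continuous c
  differentiable : ∃ s : Set ℝ, s.Countable ∧ ∀ t ∈ Set.Ioo (0 : ℝ) 1 \ s, DifferentiableAt ℝ c t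
  integrable : IntervalIntegrable (deriv c) MeasureTheory.volume 0 1

/-- The forms `f i dx`. -/
def formOf {ι : Type} (f : ι → ℂ × ℂ → ℂ) (i : ι) (q : ℂ × ℂ) : ℂ × ℂ →L[ℂ] ℂ :=
  f i q • ContinuousLinearMap.fst ℂ ℂ ℂ

theorem intervalIntegrable_formOf_mul {ι : Type} {f : ι → ℂ × ℂ → ℂ} (hf : ∀ i, Continuous (f i))
    {c : ℝ → ℂ × ℂ} (hc : IsRegularPath c) (i : ι) {φ : ℝ → ℂ}
    (hφ : ContinuousOn φ (Set.Icc 0 1)) :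
    IntervalIntegrable (fun u => formOf f i (c u) (deriv c u) * φ u)
      MeasureTheory.volume 0 1 := by
  have h1 : IntervalIntegrable (fun u => (deriv c u).1) MeasureTheory.volume 0 1 := by
    have := hc.integrable
    rw [intervalIntegrable_iff] at this ⊢
    exact this.fst
  have h2 : ContinuousOn (fun u => f i (c u) * φ u) (Set.uIcc 0 1) := by
    rw [Set.uIcc_of_le zero_le_one]
    exact ((hf i).comp hc.continuous).continuousOn.mul hφ
  refine (h1.continuousOn_mul h2).congr fun u _ => ?_
  simp only [formOf, smul_apply, ContinuousLinearMap.coe_fst', smul_eq_mul]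
  ring

theorem continuousOn_iterInt {ι : Type} {f : ι → ℂ × ℂ → ℂ} (hf : ∀ i, Continuous (f i))
    {c : ℝ → ℂ × ℂ} (hc : IsRegularPath c) (w : List ι) :
    ContinuousOn (iterInt c (w.map (formOf f))) (Set.Icc 0 1) := by
  induction w with
  | nil => exact continuousOn_const
  | cons i w ih =>
    have := intervalIntegral.continuousOn_primitive_interval'
      (intervalIntegrable_formOf_mul hf hc i ih) Set.left_mem_uIcc
    rwa [Set.uIcc_of_le zero_le_one] at this

/-- Two primitives of the same integrand that agree at one time agree on the whole interval. The
paths may fail to be differentiable on a countable set, which the fundamental theorem of calculus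
tolerates because `ψ` is continuous. -/
theorem iterInt_eq_of_hasDerivAt {ι : Type} {f : ι → ℂ × ℂ → ℂ} (hf : ∀ i, Continuous (f i))
    {c : ℝ → ℂ × ℂ} (hc : IsRegularPath c) {I : Set ℝ} (hI : I.OrdConnected)
    (hI01 : I ⊆ Set.Icc 0 1) {t : ℝ} (ht : t ∈ I) (i : ι) (w : List ι) {φ ψ : ℝ → ℂ}
    (hφ : ∀ u ∈ I, iterInt c (w.map (formOf f)) u = φ u) (hψ : ContinuousOn ψ I)
    (hd : ∀ u ∈ I, u ∈ Set.Ioo (0 : ℝ) 1 → DifferentiableAt ℝ c u →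
      HasDerivAt ψ (f i (c u) * (deriv c u).1 * φ u) u)
    (h0 : iterInt c ((i :: w).map (formOf f)) t = ψ t) :
    ∀ u ∈ I, iterInt c ((i :: w).map (formOf f)) u = ψ u := by
  intro u hu
  have hsub : Set.uIcc t u ⊆ I := hI.uIcc_subset ht hu
  have hint := intervalIntegrable_formOf_mul hf hc i (continuousOn_iterInt hf hc w)
  obtain ⟨s, hs, hsd⟩ := hc.differentiable
  have mono : ∀ {x y : ℝ}, x ∈ Set.Icc (0 : ℝ) 1 → y ∈ Set.Icc (0 : ℝ) 1 →
      IntervalIntegrable (fun u => formOf f i (c u) (deriv c u) * iterInt c (w.map (formOf f)) u)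
        MeasureTheory.volume x y := by
    intro x y hx hy
    refine hint.mono_set ?_
    rw [Set.uIcc_of_le (zero_le_one (α := ℝ))]
    exact Set.ordConnected_Icc.uIcc_subset hx hy
  have key : ∫ u in t..u, formOf f i (c u) (deriv c u) * iterInt c (w.map (formOf f)) u =
      ψ u - ψ t := by
    apply MeasureTheory.integral_eq_of_hasDerivAt_off_countable ψ _ hs (hψ.mono hsub)
    · intro x hx
      have hx' : x ∈ I := hsub ⟨hx.1.1.le, hx.1.2.le⟩
      have hx01 : x ∈ Set.Ioo (0 : ℝ) 1 :=
        ⟨(le_min (hI01 ht).1 (hI01 hu).1).trans_lt hx.1.1,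
          hx.1.2.trans_le (max_le (hI01 ht).2 (hI01 hu).2)⟩
      rw [hφ x hx']
      exact hd x hx' hx01 (hsd x ⟨hx01, hx.2⟩)
    · exact mono (hI01 ht) (hI01 hu)
  have h01 : (0 : ℝ) ∈ Set.Icc (0 : ℝ) 1 := ⟨le_rfl, zero_le_one⟩
  have e1 := intervalIntegral.integral_add_adjacent_intervals (mono h01 (hI01 ht))
    (mono (hI01 ht) (hI01 hu))
  have e2 : ∀ x, iterInt c ((i :: w).map (formOf f)) x = ∫ u in (0 : ℝ)..x,
    formOf f i (c u) (deriv c u) * iterInt c (w.map (formOf f)) u := fun _ => rfl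
  rw [e2] at h0 ⊢
  rw [← e1, key, h0]
  ring

/-! ## Analytic continuation of iterated integrals along a family of paths -/

variable {B : Type} [NormedAddCommGroup B] [NormedSpace ℂ B] {ι : Type}

/-- A family of local primitives near the point `δ b t` of the curve over `b`, that represents the
iterated integrals along `δ` and satisfies the derivative formula. -/
structure LocalFamily [Fintype ι] [DecidableEq ι] (h : B × (ℂ × ℂ) → ℂ) (f : ι → ℂ × ℂ → ℂ) (K : ℕ) (δ : B → ℝ → ℂ × ℂ)
    (q₀ : ℂ × ℂ) (b : B) (t : ℝ) (G : List ι → B × (ℂ × ℂ) → ℂ) : Prop where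
  contDiffAt : ∀ w, ContDiffAt ℂ 2 (G w) (b, δ b t)
  nil : ∀ e, G [] e = 1
  fibre : ∀ i w, ∀ᶠ e in 𝓝 (b, δ b t), h e = 0 → ∀ η, fderiv ℂ h e (0, η) = 0 →
    fderiv ℂ (G (i :: w)) e (0, η) = f i e.2 * η.1 * G w e
  eq : ∀ w, ∀ᶠ b' in 𝓝 b, iterInt (δ b') (w.map (formOf f)) t = G w (b', δ b' t)
  deriv : ∀ v A, FlatData h f K b v q₀ A → ∀ w, w.length ≤ K → ∀ ξ,
    fderiv ℂ h (b, δ b t) (v, ξ) = 0 → fderiv ℂ (G w) (b, δ b t) (v, ξ) =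
      headTerm (fun i => f i (δ b t)) G (b, δ b t) ξ.1 w +
        ∑ u ∈ wordsLE ι K, A w u (δ b t) * G u (b, δ b t)

section Propagation

variable {h : B × (ℂ × ℂ) → ℂ} {f : ι → ℂ × ℂ → ℂ} {ζ : ℂ × ℂ →L[ℂ] ℂ} {b₀ : B}
  {q₁ q₀ : ℂ × ℂ} {σ : B × ℂ → ℂ × ℂ} {r R : ℝ} {z' : ℂ} {c : List ι → B → ℂ} {K : ℕ}
  {δ : B → ℝ → ℂ × ℂ}

/-- The points near `e` of the total space lie in the domain of the chart. -/
def ChartCovers (h : B × (ℂ × ℂ) → ℂ) (ζ : ℂ × ℂ →L[ℂ] ℂ) (b₀ : B) (q₁ : ℂ × ℂ)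
    (σ : B × ℂ → ℂ × ℂ) (r R : ℝ) (e : B × (ℂ × ℂ)) : Prop :=
  ∀ᶠ e in 𝓝 e, h e = 0 → e.1 ∈ Metric.ball b₀ r ∧
    ζ (e.2 - q₁) ∈ Metric.ball (0 : ℂ) R ∧ e.2 = σ (e.1, ζ (e.2 - q₁))

theorem fderiv_comp_coord {g : B × ℂ → ℂ} {e : B × (ℂ × ℂ)}
    (hg : DifferentiableAt ℂ g (e.1, ζ (e.2 - q₁))) (v : B) (ξ : ℂ × ℂ) :
    fderiv ℂ (fun e : B × (ℂ × ℂ) => g (e.1, ζ (e.2 - q₁))) e (v, ξ) =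
      fderiv ℂ g (e.1, ζ (e.2 - q₁)) (v, ζ ξ) := by
  have h1 : HasFDerivAt (fun e : B × (ℂ × ℂ) => (e.1, ζ (e.2 - q₁)))
      ((ContinuousLinearMap.fst ℂ B (ℂ × ℂ)).prod
        (ζ.comp (ContinuousLinearMap.snd ℂ B (ℂ × ℂ)))) e :=
    hasFDerivAt_fst.prodMk (ζ.hasFDerivAt.comp e (hasFDerivAt_snd.sub_const q₁))
  have h2 : HasFDerivAt (fun e : B × (ℂ × ℂ) => g (e.1, ζ (e.2 - q₁))) _ e :=
    HasFDerivAt.comp e hg.hasFDerivAt h1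
  rw [h2.fderiv]
  simp

/-- While the path stays in a chart, its iterated integrals are the iterated primitives evaluated at
the coordinate of the moving point. The induction on the word needs equality for the shorter word at
all times of the interval, so a neighbourhood of `b₀` uniform in `s` is asserted. -/
theorem eventually_iterInt_eq_chartFamily (hf : ∀ i, ContDiff ℂ 3 (f i))
    (hc : IsChart h ζ b₀ q₁ σ r R) (hz' : z' ∈ Metric.ball (0 : ℂ) R)
    (hcd : ∀ w, ContDiffAt ℂ 2 (c w) b₀) {t₀ ε t' : ℝ}
    (ht' : t' ∈ Metric.ball t₀ ε ∩ Set.Icc 0 1)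
    (hpath : ∀ᶠ b in 𝓝 b₀, IsRegularPath (δ b))
    (hloc : ∀ᶠ b in 𝓝 b₀, ∀ s ∈ Metric.ball t₀ ε ∩ Set.Icc (0 : ℝ) 1, b ∈ Metric.ball b₀ r ∧
      ζ (δ b s - q₁) ∈ Metric.ball (0 : ℂ) R ∧ δ b s = σ (b, ζ (δ b s - q₁)))
    (hinit : ∀ w, ∀ᶠ b in 𝓝 b₀, iterInt (δ b) (w.map (formOf f)) t' =
      chartFamily f σ z' c w (b, ζ (δ b t' - q₁))) (w : List ι) :
    ∀ᶠ b in 𝓝 b₀, ∀ s ∈ Metric.ball t₀ ε ∩ Set.Icc (0 : ℝ) 1,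
      iterInt (δ b) (w.map (formOf f)) s = chartFamily f σ z' c w (b, ζ (δ b s - q₁)) := by
  induction w with
  | nil => exact Filter.Eventually.of_forall fun b s _ => rfl
  | cons i w ih =>
    obtain ⟨ρ, hρ, hρr, h1⟩ := exists_contDiffOn_chartFamily hf hc hz' hcd w
    obtain ⟨ρ', hρ', -, h1'⟩ := exists_contDiffOn_chartFamily hf hc hz' hcd (i :: w)
    filter_upwards [ih, hpath, hloc, hinit (i :: w), Metric.ball_mem_nhds b₀ hρ,
      Metric.ball_mem_nhds b₀ hρ'] with b hb hbp hbl hbi hbρ hbρ'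
    have hord : (Metric.ball t₀ ε ∩ Set.Icc (0 : ℝ) 1).OrdConnected := by
      rw [Real.ball_eq_Ioo]
      exact Set.ordConnected_Ioo.inter Set.ordConnected_Icc
    apply iterInt_eq_of_hasDerivAt (fun i => (hf i).continuous) hbp hord Set.inter_subset_right
      ht' i w hb
    · have : ContinuousOn (fun s => (b, ζ (δ b s - q₁))) (Metric.ball t₀ ε ∩ Set.Icc (0 : ℝ) 1) := by
        have := hbp.continuous
        fun_prop
      exact h1'.continuousOn.comp this fun s hs => ⟨hbρ', (hbl s hs).2.1⟩
    · intro s hs hs01 hsd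
      have hmem : (b, ζ (δ b s - q₁)) ∈ Metric.ball b₀ ρ ×ˢ Metric.ball (0 : ℂ) R :=
        ⟨hbρ, (hbl s hs).2.1⟩
      have hmem' : (b, ζ (δ b s - q₁)) ∈ Metric.ball b₀ r ×ˢ Metric.ball (0 : ℂ) R :=
        ⟨(hbl s hs).1, (hbl s hs).2.1⟩
      have d1 := hasDerivAt_chartFamily (c := c) hf hc hz' hρr h1 i hmem
      have d2 : HasDerivAt (fun s => ζ (δ b s - q₁)) (ζ (deriv (δ b) s)) s := by
        have := (ζ.restrictScalars ℝ).hasFDerivAt.comp_hasDerivAt s (hsd.hasDerivAt.sub_const q₁)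
        simpa [Function.comp_def] using this
      have d3 : HasDerivAt (fun s => chartFamily f σ z' c (i :: w) (b, ζ (δ b s - q₁))) _ s :=
        HasDerivAt.scomp (h := fun s => ζ (δ b s - q₁)) s d1 d2
      -- Near the interior time `s` the path is the image under `σ` of its own coordinate, so the
      -- coordinate of the velocity determines the velocity.
      have d4 : deriv (δ b) s = fderiv ℂ σ (b, ζ (δ b s - q₁)) (0, ζ (deriv (δ b) s)) := by
        have e1 : HasDerivAt (fun s => (b, ζ (δ b s - q₁))) ((0 : B), ζ (deriv (δ b) s)) s :=
          (hasDerivAt_const s b).prodMk d2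
        have e2 : HasDerivAt (fun s => σ (b, ζ (δ b s - q₁)))
            (fderiv ℂ σ (b, ζ (δ b s - q₁)) (0, ζ (deriv (δ b) s))) s := by
          have := ((hc.hasFDerivAt hmem').restrictScalars ℝ).comp_hasDerivAt s e1
          exact this
        have e3 : δ b =ᶠ[𝓝 s] fun s => σ (b, ζ (δ b s - q₁)) := by
          filter_upwards [Metric.isOpen_ball.mem_nhds hs.1, isOpen_Ioo.mem_nhds hs01]
            with u hu1 hu2
          exact (hbl u ⟨hu1, hu2.1.le, hu2.2.le⟩).2.2
        exact (e2.congr_of_eventuallyEq e3).deriv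
      refine d3.congr_deriv ?_
      have d5 : fderiv ℂ σ (b, ζ (δ b s - q₁)) (0, ζ (deriv (δ b) s)) =
          ζ (deriv (δ b) s) • fderiv ℂ σ (b, ζ (δ b s - q₁)) (0, 1) := by
        rw [← map_smul]
        simp
      rw [d5] at d4
      have d6 := congrArg Prod.fst d4
      simp only [Prod.smul_fst, smul_eq_mul] at d6
      rw [d6, chartCoeff, ← (hbl s hs).2.2, smul_eq_mul]
      ring
    · exact hbi

variable [Fintype ι] [DecidableEq ι]

/-- The primitives of a chart, transported to the total space by the coordinate, form a local family
at all times of the interval; the derivative formula only has to be known at the single point `z'`.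
-/
theorem localFamily_chartFamily (hh : ContDiff ℂ 4 h) (hf : ∀ i, ContDiff ℂ 3 (f i))
    (hc : IsChart h ζ b₀ q₁ σ r R) (hz' : z' ∈ Metric.ball (0 : ℂ) R)
    (hcd : ∀ w, ContDiffAt ℂ 2 (c w) b₀) {t₀ ε t' : ℝ}
    (ht' : t' ∈ Metric.ball t₀ ε ∩ Set.Icc 0 1)
    (hpath : ∀ᶠ b in 𝓝 b₀, IsRegularPath (δ b))
    (hloc : ∀ᶠ b in 𝓝 b₀, ∀ s ∈ Metric.ball t₀ ε ∩ Set.Icc (0 : ℝ) 1, b ∈ Metric.ball b₀ r ∧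
      ζ (δ b s - q₁) ∈ Metric.ball (0 : ℂ) R ∧ δ b s = σ (b, ζ (δ b s - q₁)))
    (hcov : ∀ s ∈ Metric.ball t₀ ε ∩ Set.Icc (0 : ℝ) 1,
      ChartCovers h ζ b₀ q₁ σ r R (b₀, δ b₀ s))
    (hinit : ∀ w, ∀ᶠ b in 𝓝 b₀, iterInt (δ b) (w.map (formOf f)) t' =
      chartFamily f σ z' c w (b, ζ (δ b t' - q₁)))
    (hdef : ∀ v A, FlatData h f K b₀ v q₀ A → ∀ w, w.length ≤ K →
      chartDefect f σ (chartFamily f σ z' c) K v A w (b₀, z') = 0)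
    {s : ℝ} (hs : s ∈ Metric.ball t₀ ε ∩ Set.Icc (0 : ℝ) 1) :
    LocalFamily h f K δ q₀ b₀ s (fun w e => chartFamily f σ z' c w (e.1, ζ (e.2 - q₁))) := by
  obtain ⟨-, hs2, hs3⟩ := hloc.self_of_nhds s hs
  set z := ζ (δ b₀ s - q₁) with hz
  have hmem : (b₀, z) ∈ Metric.ball b₀ r ×ˢ Metric.ball (0 : ℂ) R :=
    ⟨Metric.mem_ball_self hc.r_pos, hs2⟩
  have hC : ∀ u, ContDiffAt ℂ 2 (chartFamily f σ z' c u) (b₀, z) := by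
    intro u
    obtain ⟨ρ, hρ, -, h1⟩ := exists_contDiffOn_chartFamily hf hc hz' hcd u
    exact h1.contDiffAt (ball_prod_ball_mem_nhds ⟨Metric.mem_ball_self hρ, hs2⟩)
  refine ⟨fun w => ?_, fun e => rfl, fun i w => ?_, fun w => ?_, ?_⟩
  · exact ContDiffAt.comp (g := chartFamily f σ z' c w)
      (f := fun e : B × (ℂ × ℂ) => (e.1, ζ (e.2 - q₁))) (b₀, δ b₀ s) (hC w) (by fun_prop)
  · obtain ⟨ρ, hρ, hρr, h1⟩ := exists_contDiffOn_chartFamily hf hc hz' hcd w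
    obtain ⟨ρ', hρ', -, h1'⟩ := exists_contDiffOn_chartFamily hf hc hz' hcd (i :: w)
    filter_upwards [hcov s hs, continuousAt_fst.eventually (Metric.ball_mem_nhds b₀ hρ),
      continuousAt_fst.eventually (Metric.ball_mem_nhds b₀ hρ')] with e he heρ heρ' he0 η hη
    obtain ⟨e1, e2, e3⟩ := he he0
    have hd : DifferentiableAt ℂ (chartFamily f σ z' c (i :: w)) (e.1, ζ (e.2 - q₁)) :=
      (h1'.contDiffAt (ball_prod_ball_mem_nhds ⟨Metric.mem_ball.2 heρ', e2⟩)).differentiableAt (by simp)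
    rw [fderiv_comp_coord hd]
    have d1 := hasDerivAt_chartFamily (c := c) hf hc hz' hρr h1 i
      (e := (e.1, ζ (e.2 - q₁))) ⟨Metric.mem_ball.2 heρ, e2⟩
    have d2 : HasDerivAt (fun z : ℂ => (e.1, z)) ((0 : B), (1 : ℂ)) (ζ (e.2 - q₁)) :=
      (hasDerivAt_const _ e.1).prodMk (hasDerivAt_id _)
    have d3 := (hd.hasFDerivAt.comp_hasDerivAt _ d2).unique d1
    have e3' : e = (e.1, σ (e.1, ζ (e.2 - q₁))) := Prod.ext rfl e3
    have d4 := hc.tangent_eq hh (e := (e.1, ζ (e.2 - q₁))) ⟨e1, e2⟩ (v := 0) (ξ := η)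
      (by rw [← e3]; exact hη)
    have lin : ∀ x : ℂ, ((0 : B), x) = x • ((0 : B), (1 : ℂ)) := by simp
    rw [lin, map_smul] at d4 ⊢
    have d6 := congrArg Prod.fst d4
    simp only [Prod.smul_fst, smul_eq_mul] at d6
    rw [d3, d6, chartCoeff, ← e3, smul_eq_mul]
    ring
  · filter_upwards [eventually_iterInt_eq_chartFamily hf hc hz' hcd ht' hpath hloc hinit w]
      with b hb using hb s hs
  · intro v A hA w hw ξ hξ
    have d0 := chartDefect_eq_zero hh hf hc hz' hcd hA (hdef v A hA) w hw z hs2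
    rw [fderiv_comp_coord ((hC w).differentiableAt (by simp))]
    simp only [← hz]
    -- A tangent vector is a lift of `v` with fixed coordinate plus a multiple of the fibre
    -- direction. The vanishing defect treats the first part and the fibre derivative the second;
    -- their contributions add up to the head term with the full `ξ.1`.
    have d1 : ((v, ζ ξ) : B × ℂ) = (v, 0) + ζ ξ • ((0 : B), (1 : ℂ)) := by simp
    have d4 := hc.tangent_eq hh (e := (b₀, z)) hmem (v := v) (ξ := ξ) (by rw [← hs3]; exact hξ)
    rw [d1, map_add, map_smul] at d4 ⊢
    have d6 := congrArg Prod.fst d4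
    simp only [Prod.smul_fst, Prod.fst_add, smul_eq_mul] at d6
    rw [chartDefect, ← hs3, sub_eq_zero, sub_eq_iff_eq_add] at d0
    rw [d0, smul_eq_mul]
    cases w with
    | nil =>
      have : chartFamily f σ z' c [] = fun _ => 1 := rfl
      simp [headTerm, this]
    | cons i w =>
      obtain ⟨ρ, hρ, hρr, h1⟩ := exists_contDiffOn_chartFamily hf hc hz' hcd w
      have d5 := hasDerivAt_chartFamily (c := c) hf hc hz' hρr h1 i
        (e := (b₀, z)) ⟨Metric.mem_ball_self hρ, hs2⟩
      have d2 : HasDerivAt (fun z : ℂ => (b₀, z)) ((0 : B), (1 : ℂ)) z :=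
        (hasDerivAt_const _ b₀).prodMk (hasDerivAt_id _)
      have d3 := (((hC (i :: w)).differentiableAt (by simp)).hasFDerivAt.comp_hasDerivAt _ d2).unique d5
      rw [d3]
      simp only [headTerm, ← hz]
      rw [d6, chartCoeff, ← hs3]
      ring

end Propagation

end

/-! ### Continuation of local families along the loops -/

section

variable {B : Type} [NormedAddCommGroup B] [NormedSpace ℂ B] {ι : Type} [Fintype ι] [DecidableEq ι]

section Propagation

variable {h : B × (ℂ × ℂ) → ℂ} {f : ι → ℂ × ℂ → ℂ} {ζ : ℂ × ℂ →L[ℂ] ℂ} {b₀ : B}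
  {q₁ q₀ : ℂ × ℂ} {σ : B × ℂ → ℂ × ℂ} {r R : ℝ} {K : ℕ} {δ : B → ℝ → ℂ × ℂ}

/-- A local family at one time of a chart extends to all times of the chart. -/
theorem LocalFamily.exists_of_chart (hh : ContDiff ℂ 4 h) (hf : ∀ i, ContDiff ℂ 3 (f i))
    (hc : IsChart h ζ b₀ q₁ σ r R) {t₀ ε t' : ℝ}
    (ht' : t' ∈ Metric.ball t₀ ε ∩ Set.Icc 0 1)
    (hpath : ∀ᶠ b in 𝓝 b₀, IsRegularPath (δ b))
    (hδ : ContinuousAt (fun b => δ b t') b₀)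
    (hloc : ∀ᶠ b in 𝓝 b₀, ∀ s ∈ Metric.ball t₀ ε ∩ Set.Icc (0 : ℝ) 1, b ∈ Metric.ball b₀ r ∧
      ζ (δ b s - q₁) ∈ Metric.ball (0 : ℂ) R ∧ δ b s = σ (b, ζ (δ b s - q₁)))
    (hcov : ∀ s ∈ Metric.ball t₀ ε ∩ Set.Icc (0 : ℝ) 1,
      ChartCovers h ζ b₀ q₁ σ r R (b₀, δ b₀ s))
    {G : List ι → B × (ℂ × ℂ) → ℂ} (hG : LocalFamily h f K δ q₀ b₀ t' G)
    {s : ℝ} (hs : s ∈ Metric.ball t₀ ε ∩ Set.Icc (0 : ℝ) 1) :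
    ∃ G', LocalFamily h f K δ q₀ b₀ s G' := by
  obtain ⟨-, hz', hσz⟩ := hloc.self_of_nhds t' ht'
  set z' := ζ (δ b₀ t' - q₁) with hz
  have hmem : (b₀, z') ∈ Metric.ball b₀ r ×ˢ Metric.ball (0 : ℂ) R :=
    ⟨Metric.mem_ball_self hc.r_pos, hz'⟩
  have hσc : ContinuousAt (fun e : B × ℂ => (e.1, σ e)) (b₀, z') :=
    continuousAt_fst.prodMk (hc.contDiffAt hmem).continuousAt
  have hGσ : ∀ w, ContDiffAt ℂ 2 (fun e : B × ℂ => G w (e.1, σ e)) (b₀, z') := by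
    intro w
    have h1 := hG.contDiffAt w
    rw [hσz] at h1
    exact ContDiffAt.comp (g := G w) (f := fun e : B × ℂ => (e.1, σ e)) (b₀, z') h1
      (contDiffAt_fst.prodMk ((hc.contDiffAt hmem).of_le (by norm_num)))
  -- The initial values are read off from the given family. By uniqueness of primitives the chart
  -- family then agrees with it near `z'` and inherits its derivative formula.
  let c : List ι → B → ℂ := fun w b => G w (b, σ (b, z'))
  have hcd : ∀ w, ContDiffAt ℂ 2 (c w) b₀ := fun w =>
    ContDiffAt.comp (g := fun e : B × ℂ => G w (e.1, σ e)) (f := fun b => (b, z')) b₀ (hGσ w)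
      (by fun_prop)
  -- the chart family agrees with the given one
  have hagree : ∀ w, ∀ᶠ e in 𝓝 (b₀, z'), chartFamily f σ z' c w e = G w (e.1, σ e) := by
    intro w
    induction w with
    | nil => exact Filter.Eventually.of_forall fun e => (hG.nil _).symm
    | cons i w ih =>
      obtain ⟨ρ, hρ, hρr, h1⟩ := exists_contDiffOn_chartFamily hf hc hz' hcd w
      refine eventually_eq_of_hasDerivAt
        (a := fun e => chartCoeff f σ i e * chartFamily f σ z' c w e) ?_ ?_ ?_
      · filter_upwards [ball_prod_ball_mem_nhds (b₀ := b₀) (r := ρ) (R := R) (e := (b₀, z'))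
          ⟨Metric.mem_ball_self hρ, hz'⟩] with e he
        exact hasDerivAt_chartFamily hf hc hz' hρr h1 i he
      · have hfib := hG.fibre i w
        rw [hσz] at hfib
        have hGe : ∀ᶠ e in 𝓝 (b₀, σ (b₀, z')), ContDiffAt ℂ 2 (G (i :: w)) e := by
          have := hG.contDiffAt (i :: w)
          rw [hσz] at this
          exact this.eventually (by simp)
        filter_upwards [ih, hσc.eventually hfib, hσc.eventually hGe,
          ball_prod_ball_mem_nhds hmem] with e he hef heG hemem
        have d1 : HasDerivAt (fun z : ℂ => (e.1, σ (e.1, z)))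
            ((0 : B), fderiv ℂ σ e (0, 1)) e.2 := by
          have hl : HasDerivAt (fun z : ℂ => (e.1, z)) ((0 : B), (1 : ℂ)) e.2 :=
            (hasDerivAt_const e.2 e.1).prodMk (hasDerivAt_id e.2)
          exact (hasDerivAt_const e.2 e.1).prodMk ((hc.hasFDerivAt hemem).comp_hasDerivAt e.2 hl)
        have d2 := (heG.differentiableAt (by simp)).hasFDerivAt.comp_hasDerivAt e.2 d1
        have d3 := hef (hc.h_eq e hemem) (fderiv ℂ σ e (0, 1)) (hc.fderiv_h hh hemem (0, 1))
        refine HasDerivAt.congr_deriv d2 ?_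
        rw [he, chartCoeff]
        exact d3
      · exact Filter.Eventually.of_forall fun b => chartFamily_initial i w b
  have hinit : ∀ w, ∀ᶠ b in 𝓝 b₀, iterInt (δ b) (w.map (formOf f)) t' =
      chartFamily f σ z' c w (b, ζ (δ b t' - q₁)) := by
    intro w
    have hcont : ContinuousAt (fun b => (b, ζ (δ b t' - q₁))) b₀ :=
      continuousAt_id.prodMk (ζ.continuous.continuousAt.comp (hδ.sub continuousAt_const))
    filter_upwards [hcont.eventually (hagree w), hG.eq w, hloc] with b hb1 hb2 hb3
    rw [hb2, hb1, ← (hb3 t' ht').2.2]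
  refine ⟨_, localFamily_chartFamily hh hf hc hz' hcd ht' hpath hloc hcov hinit ?_ hs⟩
  intro v A hA w hw
  have e1 : chartFamily f σ z' c w =ᶠ[𝓝 (b₀, z')] fun e => G w (e.1, σ e) := hagree w
  have e2 : HasFDerivAt (fun e : B × ℂ => G w (e.1, σ e)) ((fderiv ℂ (G w) (b₀, σ (b₀, z'))).comp
      ((ContinuousLinearMap.fst ℂ B ℂ).prod (fderiv ℂ σ (b₀, z')))) (b₀, z') := by
    have := hG.contDiffAt w
    rw [hσz] at this
    exact HasFDerivAt.comp (g := G w) (f := fun e : B × ℂ => (e.1, σ e)) (b₀, z')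
      (this.differentiableAt (by simp)).hasFDerivAt (hasFDerivAt_fst.prodMk (hc.hasFDerivAt hmem))
  have e3 := hG.deriv v A hA w hw (fderiv ℂ σ (b₀, z') (v, 0))
    (by rw [hσz]; exact hc.fderiv_h hh hmem (v, 0))
  rw [hσz] at e3
  have e4 : fderiv ℂ (chartFamily f σ z' c w) (b₀, z') (v, 0) =
      fderiv ℂ (G w) (b₀, σ (b₀, z')) (v, fderiv ℂ σ (b₀, z') (v, 0)) := by
    rw [e1.fderiv_eq, e2.fderiv]
    simp
  have e5 : ∀ u, chartFamily f σ z' c u (b₀, z') = G u (b₀, σ (b₀, z')) :=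
    fun u => (hagree u).self_of_nhds
  rw [chartDefect, e4, e3]
  simp only [e5]
  cases w with
  | nil => simp [headTerm]
  | cons i w =>
    simp only [headTerm, e5]
    ring

/-- The local family at the base point. -/
theorem LocalFamily.exists_of_base (hh : ContDiff ℂ 4 h) (hf : ∀ i, ContDiff ℂ 3 (f i))
    (hc : IsChart h (ContinuousLinearMap.fst ℂ ℂ ℂ) b₀ q₀ σ r R) {ε : ℝ} (hε : 0 < ε)
    (hpath : ∀ᶠ b in 𝓝 b₀, IsRegularPath (δ b)) (hq₀ : δ b₀ 0 = q₀)
    (hbase : ∀ᶠ b in 𝓝 b₀, (δ b 0).1 = 0)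
    (hloc : ∀ᶠ b in 𝓝 b₀, ∀ s ∈ Metric.ball (0 : ℝ) ε ∩ Set.Icc (0 : ℝ) 1,
      b ∈ Metric.ball b₀ r ∧ (δ b s - q₀).1 ∈ Metric.ball (0 : ℂ) R ∧
        δ b s = σ (b, (δ b s - q₀).1))
    (hcov : ∀ s ∈ Metric.ball (0 : ℝ) ε ∩ Set.Icc (0 : ℝ) 1,
      ChartCovers h (ContinuousLinearMap.fst ℂ ℂ ℂ) b₀ q₀ σ r R (b₀, δ b₀ s)) :
    ∃ G', LocalFamily h f K δ q₀ b₀ 0 G' := by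
  have h0 : (0 : ℝ) ∈ Metric.ball (0 : ℝ) ε ∩ Set.Icc 0 1 :=
    ⟨Metric.mem_ball_self hε, le_rfl, zero_le_one⟩
  have hz' : (0 : ℂ) ∈ Metric.ball (0 : ℂ) R := Metric.mem_ball_self hc.R_pos
  have hmem : (b₀, (0 : ℂ)) ∈ Metric.ball b₀ r ×ˢ Metric.ball (0 : ℂ) R :=
    ⟨Metric.mem_ball_self hc.r_pos, hz'⟩
  have hq1 : q₀.1 = 0 := by rw [← hq₀]; exact hbase.self_of_nhds
  have hσ0 : σ (b₀, 0) = q₀ := by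
    have := (hloc.self_of_nhds 0 h0).2.2
    rw [hq₀] at this
    simpa using this.symm
  have hzero : ∀ (i : ι) (w : List ι) (b : B),
      chartFamily f σ 0 (fun _ _ => 0) (i :: w) (b, 0) = 0 := fun i w b =>
    chartFamily_initial i w b
  refine ⟨_, localFamily_chartFamily (z' := 0) (c := fun _ _ => 0) hh hf hc hz'
    (fun _ => contDiffAt_const) h0 hpath hloc hcov ?_ ?_ h0⟩
  · intro w
    filter_upwards [hbase] with b hb
    have : ContinuousLinearMap.fst ℂ ℂ ℂ (δ b 0 - q₀) = 0 := by simp [hb, hq1]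
    rw [this]
    cases w with
    | nil => rfl
    | cons i w =>
      rw [hzero]
      simp [iterInt]
  · intro v A hA w hw
    -- On `x = 0` the primitives are identically `1` (empty word) or `0` in the parameter.
    have e1 : fderiv ℂ (chartFamily f σ 0 (fun _ _ => 0) w) (b₀, 0) (v, 0) = 0 := by
      obtain ⟨ρ, hρ, -, h1⟩ := exists_contDiffOn_chartFamily (c := fun _ _ => 0) hf hc hz'
        (fun _ => contDiffAt_const) w
      have h2 : HasFDerivAt (chartFamily f σ 0 (fun _ _ => 0) w) _ (b₀, 0) :=
        ((h1.contDiffAt (ball_prod_ball_mem_nhds ⟨Metric.mem_ball_self hρ, hz'⟩)).differentiableAt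
          (by simp)).hasFDerivAt
      have h3 := HasFDerivAt.comp (f := fun b : B => (b, (0 : ℂ))) b₀ h2
        (hasFDerivAt_prodMk_left b₀ (0 : ℂ))
      have h4 : HasFDerivAt (chartFamily f σ 0 (fun _ _ => 0) w ∘ fun b => (b, (0 : ℂ)))
          (0 : B →L[ℂ] ℂ) b₀ := by
        cases w with
        | nil => exact hasFDerivAt_const (1 : ℂ) b₀
        | cons i w =>
          have : (chartFamily f σ 0 (fun _ _ => 0) (i :: w) ∘ fun b => (b, (0 : ℂ))) =
              fun _ => 0 := funext fun b => hzero i w b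
          rw [this]
          exact hasFDerivAt_const (0 : ℂ) b₀
      have := DFunLike.congr_fun (h3.unique h4) v
      simpa using this
    have e2 : (fderiv ℂ σ (b₀, 0) (v, 0)).1 = 0 := hc.coord_fderiv hmem (v, 0)
    have e3 : ∀ w, headTerm (fun i => f i (σ (b₀, 0))) (chartFamily f σ 0 fun _ _ => 0) (b₀, 0)
        (0 : ℂ) w = 0 := by
      intro w
      cases w <;> simp [headTerm]
    -- In the remaining sum only the empty word has a nonzero primitive at the base point, and its
    -- coefficient vanishes there by `FlatData.base`.
    rw [chartDefect, e1, e2, e3, hσ0, sub_self, zero_sub, neg_eq_zero]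
    apply Finset.sum_eq_zero
    intro u _
    cases u with
    | nil => rw [hA.base, zero_mul]
    | cons j u => rw [hzero, mul_zero]

end Propagation

/-- Holomorphic dependence on the parameter of the iterated integrals along a family of loops, and
the formula for their derivatives. -/
theorem contDiffAt_iterInt [CompleteSpace B] {h : B × (ℂ × ℂ) → ℂ} (hh : ContDiff ℂ 4 h)
    {f : ι → ℂ × ℂ → ℂ} (hf : ∀ i, ContDiff ℂ 3 (f i)) (K : ℕ) {δ : B → ℝ → ℂ × ℂ} {b₀ : B}
    {U : Set B} (hU : IsOpen U) (hb₀ : b₀ ∈ U)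
    (hδ : ContinuousOn (fun x : B × ℝ => δ x.1 x.2) (U ×ˢ Set.Icc 0 1))
    (hpath : ∀ b ∈ U, IsRegularPath (δ b)) (hcurve : ∀ b ∈ U, ∀ s ∈ Set.Icc (0 : ℝ) 1, h (b, δ b s) = 0)
    (hloop : ∀ b ∈ U, δ b 1 = δ b 0) (hbase : ∀ b ∈ U, (δ b 0).1 = 0)
    (hsmooth : ∀ s ∈ Set.Icc (0 : ℝ) 1, ¬ (fderiv ℂ h (b₀, δ b₀ s) (0, (1, 0)) = 0 ∧
      fderiv ℂ h (b₀, δ b₀ s) (0, (0, 1)) = 0))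
    (htrans : fderiv ℂ h (b₀, δ b₀ 0) (0, (0, 1)) ≠ 0) (w : List ι) :
    ContDiffAt ℂ 2 (fun b => iterInt (δ b) (w.map (formOf f)) 1) b₀ ∧
    ∀ v A, FlatData h f K b₀ v (δ b₀ 0) A → w.length ≤ K →
      fderiv ℂ (fun b => iterInt (δ b) (w.map (formOf f)) 1) b₀ v =
        ∑ u ∈ wordsLE ι K, A w u (δ b₀ 0) * iterInt (δ b₀) (u.map (formOf f)) 1 := by
  have hUn := hU.mem_nhds hb₀
  have hpath' : ∀ᶠ b in 𝓝 b₀, IsRegularPath (δ b) := by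
    filter_upwards [hUn] with b hb using hpath b hb
  have hδs : ∀ s ∈ Set.Icc (0 : ℝ) 1, ContinuousAt (fun b => δ b s) b₀ := by
    intro s hs
    have : ContinuousOn (fun b => δ b s) U :=
      hδ.comp (f := fun b => (b, s)) (by fun_prop) fun b hb => ⟨hb, hs⟩
    exact this.continuousAt hUn
  -- localization in a chart
  have local_chart : ∀ (t₀ : ℝ) (ζ : ℂ × ℂ →L[ℂ] ℂ) (σ : B × ℂ → ℂ × ℂ) (r R : ℝ),
      t₀ ∈ Set.Icc (0 : ℝ) 1 → IsChart h ζ b₀ (δ b₀ t₀) σ r R → ∃ ε > 0,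
      (∀ᶠ b in 𝓝 b₀, ∀ s ∈ Metric.ball t₀ ε ∩ Set.Icc (0 : ℝ) 1, b ∈ Metric.ball b₀ r ∧
        ζ (δ b s - δ b₀ t₀) ∈ Metric.ball (0 : ℂ) R ∧ δ b s = σ (b, ζ (δ b s - δ b₀ t₀))) ∧
      (∀ s ∈ Metric.ball t₀ ε ∩ Set.Icc (0 : ℝ) 1,
        ChartCovers h ζ b₀ (δ b₀ t₀) σ r R (b₀, δ b₀ s)) := by
    intro t₀ ζ σ r R ht₀ hc
    have h1 := eventually_eventually_nhds.2 hc.surj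
    have h2 : Filter.Tendsto (fun x : B × ℝ => (x.1, δ x.1 x.2))
        (𝓝 b₀ ×ˢ 𝓝[Set.Icc 0 1] t₀) (𝓝 (b₀, δ b₀ t₀)) := by
      have h3 := hδ (b₀, t₀) ⟨hb₀, ht₀⟩
      rw [ContinuousWithinAt, nhdsWithin_prod_eq, hU.nhdsWithin_eq hb₀] at h3
      exact (Filter.tendsto_fst.prodMk_nhds h3)
    obtain ⟨pa, hpa, pb, hpb, hab⟩ := Filter.eventually_prod_iff.1 (h2.eventually h1)
    obtain ⟨ε, hε, hball⟩ := Metric.mem_nhdsWithin_iff.1 hpb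
    refine ⟨ε, hε, ?_, ?_⟩
    · filter_upwards [hpa, hUn] with b hb hbU s hs
      exact (hab hb (hball hs)).self_of_nhds (hcurve b hbU s hs.2)
    · intro s hs
      exact hab hpa.self_of_nhds (hball hs)
  have h01 : (0 : ℝ) ∈ Set.Icc (0 : ℝ) 1 := ⟨le_rfl, zero_le_one⟩
  have h11 : (1 : ℝ) ∈ Set.Icc (0 : ℝ) 1 := ⟨zero_le_one, le_rfl⟩
  -- the base point
  have hdet : chartDet h (ContinuousLinearMap.fst ℂ ℂ ℂ) (b₀, δ b₀ 0) ≠ 0 := by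
    simpa [chartDet] using htrans
  obtain ⟨σ₀, r₀, R₀, hc₀⟩ := exists_isChart hh (hcurve b₀ hb₀ 0 h01) hdet
  obtain ⟨ε₀, hε₀, hloc₀, hcov₀⟩ := local_chart 0 _ σ₀ r₀ R₀ h01 hc₀
  have hbase' : ∀ᶠ b in 𝓝 b₀, (δ b 0).1 = 0 := by
    filter_upwards [hUn] with b hb using hbase b hb
  have start : ∃ G, LocalFamily h f K δ (δ b₀ 0) b₀ 0 G :=
    LocalFamily.exists_of_base hh hf hc₀ hε₀ hpath' rfl hbase' hloc₀ hcov₀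
  -- continuation
  have cont : ∀ s t : unitInterval, (∃ G, LocalFamily h f K δ (δ b₀ 0) b₀ s G) →
      ∃ G, LocalFamily h f K δ (δ b₀ 0) b₀ t G := by
    -- A chart around any time carries a local family in both directions between that time and
    -- nearby ones; connectedness of the interval and transitivity then join `0` to `1`.
    apply PreconnectedSpace.induction₂'
    · intro t₀
      obtain ⟨ζ, hζ⟩ := exists_chartDet_ne_zero (hsmooth t₀ t₀.2)
      obtain ⟨σ, r, R, hc⟩ := exists_isChart hh (hcurve b₀ hb₀ t₀ t₀.2) hζ
      obtain ⟨ε, hε, hloc, hcov⟩ := local_chart t₀ ζ σ r R t₀.2 hc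
      have hmem : ∀ᶠ s : unitInterval in 𝓝 t₀, (s : ℝ) ∈ Metric.ball (t₀ : ℝ) ε :=
        continuous_subtype_val.continuousAt.eventually (Metric.ball_mem_nhds _ hε)
      have ht₀ : (t₀ : ℝ) ∈ Metric.ball (t₀ : ℝ) ε ∩ Set.Icc 0 1 :=
        ⟨Metric.mem_ball_self hε, t₀.2⟩
      filter_upwards [hmem] with s hs
      exact ⟨fun ⟨G, hG⟩ => hG.exists_of_chart hh hf hc ht₀ hpath' (hδs _ t₀.2) hloc hcov
          ⟨hs, s.2⟩,
        fun ⟨G, hG⟩ => hG.exists_of_chart hh hf hc ⟨hs, s.2⟩ hpath' (hδs _ s.2) hloc hcov ht₀⟩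
    · exact ⟨fun a b c hab hbc ha => hbc (hab ha)⟩
  obtain ⟨G, hG⟩ : ∃ G, LocalFamily h f K δ (δ b₀ 0) b₀ 1 G := cont 0 1 start
  -- the base point depends holomorphically on the parameter
  have hp : ContDiffAt ℂ 2 (fun b => δ b 0) b₀ := by
    have h1 : ContDiffAt ℂ 2 (fun b => σ₀ (b, 0)) b₀ :=
      ContDiffAt.comp (g := σ₀) (f := fun b => (b, (0 : ℂ))) b₀
        ((hc₀.contDiffAt ⟨Metric.mem_ball_self hc₀.r_pos,
          Metric.mem_ball_self hc₀.R_pos⟩).of_le (by norm_num)) (by fun_prop)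
    refine h1.congr_of_eventuallyEq ?_
    filter_upwards [hloc₀, hbase'] with b hb hb0
    have := (hb 0 ⟨Metric.mem_ball_self hε₀, h01⟩).2.2
    have h2 : ContinuousLinearMap.fst ℂ ℂ ℂ (δ b 0 - δ b₀ 0) = 0 := by
      simp [hb0, hbase'.self_of_nhds]
    rwa [h2] at this
  have hloop₀ := hloop b₀ hb₀
  have hGc : ∀ w, ContDiffAt ℂ 2 (G w) (b₀, δ b₀ 0) := fun w => hloop₀ ▸ hG.contDiffAt w
  have heq : ∀ w, (fun b => iterInt (δ b) (w.map (formOf f)) 1) =ᶠ[𝓝 b₀]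
      fun b => G w (b, δ b 0) := by
    intro w
    filter_upwards [hG.eq w, hUn] with b hb hbU
    rw [hb, hloop b hbU]
  refine ⟨?_, fun v A hA hw => ?_⟩
  · refine ContDiffAt.congr_of_eventuallyEq ?_ (heq w)
    exact ContDiffAt.comp (g := G w) (f := fun b => (b, δ b 0)) b₀ (hGc w)
      (contDiffAt_id.prodMk hp)
  · have hp1 : HasFDerivAt (fun b => (b, δ b 0)) ((ContinuousLinearMap.id ℂ B).prod
        (fderiv ℂ (fun b => δ b 0) b₀)) b₀ :=
      (hasFDerivAt_id b₀).prodMk (hp.differentiableAt (by simp)).hasFDerivAt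
    have d1 : HasFDerivAt (fun b => G w (b, δ b 0)) _ b₀ :=
      HasFDerivAt.comp (g := G w) (f := fun b => (b, δ b 0)) b₀
        ((hGc w).differentiableAt (by simp)).hasFDerivAt hp1
    have d2 : HasFDerivAt (fun b => h (b, δ b 0)) _ b₀ :=
      HasFDerivAt.comp (g := h) (f := fun b => (b, δ b 0)) b₀
        (hh.differentiable (by simp) _).hasFDerivAt hp1
    have d3 : HasFDerivAt (fun b => h (b, δ b 0)) (0 : B →L[ℂ] ℂ) b₀ := by
      refine (hasFDerivAt_const (0 : ℂ) b₀).congr_of_eventuallyEq ?_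
      filter_upwards [hUn] with b hb using hcurve b hb 0 h01
    have d4 : fderiv ℂ h (b₀, δ b₀ 0) (v, fderiv ℂ (fun b => δ b 0) b₀ v) = 0 := by
      have := DFunLike.congr_fun (d2.unique d3) v
      simpa using this
    -- The base point moves on `x = 0`, which kills the head term at the closing point of the loop.
    have d5 : (fderiv ℂ (fun b => δ b 0) b₀ v).1 = 0 := by
      have h1 : HasFDerivAt (fun b => (δ b 0).1) _ b₀ :=
        (ContinuousLinearMap.fst ℂ ℂ ℂ).hasFDerivAt.comp b₀
          (hp.differentiableAt (by simp)).hasFDerivAt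
      have h2 : HasFDerivAt (fun b => (δ b 0).1) (0 : B →L[ℂ] ℂ) b₀ :=
        (hasFDerivAt_const (0 : ℂ) b₀).congr_of_eventuallyEq hbase'
      have := DFunLike.congr_fun (h1.unique h2) v
      simpa using this
    have d6 := hG.deriv v A hA w hw (fderiv ℂ (fun b => δ b 0) b₀ v) (by rw [hloop₀]; exact d4)
    rw [hloop₀, d5] at d6
    rw [(heq w).fderiv_eq, d1.fderiv]
    have d7 : ∀ w, headTerm (fun i => f i (δ b₀ 0)) G (b₀, δ b₀ 0) (0 : ℂ) w = 0 := by
      intro w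
      cases w <;> simp [headTerm]
    rw [d7, zero_add] at d6
    simp only [ContinuousLinearMap.comp_apply, ContinuousLinearMap.prod_apply,
      ContinuousLinearMap.id_apply]
    rw [d6]
    refine Finset.sum_congr rfl fun u _ => ?_
    exact congrArg _ (heq u).self_of_nhds.symm

end

section

/-! ## Regularity of products of piecewise smooth loops -/

/-- The points of the partition form the countable exceptional set; on each open piece the
derivative coincides with `derivWithin`, which is continuous on the closed piece. -/
theorem PiecewiseC1.isRegularPath {q q' : ℂ × ℂ} {γ : Path q q'} (hγ : PiecewiseC1 γ) :
    IsRegularPath γ.extend := by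
  obtain ⟨m, t, hmono, h0, h1, hd⟩ := hγ
  refine ⟨γ.continuous_extend, ⟨Set.range t, Set.countable_range t, ?_⟩, ?_⟩
  · rintro u ⟨hu, hut⟩
    have hex : ∃ i, u ≤ t i := ⟨m, h1 ▸ hu.2.le⟩
    classical
    have hi := Nat.find_spec hex
    have him : Nat.find hex ≤ m := Nat.find_min' hex (h1 ▸ hu.2.le)
    obtain ⟨i, hi'⟩ : ∃ i, Nat.find hex = i + 1 := by
      apply Nat.exists_eq_succ_of_ne_zero
      intro h
      rw [h, h0] at hi
      exact absurd hu.1 (not_lt.2 hi)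
    have hlow : t i < u := not_le.1 (Nat.find_min hex (m := i) (by omega))
    rw [hi'] at hi
    have hupp : u < t (i + 1) := lt_of_le_of_ne hi fun h => hut ⟨i + 1, h.symm⟩
    exact ((hd i (by omega)).differentiableOn (by simp)).differentiableAt
      (Icc_mem_nhds hlow hupp)
  · rw [← h0, ← h1]
    apply IntervalIntegrable.trans_iterate
    intro i hi
    have hle : t i ≤ t (i + 1) := hmono (Nat.le_succ i)
    rcases hle.eq_or_lt with h | hlt
    · rw [h]
    · have hc : ContinuousOn (derivWithin γ.extend (Set.Icc (t i) (t (i + 1))))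
          (Set.Icc (t i) (t (i + 1))) :=
        (hd i hi).continuousOn_derivWithin (uniqueDiffOn_Icc hlt) le_rfl
      rw [← Set.uIcc_of_le hle] at hc
      refine hc.intervalIntegrable.congr_uIoo fun u hu => ?_
      rw [Set.uIoo_of_le hle] at hu
      rw [Set.uIcc_of_le hle]
      exact derivWithin_of_mem_nhds (Icc_mem_nhds hu.1 hu.2)

theorem IsRegularPath.trans {p q r : ℂ × ℂ} {γ : Path p q} {γ' : Path q r}
    (h : IsRegularPath γ.extend) (h' : IsRegularPath γ'.extend) :
    IsRegularPath (γ.trans γ').extend := by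
  have e1 : ∀ u < (1 / 2 : ℝ), (γ.trans γ').extend =ᶠ[𝓝 u] fun u => γ.extend (2 * u) := by
    intro u hu
    filter_upwards [gt_mem_nhds hu] with x hx using Path.extend_trans_of_le_half γ γ' hx.le
  have e2 : ∀ u > (1 / 2 : ℝ), (γ.trans γ').extend =ᶠ[𝓝 u] fun u => γ'.extend (2 * u - 1) := by
    intro u hu
    filter_upwards [lt_mem_nhds hu] with x hx using Path.extend_trans_of_half_le γ γ' hx.le
  refine ⟨Path.continuous_extend _, ?_, ?_⟩
  · obtain ⟨s, hs, hd⟩ := h.differentiable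
    obtain ⟨s', hs', hd'⟩ := h'.differentiable
    refine ⟨{1 / 2} ∪ ((fun u : ℝ => 2 * u) ⁻¹' s ∪ (fun u : ℝ => 2 * u - 1) ⁻¹' s'), ?_, ?_⟩
    · refine (Set.countable_singleton _).union ((hs.preimage_of_injOn ?_).union
        (hs'.preimage_of_injOn ?_))
      · intro x _ y _ hxy
        simpa using hxy
      · intro x _ y _ hxy
        simpa using hxy
    · rintro u ⟨hu, hus⟩
      simp only [Set.mem_union, Set.mem_singleton_iff, Set.mem_preimage, not_or] at hus
      rcases lt_or_gt_of_ne hus.1 with hlt | hgt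
      · rw [(e1 u hlt).differentiableAt_iff]
        have : DifferentiableAt ℝ γ.extend (2 * u) :=
          hd _ ⟨⟨by linarith [hu.1], by linarith⟩, hus.2.1⟩
        exact this.comp (f := fun u : ℝ => 2 * u) u (by fun_prop)
      · rw [(e2 u hgt).differentiableAt_iff]
        have : DifferentiableAt ℝ γ'.extend (2 * u - 1) :=
          hd' _ ⟨⟨by linarith, by linarith [hu.2]⟩, hus.2.2⟩
        exact this.comp (f := fun u : ℝ => 2 * u - 1) u (by fun_prop)
  · have i1 : IntervalIntegrable (deriv (γ.trans γ').extend) MeasureTheory.volume 0 (1 / 2) := by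
      have h2 := (h.integrable.comp_mul_left (c := 2)).smul (2 : ℝ)
      rw [zero_div] at h2
      refine h2.congr_uIoo fun u hu => ?_
      rw [Set.uIoo_of_le (by norm_num)] at hu
      rw [(e1 u hu.2).deriv_eq]
      exact (deriv_comp_mul_left (2 : ℝ) γ.extend u).symm
    have i2 : IntervalIntegrable (deriv (γ.trans γ').extend) MeasureTheory.volume (1 / 2) 1 := by
      have h2 := ((h'.integrable.comp_sub_right 1).comp_mul_left (c := 2)).smul (2 : ℝ)
      have n1 : ((0 : ℝ) + 1) / 2 = 1 / 2 := by norm_num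
      have n2 : ((1 : ℝ) + 1) / 2 = 1 := by norm_num
      rw [n1, n2] at h2
      refine h2.congr_uIoo fun u hu => ?_
      rw [Set.uIoo_of_le (by norm_num)] at hu
      rw [(e2 u hu.1).deriv_eq]
      have h3 := deriv_comp_mul_left (2 : ℝ) (fun x => γ'.extend (x - 1)) u
      rw [deriv_comp_sub_const] at h3
      exact h3.symm
    exact i1.trans i2

theorem isRegularPath_loopProd {ι : Type} {q : ℂ × ℂ} {γ : ι → Path q q}
    (h : ∀ j, IsRegularPath (γ j).extend) (l : List ι) : IsRegularPath (loopProd γ l).extend := by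
  induction l with
  | nil =>
    have e : (loopProd γ []).extend = fun _ : ℝ => q := rfl
    rw [e]
    refine ⟨continuous_const, ⟨∅, Set.countable_empty, fun t _ => differentiableAt_const q⟩, ?_⟩
    simp
  | cons j l ih => exact (h j).trans ih

theorem loopProd_mem {ι : Type} {q : ℂ × ℂ} {γ : ι → Path q q} {X : Set (ℂ × ℂ)} (hq : q ∈ X)
    (h : ∀ j t, γ j t ∈ X) (l : List ι) : ∀ t, loopProd γ l t ∈ X := by
  induction l with
  | nil => exact fun t => hq
  | cons j l ih =>
    intro t
    rw [loopProd, Path.trans_apply]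
    split_ifs
    · exact h _ _
    · exact ih _

theorem continuous_loopProd {T ι : Type} [TopologicalSpace T] {q : T → ℂ × ℂ} (hq : Continuous q)
    {γ : ι → ∀ b : T, Path (q b) (q b)} (h : ∀ j, Continuous ↿(γ j)) (l : List ι) :
    Continuous ↿(fun b => loopProd (fun j => γ j b) l) := by
  induction l with
  | nil => exact hq.comp continuous_fst
  | cons j l ih => exact Path.trans_continuous_family (γ j) (h j) _ ih

/-! ## The Hamiltonian as a function on the total space -/

/-- The value of the Hamiltonian with given coefficients at a given point. -/
def hamFn (n : ℕ) (e : (Idx n → ℂ) × (ℂ × ℂ)) : ℂ :=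
  ∑ α : Idx n, e.1 α * (e.2.1 ^ (α.1.1 : ℕ) * e.2.2 ^ (α.1.2 : ℕ))

/-- The derivative of the Hamiltonian with respect to `x`. -/
def hamFnX (n : ℕ) (e : (Idx n → ℂ) × (ℂ × ℂ)) : ℂ :=
  ∑ α : Idx n, e.1 α * ((α.1.1 : ℕ) * e.2.1 ^ ((α.1.1 : ℕ) - 1) * e.2.2 ^ (α.1.2 : ℕ))

/-- The derivative of the Hamiltonian with respect to `y`. -/
def hamFnY (n : ℕ) (e : (Idx n → ℂ) × (ℂ × ℂ)) : ℂ :=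
  ∑ α : Idx n, e.1 α * (e.2.1 ^ (α.1.1 : ℕ) * ((α.1.2 : ℕ) * e.2.2 ^ ((α.1.2 : ℕ) - 1)))

theorem contDiff_hamFn (n : ℕ) : ContDiff ℂ 4 (hamFn n) := by
  unfold hamFn
  fun_prop

theorem fderiv_hamFn {n : ℕ} (e : (Idx n → ℂ) × (ℂ × ℂ)) (v : Idx n → ℂ) (ξ : ℂ × ℂ) :
    fderiv ℂ (hamFn n) e (v, ξ) =
      hamFn n (v, e.2) + hamFnX n e * ξ.1 + hamFnY n e * ξ.2 := by
  have hα : ∀ α : Idx n, HasFDerivAt (fun e : (Idx n → ℂ) × (ℂ × ℂ) =>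
      e.1 α * (e.2.1 ^ (α.1.1 : ℕ) * e.2.2 ^ (α.1.2 : ℕ)))
      (e.1 α • (e.2.1 ^ (α.1.1 : ℕ) • ((α.1.2 : ℕ) * e.2.2 ^ ((α.1.2 : ℕ) - 1)) •
        (ContinuousLinearMap.snd ℂ ℂ ℂ).comp (ContinuousLinearMap.snd ℂ (Idx n → ℂ) (ℂ × ℂ)) +
        e.2.2 ^ (α.1.2 : ℕ) • ((α.1.1 : ℕ) * e.2.1 ^ ((α.1.1 : ℕ) - 1)) •
        (ContinuousLinearMap.fst ℂ ℂ ℂ).comp (ContinuousLinearMap.snd ℂ (Idx n → ℂ) (ℂ × ℂ))) +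
        (e.2.1 ^ (α.1.1 : ℕ) * e.2.2 ^ (α.1.2 : ℕ)) •
        (ContinuousLinearMap.proj (R := ℂ) (φ := fun _ : Idx n => ℂ) α).comp
          (ContinuousLinearMap.fst ℂ (Idx n → ℂ) (ℂ × ℂ))) e := by
    intro α
    apply HasFDerivAt.mul
    · exact (ContinuousLinearMap.proj (R := ℂ) (φ := fun _ : Idx n => ℂ) α).hasFDerivAt.comp e
        hasFDerivAt_fst
    · apply HasFDerivAt.mul
      · exact (hasDerivAt_pow _ _).comp_hasFDerivAt e
          ((ContinuousLinearMap.fst ℂ ℂ ℂ).hasFDerivAt.comp e hasFDerivAt_snd)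
      · exact (hasDerivAt_pow _ _).comp_hasFDerivAt e
          ((ContinuousLinearMap.snd ℂ ℂ ℂ).hasFDerivAt.comp e hasFDerivAt_snd)
  have := HasFDerivAt.fun_sum (u := Finset.univ) fun α _ => hα α
  have h2 : HasFDerivAt (hamFn n) _ e := this
  rw [h2.fderiv, hamFn, hamFnX, hamFnY, Finset.sum_mul, Finset.sum_mul,
    ← Finset.sum_add_distrib, ← Finset.sum_add_distrib, sum_apply]
  refine Finset.sum_congr rfl fun α _ => ?_
  simp
  ring

theorem evalAt_ham {n : ℕ} (a : Idx n → ℂ) (q : ℂ × ℂ) : evalAt (ham a) q = hamFn n (a, q) := by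
  simp [evalAt, ham, hamFn]

theorem evalAt_pderiv_zero_ham {n : ℕ} (a : Idx n → ℂ) (q : ℂ × ℂ) :
    evalAt (MvPolynomial.pderiv 0 (ham a)) q = hamFnX n (a, q) := by
  simp only [evalAt, ham, hamFnX, map_sum, Derivation.leibniz, MvPolynomial.pderiv_C,
    Derivation.leibniz_pow, MvPolynomial.pderiv_X]
  refine Finset.sum_congr rfl fun α _ => ?_
  simp [mul_comm]

theorem evalAt_pderiv_one_ham {n : ℕ} (a : Idx n → ℂ) (q : ℂ × ℂ) :
    evalAt (MvPolynomial.pderiv 1 (ham a)) q = hamFnY n (a, q) := by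
  simp only [evalAt, ham, hamFnY, map_sum, Derivation.leibniz, MvPolynomial.pderiv_C,
    Derivation.leibniz_pow, MvPolynomial.pderiv_X]
  refine Finset.sum_congr rfl fun α _ => ?_
  simp

/-! ## Iterated integrals along the products of a family of cycles -/

theorem letters_injective (n K : ℕ) : Function.Injective (Word.letters : Word n K → _) := by
  rintro ⟨⟨k, hk⟩, f⟩ ⟨⟨k', hk'⟩, f'⟩ h
  have hlen := congrArg List.length h
  simp only [Word.letters, List.length_ofFn] at hlen
  subst hlen
  simpa [Word.letters] using h

theorem length_letters_le {n K : ℕ} (w : Word n K) : w.letters.length ≤ K := by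
  simp only [Word.letters, List.length_ofFn]
  omega

theorem sum_wordsLE_eq_sum_word {n K : ℕ} {M : Type} [AddCommMonoid M]
    (φ : List (Fin n × Fin n) → M) :
    ∑ u ∈ wordsLE (Fin n × Fin n) K, φ u = ∑ u : Word n K, φ u.letters := by
  have : wordsLE (Fin n × Fin n) K = Finset.univ.image (Word.letters : Word n K → _) := by
    ext u
    rw [mem_wordsLE]
    simp only [Finset.mem_image, Finset.mem_univ, true_and]
    constructor
    · intro hu
      exact ⟨⟨⟨u.length, Nat.lt_succ_of_le hu⟩, u.get⟩, by simp [Word.letters]⟩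
    · rintro ⟨w, rfl⟩
      exact length_letters_le w
  rw [this, Finset.sum_image fun _ _ _ _ h => letters_injective n K h]

/-- The coefficient of the basic form. -/
def basicCoeff {n : ℕ} (i : Fin n × Fin n) (q : ℂ × ℂ) : ℂ :=
  q.1 ^ (i.1 : ℕ) * q.2 ^ ((i.2 : ℕ) + 1)

/-- The base point is the starting point of a loop, and `1 ≤ n` ensures that there is a loop. -/
theorem CycleFamily.continuousOn_base {n : ℕ} (hn : 1 ≤ n) {a : Idx n → ℂ} (F : CycleFamily a) :
    ContinuousOn F.base F.U := by
  have h1 := (F.continuousOn_loop (⟨0, hn⟩, ⟨0, hn⟩)).comp (f := fun b => (b, (0 : unitInterval)))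
    (s := F.U) (by fun_prop) fun b hb => ⟨hb, Set.mem_univ _⟩
  refine h1.snd.congr fun b _ => ?_
  simp

/-- Transversality at the base point persists by continuity, and smoothness of the curve along the
compact loops persists by compactness of the interval. Hence `contDiffAt_iterInt` applies at every
`b` close to `a` and not just at `a`. -/
theorem CycleFamily.eventually_S {n : ℕ} (hn : 1 ≤ n) {a : Idx n → ℂ} (hs : SmoothCurve a)
    (ht : TransversalToAxis a) (F : CycleFamily a) (K : ℕ) :
    ∀ᶠ b in 𝓝 a, b ∈ F.U ∧ ∀ w v : Word n K, ContDiffAt ℂ 2 (fun b => F.S K b w v) b ∧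
      ∀ z A, FlatData (hamFn n) basicCoeff K b z ((0 : ℂ), F.base b) A →
        fderiv ℂ (fun b => F.S K b w v) b z =
          ∑ u : Word n K, A w.letters u.letters ((0 : ℂ), F.base b) * F.S K b u v := by
  have hUn := F.isOpen_U.mem_nhds F.mem_U
  have hbc := F.continuousOn_base hn
  have hU : ∀ b ∈ F.U, F.U ∈ 𝓝 b := fun b hb => F.isOpen_U.mem_nhds hb
  -- transversality to the axis
  have htrans : ∀ᶠ b in 𝓝 a, hamFnY n (b, ((0 : ℂ), F.base b)) ≠ 0 := by
    have h1 : ContinuousAt (fun b => hamFnY n (b, ((0 : ℂ), F.base b))) a := by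
      have h2 : Continuous (hamFnY n) := by unfold hamFnY; fun_prop
      exact h2.continuousAt.comp (continuousAt_id.prodMk
        (continuousAt_const.prodMk (hbc.continuousAt hUn)))
    apply h1.eventually_ne
    rw [← evalAt_pderiv_one_ham]
    exact ht _ (F.base_mem a F.mem_U)
  -- the loops
  have hcont : ∀ l, ContinuousOn (fun x : (Idx n → ℂ) × ℝ =>
      (loopProd (fun j => F.loop j x.1) l).extend x.2) (F.U ×ˢ Set.univ) := by
    intro l
    have h1 : Continuous (fun b : F.U => ((0 : ℂ), F.base b)) :=
      continuous_const.prodMk (continuousOn_iff_continuous_domRestrict.1 hbc)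
    have h2 := continuous_loopProd h1 (γ := fun j (b : F.U) => F.loop j b) (fun j => by
      have := continuousOn_iff_continuous_domRestrict.1 (F.continuousOn_loop j)
      exact this.comp (f := fun x : F.U × unitInterval =>
        (⟨(x.1.1, x.2), x.1.2, Set.mem_univ _⟩ : F.U ×ˢ (Set.univ : Set unitInterval)))
        (by fun_prop)) l
    have h3 := Path.continuous_uncurry_extend_of_continuous_family _ h2
    rw [continuousOn_iff_continuous_domRestrict]
    exact h3.comp (f := fun x : (F.U ×ˢ (Set.univ : Set ℝ) : Set _) =>
      ((⟨x.1.1, x.2.1⟩ : F.U), x.1.2)) (by fun_prop)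
  have hcurve : ∀ l, ∀ b ∈ F.U, ∀ s ∈ Set.Icc (0 : ℝ) 1,
      (loopProd (fun j => F.loop j b) l).extend s ∈ curve b := by
    intro l b hb s hs
    rw [Path.extend_apply _ hs]
    exact loopProd_mem (F.base_mem b hb) (fun j t => F.loop_mem j b hb t) l _
  have hsmooth : ∀ l, ∀ᶠ b in 𝓝 a, ∀ s ∈ Set.Icc (0 : ℝ) 1,
      (hamFnX n (b, (loopProd (fun j => F.loop j b) l).extend s),
        hamFnY n (b, (loopProd (fun j => F.loop j b) l).extend s)) ≠ (0 : ℂ × ℂ) := by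
    intro l
    apply isCompact_Icc.eventually_forall_of_forall_eventually
    intro s hs'
    have h1 : ContinuousAt (fun x : (Idx n → ℂ) × ℝ =>
        (loopProd (fun j => F.loop j x.1) l).extend x.2) (a, s) :=
      (hcont l).continuousAt ((F.isOpen_U.prod isOpen_univ).mem_nhds ⟨F.mem_U, Set.mem_univ _⟩)
    have h2 : Continuous (fun e => (hamFnX n e, hamFnY n e)) := by
      unfold hamFnX hamFnY
      fun_prop
    have h3 := h2.continuousAt.comp (continuousAt_fst.prodMk h1)
    apply h3.eventually_ne
    intro h0
    apply hs _ (hcurve l a F.mem_U s hs')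
    rw [evalAt_pderiv_zero_ham, evalAt_pderiv_one_ham]
    exact Prod.ext_iff.1 h0
  have hsm : ∀ᶠ b in 𝓝 a, ∀ v : Word n K, ∀ s ∈ Set.Icc (0 : ℝ) 1,
      (hamFnX n (b, (loopProd (fun j => F.loop j b) v.letters).extend s),
        hamFnY n (b, (loopProd (fun j => F.loop j b) v.letters).extend s)) ≠ (0 : ℂ × ℂ) :=
    Filter.eventually_all.2 fun v => hsmooth v.letters
  have hf : ∀ i : Fin n × Fin n, ContDiff ℂ 3 (basicCoeff i) := by
    intro i
    unfold basicCoeff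
    fun_prop
  filter_upwards [hUn, htrans, hsm] with b hbU hbt hbs
  refine ⟨hbU, fun w v => ?_⟩
  have zero_X : ∀ e : (Idx n → ℂ) × (ℂ × ℂ), fderiv ℂ (hamFn n) e (0, (1, 0)) = hamFnX n e := by
    intro e
    rw [fderiv_hamFn]
    simp [hamFn]
  have zero_Y : ∀ e : (Idx n → ℂ) × (ℂ × ℂ), fderiv ℂ (hamFn n) e (0, (0, 1)) = hamFnY n e := by
    intro e
    rw [fderiv_hamFn]
    simp [hamFn]
  have main := contDiffAt_iterInt (contDiff_hamFn n) hf K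
    (δ := fun b => (loopProd (fun j => F.loop j b) v.letters).extend) (b₀ := b) F.isOpen_U hbU
    ((hcont v.letters).mono (Set.prod_mono le_rfl (Set.subset_univ _)))
    (fun b hb => isRegularPath_loopProd (fun j => (F.piecewiseC1_loop j b hb).isRegularPath) _)
    (fun b hb s hs => by rw [← evalAt_ham]; exact hcurve v.letters b hb s hs)
    (fun b _ => by simp) (fun b _ => by simp)
    (fun s hs h0 => hbs v s hs (by rw [zero_X, zero_Y] at h0; exact Prod.ext h0.1 h0.2))
    (by rw [zero_Y]; simpa using hbt) w.letters
  refine ⟨main.1, fun z A hA => ?_⟩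
  have := main.2 z A (by simpa using hA) (length_letters_le w)
  rw [sum_wordsLE_eq_sum_word] at this
  refine Eq.trans this (Finset.sum_congr rfl fun u _ => ?_)
  simp only [Path.extend_zero]
  rfl

end

section

/-! ## Norms and weights of integer polynomials -/

open MvPolynomial

variable {τ : Type}

theorem polyNorm_eq_sum {P : MvPolynomial τ ℤ} {S : Finset (τ →₀ ℕ)} (h : P.support ⊆ S) :
    polyNorm P = ∑ m ∈ S, (P.coeff m).natAbs := by
  apply Finset.sum_subset h
  intro m _ hm
  rw [notMem_support_iff.1 hm, Int.natAbs_zero]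

theorem polyNorm_add_le (P Q : MvPolynomial τ ℤ) : polyNorm (P + Q) ≤ polyNorm P + polyNorm Q := by
  classical
  rw [polyNorm_eq_sum (support_add (p := P) (q := Q)), polyNorm_eq_sum Finset.subset_union_left,
    polyNorm_eq_sum (P := Q) Finset.subset_union_right, ← Finset.sum_add_distrib]
  refine Finset.sum_le_sum fun m _ => ?_
  rw [coeff_add]
  exact Int.natAbs_add_le _ _

theorem polyNorm_monomial_le (m : τ →₀ ℕ) (c : ℤ) : polyNorm (monomial m c) ≤ c.natAbs := by
  classical
  rw [polyNorm_eq_sum (support_monomial_subset (s := m) (a := c))]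
  simp

/-- The polynomial is homogeneous of degree `t` for the weights `ω`, of degree at most `d` for the
weights `ω'`, and has norm at most `N`. -/
structure Bd (ω ω' : τ → ℕ) (t d N : ℕ) (P : MvPolynomial τ ℤ) : Prop where
  hom : ∀ m, P.coeff m ≠ 0 → Finsupp.weight ω m = t
  deg : ∀ m, P.coeff m ≠ 0 → Finsupp.weight ω' m ≤ d
  norm : polyNorm P ≤ N

namespace Bd

variable {ω ω' : τ → ℕ} {t t' d d' N N' : ℕ} {P Q : MvPolynomial τ ℤ}

theorem mono (h : Bd ω ω' t d N P) (hd : d ≤ d') (hN : N ≤ N') : Bd ω ω' t d' N' P :=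
  ⟨h.hom, fun m hm => (h.deg m hm).trans hd, h.norm.trans hN⟩

theorem zero : Bd ω ω' t d N (0 : MvPolynomial τ ℤ) :=
  ⟨fun m hm => absurd (coeff_zero m) hm, fun m hm => absurd (coeff_zero m) hm, by simp [polyNorm]⟩

theorem monomial (m : τ →₀ ℕ) (c : ℤ) (ht : Finsupp.weight ω m = t)
    (hd : Finsupp.weight ω' m ≤ d) (hN : c.natAbs ≤ N) : Bd ω ω' t d N (monomial m c) := by
  classical
  refine ⟨fun m' hm' => ?_, fun m' hm' => ?_, (polyNorm_monomial_le m c).trans hN⟩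
  · rw [coeff_monomial] at hm'
    obtain rfl : m = m' := by_contra fun h => hm' (if_neg h)
    exact ht
  · rw [coeff_monomial] at hm'
    obtain rfl : m = m' := by_contra fun h => hm' (if_neg h)
    exact hd

theorem add (h : Bd ω ω' t d N P) (h' : Bd ω ω' t d N' Q) : Bd ω ω' t d (N + N') (P + Q) := by
  refine ⟨fun m hm => ?_, fun m hm => ?_,
    (polyNorm_add_le P Q).trans (Nat.add_le_add h.norm h'.norm)⟩
  · rw [coeff_add] at hm
    by_cases h0 : P.coeff m = 0
    · exact h'.hom m (by rwa [h0, zero_add] at hm)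
    · exact h.hom m h0
  · rw [coeff_add] at hm
    by_cases h0 : P.coeff m = 0
    · exact h'.deg m (by rwa [h0, zero_add] at hm)
    · exact h.deg m h0

theorem sum {ι : Type} (s : Finset ι) {F : ι → MvPolynomial τ ℤ} {n : ι → ℕ}
    (h : ∀ i ∈ s, Bd ω ω' t d (n i) (F i)) : Bd ω ω' t d (∑ i ∈ s, n i) (∑ i ∈ s, F i) := by
  classical
  induction s using Finset.induction_on with
  | empty => exact zero
  | insert i s hi ih =>
    rw [Finset.sum_insert hi, Finset.sum_insert hi]
    exact (h i (Finset.mem_insert_self i s)).add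
      (ih fun j hj => h j (Finset.mem_insert_of_mem hj))

theorem sum_const {ι : Type} (s : Finset ι) {F : ι → MvPolynomial τ ℤ}
    (h : ∀ i ∈ s, Bd ω ω' t d N (F i)) : Bd ω ω' t d (s.card * N) (∑ i ∈ s, F i) := by
  have := Bd.sum s h
  rwa [Finset.sum_const, smul_eq_mul] at this

theorem zsmul (c : ℤ) (h : Bd ω ω' t d N P) : Bd ω ω' t d (c.natAbs * N) (c • P) := by
  refine ⟨fun m hm => ?_, fun m hm => ?_, ?_⟩
  · rw [coeff_smul, smul_eq_mul] at hm
    exact h.hom m (right_ne_zero_of_mul hm)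
  · rw [coeff_smul, smul_eq_mul] at hm
    exact h.deg m (right_ne_zero_of_mul hm)
  · rw [polyNorm_eq_sum (support_smul (a := c) (f := P))]
    simp only [coeff_smul, smul_eq_mul, Int.natAbs_mul]
    rw [← Finset.mul_sum]
    exact Nat.mul_le_mul_left _ h.norm

theorem neg (h : Bd ω ω' t d N P) : Bd ω ω' t d N (-P) := by
  have := h.zsmul (-1)
  simpa using this

/-- The image under an additive map whose values on the monomials are bounded. -/
theorem map {σ : Type} {P : MvPolynomial σ ℤ} (Φ : MvPolynomial σ ℤ →ₗ[ℤ] MvPolynomial τ ℤ)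
    (hP : polyNorm P ≤ N')
    (h : ∀ m, P.coeff m ≠ 0 → Bd ω ω' t d N (Φ (MvPolynomial.monomial m 1))) :
    Bd ω ω' t d (N' * N) (Φ P) := by
  have e : Φ P = ∑ m ∈ P.support, P.coeff m • Φ (MvPolynomial.monomial m 1) := by
    conv_lhs => rw [P.as_sum, map_sum]
    refine Finset.sum_congr rfl fun m _ => ?_
    rw [← map_smul, smul_monomial, smul_eq_mul, mul_one]
  rw [e]
  have := Bd.sum P.support fun m hm => (h m (mem_support_iff.1 hm)).zsmul (P.coeff m)
  refine this.mono le_rfl ?_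
  rw [← Finset.sum_mul]
  exact Nat.mul_le_mul_right _ hP

theorem mul (h : Bd ω ω' t d N P) (h' : Bd ω ω' t' d' N' Q) :
    Bd ω ω' (t + t') (d + d') (N * N') (P * Q) := by
  refine map (LinearMap.mulRight ℤ Q) h.norm fun m hm => ?_
  rw [LinearMap.mulRight_apply, ← mul_one N']
  refine map (LinearMap.mulLeft ℤ (MvPolynomial.monomial m 1)) h'.norm fun m' hm' => ?_
  rw [LinearMap.mulLeft_apply, monomial_mul]
  refine monomial _ _ ?_ ?_ (by simp)
  · rw [map_add, h.hom m hm, h'.hom m' hm']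
  · rw [map_add]
    exact Nat.add_le_add (h.deg m hm) (h'.deg m' hm')

theorem X (i : τ) : Bd ω ω' (ω i) (ω' i) 1 (MvPolynomial.X i) :=
  monomial _ _ (by simp [Finsupp.weight_single]) (by simp [Finsupp.weight_single]) (by simp)

theorem one : Bd ω ω' 0 0 1 (1 : MvPolynomial τ ℤ) :=
  monomial 0 1 (by simp) (by simp) (by simp)

theorem intCast (c : ℤ) : Bd ω ω' 0 0 c.natAbs (c : MvPolynomial τ ℤ) := by
  have := (one (ω := ω) (ω' := ω')).zsmul c
  simpa using this

theorem pow (h : Bd ω ω' t d N P) (k : ℕ) : Bd ω ω' (k * t) (k * d) (N ^ k) (P ^ k) := by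
  induction k with
  | zero => simpa using one
  | succ k ih =>
    rw [pow_succ, pow_succ, Nat.succ_mul, Nat.succ_mul]
    exact ih.mul h

theorem prod {ι : Type} (s : Finset ι) {F : ι → MvPolynomial τ ℤ} {t d n : ι → ℕ}
    (h : ∀ i ∈ s, Bd ω ω' (t i) (d i) (n i) (F i)) :
    Bd ω ω' (∑ i ∈ s, t i) (∑ i ∈ s, d i) (∏ i ∈ s, n i) (∏ i ∈ s, F i) := by
  classical
  induction s using Finset.induction_on with
  | empty => simpa using one
  | insert i s hi ih =>
    rw [Finset.sum_insert hi, Finset.sum_insert hi, Finset.prod_insert hi, Finset.prod_insert hi]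
    exact (h i (Finset.mem_insert_self i s)).mul
      (ih fun j hj => h j (Finset.mem_insert_of_mem hj))

/-- Substitution of polynomials. -/
theorem aeval {σ : Type} {υ υ' : σ → ℕ} {P : MvPolynomial σ ℤ} (h : Bd υ υ' t d N P)
    {F : σ → MvPolynomial τ ℤ} (hF : ∀ i, Bd ω ω' (υ i) (υ' i) 1 (F i)) :
    Bd ω ω' t d N (MvPolynomial.aeval F P) := by
  rw [← mul_one N]
  refine map (MvPolynomial.aeval F).toLinearMap h.norm fun m hm => ?_
  rw [AlgHom.toLinearMap_apply, aeval_monomial, map_one, one_mul]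
  have := Bd.prod m.support fun i _ => (hF i).pow (m i)
  simp only [one_pow, Finset.prod_const_one] at this
  have e : ∀ ω : σ → ℕ, ∑ i ∈ m.support, m i * ω i = Finsupp.weight ω m := by
    intro ω
    rw [Finsupp.weight_apply, Finsupp.sum]
    simp
  rw [e, e, h.hom m hm] at this
  exact this.mono (h.deg m hm) le_rfl

end Bd

/-! ## Determinants -/

/-- The weight of an entry may depend on its row: in a cofactor one row of linear forms is replaced
by a row of constants. -/
theorem bd_det {ω ω' : τ → ℕ} {κ : Type} [Fintype κ] [DecidableEq κ]
    {M : Matrix κ κ (MvPolynomial τ ℤ)} {r : κ → ℕ} {b : ℕ} (h : ∀ i j, Bd ω ω' (r i) 0 b (M i j)) :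
    Bd ω ω' (∑ i, r i) 0 ((Fintype.card κ).factorial * b ^ Fintype.card κ) M.det := by
  rw [Matrix.det_apply, ← Fintype.card_perm]
  apply Bd.sum_const Finset.univ
  intro σ _
  have := Bd.prod Finset.univ fun i _ => h (σ i) i
  simp only [Finset.sum_const_zero, Finset.prod_const] at this
  rw [Equiv.sum_comp σ r] at this
  rcases Int.units_eq_one_or (Equiv.Perm.sign σ) with hs | hs
  · rw [hs, one_smul]
    exact this
  · rw [hs, Units.neg_smul, one_smul]
    exact this.neg

theorem bd_adjugate {ω ω' : τ → ℕ} {κ : Type} [Fintype κ] [DecidableEq κ]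
    {M : Matrix κ κ (MvPolynomial τ ℤ)} {b : ℕ} (hb : 1 ≤ b) (h : ∀ i j, Bd ω ω' 1 0 b (M i j))
    (i j : κ) : Bd ω ω' (Fintype.card κ - 1) 0
      ((Fintype.card κ).factorial * b ^ Fintype.card κ) (M.adjugate i j) := by
  rw [Matrix.adjugate_apply]
  have e : Fintype.card κ - 1 = ∑ k : κ, if k = j then 0 else 1 := by
    rw [← Finset.card_univ, ← Finset.card_erase_of_mem (Finset.mem_univ j), Finset.card_eq_sum_ones,
      ← Finset.sum_filter_add_sum_filter_not Finset.univ (fun k => k = j)]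
    rw [Finset.sum_ite_of_true (s := {x | x = j}) (by simp), Finset.sum_ite_of_false (by simp)]
    simp [Finset.filter_ne']
  rw [e]
  apply bd_det
  intro k l
  by_cases hk : k = j
  · subst hk
    rw [Matrix.updateRow_self, if_pos rfl]
    by_cases hl : l = i
    · subst hl
      rw [Pi.single_eq_same]
      exact Bd.one.mono le_rfl hb
    · rw [Pi.single_eq_of_ne hl]
      exact Bd.zero
  · rw [Matrix.updateRow_ne hk, if_neg hk]
    exact h k l

/-- A matrix of linear forms over `ℤ` that is of full row rank at some point has a right inverse up
to a determinant. -/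
theorem exists_scaled_rightInverse {κ Col I : Type} [Fintype κ] [DecidableEq κ] [Fintype Col]
    [DecidableEq Col] [Fintype I] (k : I → Matrix κ Col ℤ) {b : ℕ} (hb : ∀ a i j, (k a i j).natAbs ≤ b)
    (hb1 : 1 ≤ Fintype.card I * b) (x₀ : I → ℚ)
    (hsurj : ∀ i : κ, Pi.single i 1 ∈ Submodule.span ℚ
      (Set.range fun (c : Col) (i : κ) => ∑ a, x₀ a * (k a i c : ℚ))) :
    ∃ (Δ : MvPolynomial I ℤ) (Y : Matrix Col κ (MvPolynomial I ℤ)), Δ ≠ 0 ∧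
      Bd (fun _ => 1) (fun _ => 0) (Fintype.card κ) 0
        ((Fintype.card κ).factorial * (Fintype.card I * b) ^ Fintype.card κ) Δ ∧
      (∀ c i, Bd (fun _ => 1) (fun _ => 0) (Fintype.card κ - 1) 0
        (Fintype.card κ * ((Fintype.card κ).factorial * (Fintype.card I * b) ^ Fintype.card κ))
          (Y c i)) ∧
      (Matrix.of fun i c => ∑ a, (k a i c : MvPolynomial I ℤ) * MvPolynomial.X a) * Y =
        Δ • (1 : Matrix κ κ (MvPolynomial I ℤ)) := by
  set col : Col → κ → ℚ := fun c i => ∑ a, x₀ a * (k a i c : ℚ) with hcol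
  have htop : Submodule.span ℚ (Set.range col) = ⊤ := by
    rw [eq_top_iff, ← (Pi.basisFun ℚ κ).span_eq, Submodule.span_le]
    rintro _ ⟨i, rfl⟩
    rw [Pi.basisFun_apply]
    exact hsurj i
  -- A basis chosen among the columns at `x₀` singles out a square minor with nonzero value there.
  -- The right inverse is Cramer's rule for this minor, with zero rows at the columns that were not
  -- chosen.
  obtain ⟨f, hf, -, hli⟩ := Submodule.exists_fun_fin_finrank_span_eq ℚ (Set.range col)
  have hcard : Module.finrank ℚ (Submodule.span ℚ (Set.range col)) = Fintype.card κ := by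
    rw [htop, finrank_top, Module.finrank_fintype_fun_eq_card]
  let e : κ ≃ Fin (Module.finrank ℚ (Submodule.span ℚ (Set.range col))) :=
    Fintype.equivFinOfCardEq hcard.symm
  choose s hs using fun i => hf (e i)
  set A : Matrix κ Col (MvPolynomial I ℤ) :=
    Matrix.of fun i c => ∑ a, (k a i c : MvPolynomial I ℤ) * MvPolynomial.X a with hA
  have hAbd : ∀ i c, Bd (fun _ => 1) (fun _ => 0) 1 0 (Fintype.card I * b) (A i c) := by
    intro i c
    rw [← Finset.card_univ]
    apply Bd.sum_const
    intro a _
    have := (Bd.intCast (ω := fun _ : I => 1) (ω' := fun _ => 0) (k a i c)).mul (Bd.X a)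
    refine Bd.mono (by simpa using this) le_rfl ?_
    exact hb a i c
  set A' := A.submatrix id s with hA'
  set S : Matrix Col κ (MvPolynomial I ℤ) := Matrix.of fun c i => if s i = c then 1 else 0 with hS
  have hAS : A * S = A' := by
    ext i j
    simp [Matrix.mul_apply, hS, hA']
  have hdet : A'.det ≠ 0 := by
    intro h0
    have h1 : (MvPolynomial.aeval x₀ : MvPolynomial I ℤ →ₐ[ℤ] ℚ) A'.det = 0 := by rw [h0, map_zero]
    rw [AlgHom.map_det] at h1
    have h2 : ((MvPolynomial.aeval x₀ : MvPolynomial I ℤ →ₐ[ℤ] ℚ).mapMatrix A').col = f ∘ e := by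
      funext j i
      rw [Function.comp_apply, ← hs j, hcol]
      simp [hA', hA, Matrix.col_apply, mul_comm]
    have h3 : LinearIndependent ℚ
        ((MvPolynomial.aeval x₀ : MvPolynomial I ℤ →ₐ[ℤ] ℚ).mapMatrix A').col := by
      rw [h2]
      exact hli.comp _ e.injective
    rw [Matrix.linearIndependent_cols_iff_isUnit, Matrix.isUnit_iff_isUnit_det, h1] at h3
    exact not_isUnit_zero h3
  refine ⟨A'.det, S * A'.adjugate, hdet, ?_, fun c i => ?_, ?_⟩
  · have := bd_det (fun i j => hAbd i (s j)) (M := A')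
    simpa using this
  · rw [Matrix.mul_apply, ← Finset.card_univ]
    apply Bd.sum_const
    intro j _
    rw [hS, Matrix.of_apply, ite_mul, one_mul, zero_mul]
    split_ifs
    · exact bd_adjugate hb1 (fun i j => hAbd i (s j)) j i
    · exact Bd.zero
  · rw [← Matrix.mul_assoc, hAS, Matrix.mul_adjugate]

end

section

/-! ## The linear system -/

open MvPolynomial

/-- Exponents of monomials in two variables of degree at most `D`. -/
abbrev Mon (D : ℕ) : Type := {m : Fin (D + 1) × Fin (D + 1) // (m.1 : ℕ) + (m.2 : ℕ) ≤ D}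

/-- The exponents of `x ^ a y ^ b`. -/
def Mon.mk {D : ℕ} (a b : ℕ) (h : a + b ≤ D) : Mon D := ⟨(⟨a, by omega⟩, ⟨b, by omega⟩), h⟩

theorem card_mon_le (D : ℕ) : Fintype.card (Mon D) ≤ (D + 1) ^ 2 := by
  refine (Fintype.card_subtype_le _).trans ?_
  simp [sq]

/-- The unknowns of the linear system: the coefficients of the basic forms, of a function `f` and of
a multiplier `q`. -/
abbrev Unknown (n s : ℕ) : Type := (Fin n × Fin n) ⊕ (Mon (s + 2 * n + 1) ⊕ Mon (s + 2 * n - 1))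

/-- The exponents of the image of `x ^ A y ^ B` under the operator attached to an unknown. -/
def opExp {n s : ℕ} : Unknown n s → ℕ → ℕ → ℕ × ℕ
  | .inl i, A, B => (A + i.1, B + i.2)
  | .inr (.inl m), A, B => (m.1.1 + A - 1, m.1.2 + B - 1)
  | .inr (.inr m), A, B => (m.1.1 + A, m.1.2 + B)

/-- The coefficient of the image of `x ^ A y ^ B` under the operator attached to an unknown. -/
def opCoeff {n s : ℕ} : Unknown n s → ℕ → ℕ → ℤ
  | .inl _, _, B => B
  | .inr (.inl m), A, B => (m.1.1 : ℕ) * B - (m.1.2 : ℕ) * A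
  | .inr (.inr _), _, _ => 1

theorem natAbs_opCoeff_le {n s : ℕ} (c : Unknown n s) {A B : ℕ} (h : A + B ≤ n + 1) :
    (opCoeff c A B).natAbs ≤ (s + 2 * n + 1) * (n + 1) := by
  match c with
  | .inl i =>
    simp only [opCoeff, Int.natAbs_natCast]
    nlinarith
  | .inr (.inl m) =>
    have h1 := m.2
    have e1 : (m.1.1 : ℕ) * B ≤ (s + 2 * n + 1) * (n + 1) := Nat.mul_le_mul (by omega) (by omega)
    have e2 : (m.1.2 : ℕ) * A ≤ (s + 2 * n + 1) * (n + 1) := Nat.mul_le_mul (by omega) (by omega)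
    simp only [opCoeff]
    rw [← Nat.cast_mul, ← Nat.cast_mul]
    omega
  | .inr (.inr m) =>
    simp only [opCoeff, Int.natAbs_one]
    nlinarith

/-- The subtractions in `opExp` are truncated only when the coefficient is zero, a case that `h0`
excludes; otherwise the exponents are the true ones. -/
theorem opExp_le {n s : ℕ} (hn : 1 ≤ n) (c : Unknown n s) {A B : ℕ} (h : A + B ≤ n + 1)
    (h0 : opCoeff c A B ≠ 0) : (opExp c A B).1 + (opExp c A B).2 ≤ s + 3 * n := by
  match c with
  | .inl i =>
    simp only [opExp]
    omega
  | .inr (.inl m) =>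
    have h1 := m.2
    have e1 : 1 ≤ (m.1.1 : ℕ) + A := by
      by_contra h2
      apply h0
      have e3 : (m.1.1 : ℕ) = 0 := by omega
      have e4 : A = 0 := by omega
      simp [opCoeff, e3, e4]
    have e2 : 1 ≤ (m.1.2 : ℕ) + B := by
      by_contra h2
      apply h0
      have e3 : (m.1.2 : ℕ) = 0 := by omega
      have e4 : B = 0 := by omega
      simp [opCoeff, e3, e4]
    simp only [opExp]
    omega
  | .inr (.inr m) =>
    have h1 := m.2
    have := Fin.prop m.1.1
    simp only [opExp]
    omega

/-- The matrices of the linear system. -/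
def opMatrix (n s : ℕ) (α : Idx n) : Matrix (Mon (s + 3 * n)) (Unknown n s) ℤ :=
  Matrix.of fun m c => if (((m.1.1 : ℕ), (m.1.2 : ℕ)) : ℕ × ℕ) = opExp c α.1.1 α.1.2 then
    opCoeff c α.1.1 α.1.2 else 0

theorem natAbs_opMatrix_le {n s : ℕ} (α : Idx n) (m : Mon (s + 3 * n)) (c : Unknown n s) :
    (opMatrix n s α m c).natAbs ≤ (s + 2 * n + 1) * (n + 1) := by
  rw [opMatrix, Matrix.of_apply]
  split_ifs
  · exact natAbs_opCoeff_le c α.2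
  · simp

/-- The index of the coefficient of `x ^ a y ^ b`. -/
def idxMk {n : ℕ} (a b : ℕ) (h : a + b ≤ n + 1) : Idx n := ⟨(⟨a, by omega⟩, ⟨b, by omega⟩), h⟩

/-- The coefficients of the Hamiltonian `x ^ (n + 1) + y ^ (n + 1) - 1`. -/
def fermat (n : ℕ) (α : Idx n) : ℚ :=
  (if α = idxMk (n + 1) 0 (by omega) then 1 else 0) +
    (if α = idxMk 0 (n + 1) (by omega) then 1 else 0) - (if α = idxMk 0 0 (by omega) then 1 else 0)

theorem sum_fermat_mul {n : ℕ} (φ : ℕ → ℕ → ℚ) :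
    ∑ α : Idx n, fermat n α * φ α.1.1 α.1.2 = φ (n + 1) 0 + φ 0 (n + 1) - φ 0 0 := by
  have key : ∀ (β : Idx n) [∀ α : Idx n, Decidable (α = β)],
      ∑ α : Idx n, (if α = β then (1 : ℚ) else 0) * φ α.1.1 α.1.2 = φ β.1.1 β.1.2 := by
    intro β _
    rw [Finset.sum_eq_single β (fun α _ h => by rw [if_neg h, zero_mul])
      (fun h => absurd (Finset.mem_univ β) h), if_pos rfl, one_mul]
  have e : φ (n + 1) 0 + φ 0 (n + 1) - φ 0 0 =
      φ (idxMk (n := n) (n + 1) 0 (by omega)).1.1 (idxMk (n := n) (n + 1) 0 (by omega)).1.2 +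
      φ (idxMk (n := n) 0 (n + 1) (by omega)).1.1 (idxMk (n := n) 0 (n + 1) (by omega)).1.2 -
      φ (idxMk (n := n) 0 0 (by omega)).1.1 (idxMk (n := n) 0 0 (by omega)).1.2 := rfl
  rw [e, ← key, ← key (idxMk 0 (n + 1) _), ← key (idxMk 0 0 _), ← Finset.sum_add_distrib,
    ← Finset.sum_sub_distrib]
  refine Finset.sum_congr rfl fun α _ => ?_
  rw [fermat]
  ring

/-- The standard vector attached to `x ^ a y ^ b`. -/
def monVec (D a b : ℕ) (m : Mon D) : ℚ := if (((m.1.1 : ℕ), (m.1.2 : ℕ)) : ℕ × ℕ) = (a, b) then 1 else 0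

/-- The column space of the linear system for the Fermat Hamiltonian. -/
def fermatSpan (n s : ℕ) : Submodule ℚ (Mon (s + 3 * n) → ℚ) :=
  Submodule.span ℚ (Set.range fun (c : Unknown n s) (m : Mon (s + 3 * n)) =>
    ∑ α, fermat n α * (opMatrix n s α m c : ℚ))

theorem fermat_column_mem {n s : ℕ} (c : Unknown n s) :
    (opCoeff c (n + 1) 0 : ℚ) • monVec (s + 3 * n) (opExp c (n + 1) 0).1 (opExp c (n + 1) 0).2 +
      (opCoeff c 0 (n + 1) : ℚ) • monVec (s + 3 * n) (opExp c 0 (n + 1)).1 (opExp c 0 (n + 1)).2 -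
      (opCoeff c 0 0 : ℚ) • monVec (s + 3 * n) (opExp c 0 0).1 (opExp c 0 0).2 ∈
        fermatSpan n s := by
  refine Submodule.subset_span ⟨c, ?_⟩
  funext m
  have := sum_fermat_mul (n := n) fun A B =>
    if (((m.1.1 : ℕ), (m.1.2 : ℕ)) : ℕ × ℕ) = opExp c A B then (opCoeff c A B : ℚ) else 0
  simp only [opMatrix, Matrix.of_apply, Int.cast_ite, Int.cast_zero]
  rw [this]
  simp [monVec]

/-- For `H = x^(n+1) + y^(n+1) - 1`, modulo the column space, the multiplier gives `x^i y^j ≡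
x^(i+n+1) y^j + x^i y^(j+n+1)`, and the bracket gives `(i+1) x^i y^(j+n+1) ≡ (j+1) x^(i+n+1) y^j`.
So `x^i y^j` lies in the column space if and only if its multiples do (`up`, `down`), which lowers
exponents above `n`. An exponent equal to `n` comes from the bracket of `H` with a power of the
other variable. If both exponents are below `n`, then `x^a y^(b+n+1)` is the column of a basic form
up to the factor `n + 1`. -/
theorem monVec_mem_fermatSpan {n s : ℕ} (hn : 1 ≤ n) (a b : ℕ) (hab : a + b ≤ s + 3 * n) :
    monVec (s + 3 * n) a b ∈ fermatSpan n s := by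
  have cancel : ∀ {r : ℚ} {v : Mon (s + 3 * n) → ℚ}, r ≠ 0 → r • v ∈ fermatSpan n s →
      v ∈ fermatSpan n s := by
    intro r v hr hv
    have := Submodule.smul_mem _ r⁻¹ hv
    rwa [smul_smul, inv_mul_cancel₀ hr, one_smul] at this
  have hn1 : ((n : ℚ) + 1) ≠ 0 := by positivity
  -- the three families of columns
  have basic : ∀ i j, i < n → j < n → monVec (s + 3 * n) i (n + 1 + j) ∈ fermatSpan n s := by
    intro i j hi hj
    have := fermat_column_mem (s := s) (.inl (⟨i, hi⟩, ⟨j, hj⟩) : Unknown n s)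
    simp only [opCoeff, opExp, Nat.cast_zero, Int.cast_zero, zero_smul, zero_add, sub_zero,
      Nat.cast_add, Nat.cast_one, Int.cast_add, Int.cast_natCast, Int.cast_one] at this
    exact cancel hn1 this
  have bracket : ∀ i j, i + j ≤ s + 2 * n + 1 →
      ((n : ℚ) + 1) • ((i : ℚ) • monVec (s + 3 * n) (i - 1) (j + n) -
        (j : ℚ) • monVec (s + 3 * n) (i + n) (j - 1)) ∈ fermatSpan n s := by
    intro i j hij
    have := fermat_column_mem (.inr (.inl (Mon.mk i j hij)) : Unknown n s)
    simp only [opCoeff, opExp, Mon.mk] at this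
    push_cast at this
    convert this using 1
    simp only [mul_zero, sub_zero, zero_sub, zero_smul, add_zero, Nat.add_sub_cancel,
      ← add_assoc, neg_smul, smul_sub, smul_smul]
    rw [mul_comm (i : ℚ), mul_comm (j : ℚ)]
    abel
  have mult : ∀ i j, i + j ≤ s + 2 * n - 1 →
      monVec (s + 3 * n) (i + n + 1) j + monVec (s + 3 * n) i (j + n + 1) -
        monVec (s + 3 * n) i j ∈ fermatSpan n s := by
    intro i j hij
    have := fermat_column_mem (.inr (.inr (Mon.mk i j hij)) : Unknown n s)
    simpa [opCoeff, opExp, Mon.mk, ← add_assoc] using this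
  -- relations between a monomial and its multiples
  have rel : ∀ i j, i + j ≤ s + 2 * n - 1 →
      ((i : ℚ) + 1) • monVec (s + 3 * n) i (j + n + 1) -
        ((j : ℚ) + 1) • monVec (s + 3 * n) (i + n + 1) j ∈ fermatSpan n s := by
    intro i j hij
    have := bracket (i + 1) (j + 1) (by omega)
    have h2 := cancel hn1 this
    simp only [Nat.add_sub_cancel, Nat.cast_add, Nat.cast_one] at h2
    rwa [show j + 1 + n = j + n + 1 by ring, show i + 1 + n = i + n + 1 by ring] at h2
  have up : ∀ i j, i + j ≤ s + 2 * n - 1 → monVec (s + 3 * n) i j ∈ fermatSpan n s →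
      monVec (s + 3 * n) i (j + n + 1) ∈ fermatSpan n s ∧
        monVec (s + 3 * n) (i + n + 1) j ∈ fermatSpan n s := by
    intro i j hij h0
    have h1 := rel i j hij
    have h2 := Submodule.add_mem _ (mult i j hij) h0
    rw [sub_add_cancel] at h2
    have hij0 : ((i : ℚ) + j + 2) ≠ 0 := by positivity
    constructor
    · apply cancel hij0
      have := Submodule.add_mem _ h1 (Submodule.smul_mem _ ((j : ℚ) + 1) h2)
      convert this using 1
      module
    · apply cancel hij0
      have := Submodule.sub_mem _ (Submodule.smul_mem _ ((i : ℚ) + 1) h2) h1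
      convert this using 1
      module
  have down : ∀ i j, i + j ≤ s + 2 * n - 1 →
      monVec (s + 3 * n) i (j + n + 1) ∈ fermatSpan n s →
      monVec (s + 3 * n) i j ∈ fermatSpan n s := by
    intro i j hij h0
    have h1 := rel i j hij
    have hj0 : ((j : ℚ) + 1) ≠ 0 := by positivity
    have h2 : monVec (s + 3 * n) (i + n + 1) j ∈ fermatSpan n s := by
      apply cancel hj0
      have := Submodule.sub_mem _ (Submodule.smul_mem _ ((i : ℚ) + 1) h0) h1
      convert this using 1
      module
    have := Submodule.sub_mem _ (Submodule.add_mem _ h2 h0) (mult i j hij)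
    convert this using 1
    module
  -- induction on the degree
  suffices H : ∀ k a b, a + b = k → a + b ≤ s + 3 * n → monVec (s + 3 * n) a b ∈ fermatSpan n s from
    H _ a b rfl hab
  intro k
  induction k using Nat.strong_induction_on with
  | _ k ih =>
    intro a b hk hab
    by_cases ha : n + 1 ≤ a
    · obtain ⟨i, rfl⟩ : ∃ i, a = i + n + 1 := ⟨a - n - 1, by omega⟩
      exact (up i b (by omega) (ih (i + b) (by omega) i b rfl (by omega))).2
    by_cases hb : n + 1 ≤ b
    · obtain ⟨j, rfl⟩ : ∃ j, b = j + n + 1 := ⟨b - n - 1, by omega⟩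
      exact (up a j (by omega) (ih (a + j) (by omega) a j rfl (by omega))).1
    by_cases ha' : a = n
    · subst ha'
      have h1 := cancel hn1 (bracket 0 (b + 1) (by omega))
      simp only [Nat.cast_zero, zero_smul, zero_sub, zero_add, Nat.add_sub_cancel, Nat.cast_add,
        Nat.cast_one] at h1
      rw [Submodule.neg_mem_iff] at h1
      exact cancel (by positivity) h1
    by_cases hb' : b = n
    · subst hb'
      have h1 := cancel hn1 (bracket (a + 1) 0 (by omega))
      simp only [Nat.cast_zero, zero_smul, sub_zero, zero_add, Nat.add_sub_cancel, Nat.cast_add,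
        Nat.cast_one] at h1
      exact cancel (by positivity) h1
    · apply down a b (by omega)
      have := basic a b (by omega) (by omega)
      rwa [show n + 1 + b = b + n + 1 by ring] at this

/-- Full rank at the Fermat polynomial gives a minor that is nonzero as a polynomial in `λ`. There
is a separate system for each `s`, so that a monomial of degree `s` gets an `f` of degree at most `s
+ 2n + 1`; a single system for the largest degree would spoil the degree count of the later
recursion. -/
theorem exists_scaled_solution {n : ℕ} (hn : 1 ≤ n) (s : ℕ) :
    ∃ (Δ : MvPolynomial (Idx n) ℤ)
      (Y : Matrix (Unknown n s) (Mon (s + 3 * n)) (MvPolynomial (Idx n) ℤ)), Δ ≠ 0 ∧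
      Bd (fun _ => 1) (fun _ => 0) (Fintype.card (Mon (s + 3 * n))) 0
        ((Fintype.card (Mon (s + 3 * n))).factorial *
          (Fintype.card (Idx n) * ((s + 2 * n + 1) * (n + 1))) ^
            Fintype.card (Mon (s + 3 * n))) Δ ∧
      (∀ c i, Bd (fun _ => 1) (fun _ => 0) (Fintype.card (Mon (s + 3 * n)) - 1) 0
        (Fintype.card (Mon (s + 3 * n)) * ((Fintype.card (Mon (s + 3 * n))).factorial *
          (Fintype.card (Idx n) * ((s + 2 * n + 1) * (n + 1))) ^
            Fintype.card (Mon (s + 3 * n)))) (Y c i)) ∧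
      (Matrix.of fun m c => ∑ α, (opMatrix n s α m c : MvPolynomial (Idx n) ℤ) * X α) * Y =
        Δ • (1 : Matrix (Mon (s + 3 * n)) (Mon (s + 3 * n)) (MvPolynomial (Idx n) ℤ)) := by
  apply exists_scaled_rightInverse (opMatrix n s) (fun α m c => natAbs_opMatrix_le α m c) _
    (fermat n)
  · intro m
    have h1 := monVec_mem_fermatSpan (s := s) hn m.1.1 m.1.2 m.2
    have e : (Pi.single m 1 : Mon (s + 3 * n) → ℚ) = monVec (s + 3 * n) m.1.1 m.1.2 := by
      funext m'
      rw [monVec, Pi.single_apply]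
      refine if_congr ?_ rfl rfl
      rw [Subtype.ext_iff, Prod.ext_iff, Prod.ext_iff, Fin.ext_iff, Fin.ext_iff]
    rw [e]
    exact h1
  · have : 0 < Fintype.card (Idx n) := Fintype.card_pos_iff.2 ⟨idx00 n⟩
    exact Nat.mul_pos this (by positivity)

end

section

/-! ## The ring of polynomials in `λ`, `p`, `x`, `y` -/

open MvPolynomial

/-- The variables `λ_α`, `p`, `x`, `y`. -/
abbrev Var (n : ℕ) : Type := Option (Idx n) ⊕ Fin 2

/-- Integer polynomials in `λ`, `p`, `x`, `y`. -/
abbrev Pol (n : ℕ) : Type := MvPolynomial (Var n) ℤ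

/-- Weights that count the degree in `λ`. -/
def wl (n : ℕ) : Var n → ℕ
  | .inl (some _) => 1
  | _ => 0

/-- Weights that count the degree in `p`, `x`, `y`. -/
def ww (n : ℕ) : Var n → ℕ
  | .inl (some _) => 0
  | _ => 1

section
variable (n : ℕ)

/-- The inclusion of the polynomials in `λ`. -/
def emb : MvPolynomial (Idx n) ℤ →ₐ[ℤ] Pol n := rename fun α => Sum.inl (some α)

/-- The inclusion of the polynomials in `λ` and `p`. -/
def embP : MvPolynomial (Option (Idx n)) ℤ →ₐ[ℤ] Pol n := rename Sum.inl

/-- The value at `(x, y) = (0, p)`. -/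
def baseVal : Pol n →ₐ[ℤ] MvPolynomial (Option (Idx n)) ℤ :=
  aeval (Sum.elim X ![0, X none])

/-- The derivative in `x`. -/
def dX : Derivation ℤ (Pol n) (Pol n) := pderiv (Sum.inr 0)

/-- The derivative in `y`. -/
def dY : Derivation ℤ (Pol n) (Pol n) := pderiv (Sum.inr 1)

/-- The monomial `x ^ a y ^ b`. -/
def mon (a b : ℕ) : Pol n := X (Sum.inr 0) ^ a * X (Sum.inr 1) ^ b

/-- The generic Hamiltonian. -/
def genHam : Pol n := ∑ α : Idx n, X (Sum.inl (some α)) * mon n α.1.1 α.1.2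

/-- The coefficients of the basic forms. -/
def coeffPol (i : Fin n × Fin n) : Pol n := mon n i.1 (i.2 + 1)

/-- The bracket with the generic Hamiltonian. -/
def brk : Pol n →ₗ[ℤ] Pol n :=
  (LinearMap.mulRight ℤ (dY n (genHam n))).comp (dX n : Pol n →ₗ[ℤ] Pol n) -
    (LinearMap.mulRight ℤ (dX n (genHam n))).comp (dY n : Pol n →ₗ[ℤ] Pol n)

end

section
variable {n : ℕ}

theorem brk_apply (f : Pol n) :
    brk n f = dX n f * dY n (genHam n) - dY n f * dX n (genHam n) := rfl

theorem brk_mul (f g : Pol n) : brk n (f * g) = f * brk n g + brk n f * g := by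
  simp only [brk_apply, Derivation.leibniz, smul_eq_mul]
  ring

theorem dX_embP (P : MvPolynomial (Option (Idx n)) ℤ) : dX n (embP n P) = 0 := by
  apply pderiv_eq_zero_of_notMem_vars
  intro h
  obtain ⟨a, -, h2⟩ := Finset.mem_image.1 (vars_rename _ _ h)
  exact Sum.inl_ne_inr h2

theorem dY_embP (P : MvPolynomial (Option (Idx n)) ℤ) : dY n (embP n P) = 0 := by
  apply pderiv_eq_zero_of_notMem_vars
  intro h
  obtain ⟨a, -, h2⟩ := Finset.mem_image.1 (vars_rename _ _ h)
  exact Sum.inl_ne_inr h2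

theorem emb_eq_embP (P : MvPolynomial (Idx n) ℤ) : emb n P = embP n (rename some P) := by
  rw [emb, embP, rename_rename]
  rfl

theorem dX_emb (P : MvPolynomial (Idx n) ℤ) : dX n (emb n P) = 0 := by
  rw [emb_eq_embP, dX_embP]

theorem dY_emb (P : MvPolynomial (Idx n) ℤ) : dY n (emb n P) = 0 := by
  rw [emb_eq_embP, dY_embP]

theorem baseVal_embP (P : MvPolynomial (Option (Idx n)) ℤ) : baseVal n (embP n P) = P := by
  rw [baseVal, embP, aeval_rename, Sum.elim_comp_inl, aeval_X_left, AlgHom.id_apply]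

theorem mon_mul_mon (a b a' b' : ℕ) : mon n a b * mon n a' b' = mon n (a + a') (b + b') := by
  simp only [mon]
  ring

theorem dX_mon (a b : ℕ) : dX n (mon n a b) = (a : Pol n) * mon n (a - 1) b := by
  simp only [dX, mon, Derivation.leibniz, Derivation.leibniz_pow, pderiv_X_self,
    pderiv_X_of_ne (show (Sum.inr 1 : Var n) ≠ Sum.inr 0 by simp), smul_eq_mul, nsmul_eq_mul]
  ring

theorem dY_mon (a b : ℕ) : dY n (mon n a b) = (b : Pol n) * mon n a (b - 1) := by
  simp only [dY, mon, Derivation.leibniz, Derivation.leibniz_pow, pderiv_X_self,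
    pderiv_X_of_ne (show (Sum.inr 0 : Var n) ≠ Sum.inr 1 by simp), smul_eq_mul, nsmul_eq_mul]
  ring

theorem dX_genHam : dX n (genHam n) =
    ∑ α : Idx n, X (Sum.inl (some α)) * (((α.1.1 : ℕ) : Pol n) * mon n (α.1.1 - 1) α.1.2) := by
  rw [genHam, map_sum]
  refine Finset.sum_congr rfl fun α _ => ?_
  rw [Derivation.leibniz, dX_mon, dX, pderiv_X_of_ne (by simp)]
  simp

theorem dY_genHam : dY n (genHam n) =
    ∑ α : Idx n, X (Sum.inl (some α)) * (((α.1.2 : ℕ) : Pol n) * mon n α.1.1 (α.1.2 - 1)) := by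
  rw [genHam, map_sum]
  refine Finset.sum_congr rfl fun α _ => ?_
  rw [Derivation.leibniz, dY_mon, dY, pderiv_X_of_ne (by simp)]
  simp

/-! ## Solution of the linear equation for monomials -/

/-- The image of an unknown in the ring of polynomials. -/
def opPol (n : ℕ) {s : ℕ} : Unknown n s → Pol n
  | .inl i => coeffPol n i * dY n (genHam n)
  | .inr (.inl m) => brk n (mon n m.1.1 m.1.2)
  | .inr (.inr m) => mon n m.1.1 m.1.2 * genHam n

theorem opPol_eq {s : ℕ} (c : Unknown n s) : opPol n c = ∑ α : Idx n, X (Sum.inl (some α)) *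
    ((opCoeff c α.1.1 α.1.2 : Pol n) * mon n (opExp c α.1.1 α.1.2).1 (opExp c α.1.1 α.1.2).2) := by
  match c with
  | .inl i =>
    simp only [opPol, dY_genHam, Finset.mul_sum]
    refine Finset.sum_congr rfl fun α _ => ?_
    simp only [opCoeff, opExp, coeffPol]
    rw [mul_left_comm, mul_left_comm (mon n _ _), mon_mul_mon]
    push_cast
    rcases Nat.eq_zero_or_pos (α.1.2 : ℕ) with h | h
    · simp [h]
    · rw [show (i.2 : ℕ) + 1 + ((α.1.2 : ℕ) - 1) = α.1.2 + i.2 by omega,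
        add_comm (i.1 : ℕ)]
  | .inr (.inl m) =>
    simp only [opPol, brk_apply, dX_genHam, dY_genHam, Finset.mul_sum]
    rw [← Finset.sum_sub_distrib]
    refine Finset.sum_congr rfl fun α _ => ?_
    simp only [opCoeff, opExp, dX_mon, dY_mon]
    push_cast
    have e1 : ∀ a b c d : ℕ, (a : Pol n) * mon n (a - 1) b *
        (X (Sum.inl (some α)) * ((d : Pol n) * mon n c (d - 1))) =
        X (Sum.inl (some α)) * ((a * d : Pol n) * mon n (a + c - 1) (b + d - 1)) := by
      intro a b c d
      rcases Nat.eq_zero_or_pos a with h | h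
      · simp [h]
      rcases Nat.eq_zero_or_pos d with h' | h'
      · simp [h']
      rw [show a + c - 1 = (a - 1) + c by omega, show b + d - 1 = b + (d - 1) by omega,
        ← mon_mul_mon]
      ring
    have e2 : ∀ a b c d : ℕ, (b : Pol n) * mon n a (b - 1) *
        (X (Sum.inl (some α)) * ((c : Pol n) * mon n (c - 1) d)) =
        X (Sum.inl (some α)) * ((b * c : Pol n) * mon n (a + c - 1) (b + d - 1)) := by
      intro a b c d
      rcases Nat.eq_zero_or_pos b with h | h
      · simp [h]
      rcases Nat.eq_zero_or_pos c with h' | h'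
      · simp [h']
      rw [show a + c - 1 = a + (c - 1) by omega, show b + d - 1 = (b - 1) + d by omega,
        ← mon_mul_mon]
      ring
    rw [e1, e2]
    ring
  | .inr (.inr m) =>
    simp only [opPol, genHam, Finset.mul_sum]
    refine Finset.sum_congr rfl fun α _ => ?_
    simp only [opCoeff, opExp]
    rw [mul_left_comm, mon_mul_mon]
    simp

theorem sum_opMatrix_mul_mon {s : ℕ} (hn : 1 ≤ n) (c : Unknown n s) (α : Idx n) :
    ∑ m : Mon (s + 3 * n), (opMatrix n s α m c : Pol n) * mon n m.1.1 m.1.2 =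
      (opCoeff c α.1.1 α.1.2 : Pol n) *
        mon n (opExp c α.1.1 α.1.2).1 (opExp c α.1.1 α.1.2).2 := by
  by_cases h : opCoeff c (α.1.1 : ℕ) (α.1.2 : ℕ) = 0
  · rw [h, Int.cast_zero, zero_mul]
    refine Finset.sum_eq_zero fun m _ => ?_
    rw [opMatrix, Matrix.of_apply, h, ite_self, Int.cast_zero, zero_mul]
  · have h1 := opExp_le hn c α.2 h
    rw [Finset.sum_eq_single (Mon.mk _ _ h1)]
    · rw [opMatrix, Matrix.of_apply]
      simp [Mon.mk]
    · intro m _ hm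
      rw [opMatrix, Matrix.of_apply, if_neg, Int.cast_zero, zero_mul]
      intro h2
      apply hm
      rw [Prod.ext_iff] at h2
      exact Subtype.ext (Prod.ext (Fin.ext h2.1) (Fin.ext h2.2))
    · simp

/-- A column of the right inverse, translated back into polynomials: `Δ` times a monomial as a
combination of the images of the unknowns. -/
theorem emb_mul_mon {s : ℕ} (hn : 1 ≤ n) {Δ : MvPolynomial (Idx n) ℤ}
    {Y : Matrix (Unknown n s) (Mon (s + 3 * n)) (MvPolynomial (Idx n) ℤ)}
    (hY : (Matrix.of fun m c => ∑ α, (opMatrix n s α m c : MvPolynomial (Idx n) ℤ) * X α) * Y =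
      Δ • (1 : Matrix (Mon (s + 3 * n)) (Mon (s + 3 * n)) (MvPolynomial (Idx n) ℤ)))
    (m : Mon (s + 3 * n)) :
    emb n Δ * mon n m.1.1 m.1.2 = ∑ c, emb n (Y c m) * opPol n c := by
  have h1 : ∀ c, opPol n c = ∑ m' : Mon (s + 3 * n),
      emb n (∑ α, (opMatrix n s α m' c : MvPolynomial (Idx n) ℤ) * X α) *
        mon n m'.1.1 m'.1.2 := by
    intro c
    simp only [opPol_eq, ← sum_opMatrix_mul_mon hn, map_sum, map_mul, map_intCast, Finset.sum_mul,
      Finset.mul_sum]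
    rw [Finset.sum_comm]
    refine Finset.sum_congr rfl fun m' _ => Finset.sum_congr rfl fun α _ => ?_
    rw [emb, rename_X]
    ring
  have h2 : ∀ m' : Mon (s + 3 * n), ∑ c, (∑ α, (opMatrix n s α m' c : MvPolynomial (Idx n) ℤ) * X α) *
      Y c m = if m' = m then Δ else 0 := by
    intro m'
    have := congrFun (congrFun hY m') m
    simpa [Matrix.mul_apply, Matrix.one_apply] using this
  simp only [h1, Finset.mul_sum]
  rw [Finset.sum_comm, Finset.sum_eq_single m]
  · have := h2 m
    rw [if_pos rfl] at this
    rw [← this, map_sum, Finset.sum_mul]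
    refine Finset.sum_congr rfl fun c _ => ?_
    rw [map_mul]
    ring
  · intro m' _ hm'
    have := congrArg (fun P => emb n P * mon n m'.1.1 m'.1.2) (h2 m')
    simp only [if_neg hm', map_zero, zero_mul] at this
    rw [map_sum, Finset.sum_mul] at this
    rw [← this]
    refine Finset.sum_congr rfl fun c _ => ?_
    rw [map_mul]
    ring
  · simp

end

end

section

/-! ## Solution of the linear equation -/

open MvPolynomial

section
variable {n : ℕ} {t d N : ℕ}

theorem Bd.emb {P : MvPolynomial (Idx n) ℤ} (h : Bd (fun _ => 1) (fun _ => 0) t d N P) :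
    Bd (wl n) (ww n) t d N (emb n P) := by
  have e : PicardFuchs.emb n = MvPolynomial.aeval fun α => MvPolynomial.X (Sum.inl (some α)) :=
    algHom_ext fun α => by simp [PicardFuchs.emb]
  rw [e]
  exact h.aeval fun α => Bd.X (ω := wl n) (ω' := ww n) (Sum.inl (some α))

theorem Bd.embP {P : MvPolynomial (Option (Idx n)) ℤ}
    (h : Bd (fun o => wl n (Sum.inl o)) (fun o => ww n (Sum.inl o)) t d N P) :
    Bd (wl n) (ww n) t d N (embP n P) := by
  have e : PicardFuchs.embP n = MvPolynomial.aeval fun o => MvPolynomial.X (Sum.inl o) :=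
    algHom_ext fun α => by simp [PicardFuchs.embP]
  rw [e]
  exact h.aeval fun o => Bd.X (ω := wl n) (ω' := ww n) (Sum.inl o)

theorem Bd.baseVal {P : Pol n} (h : Bd (wl n) (ww n) t d N P) :
    Bd (fun o => wl n (Sum.inl o)) (fun o => ww n (Sum.inl o)) t d N (baseVal n P) := by
  refine h.aeval fun v => ?_
  match v with
  | .inl o => exact Bd.X (ω := fun o => wl n (Sum.inl o)) (ω' := fun o => ww n (Sum.inl o)) o
  | .inr 0 => exact Bd.zero
  | .inr 1 =>
    exact Bd.X (ω := fun o => wl n (Sum.inl o)) (ω' := fun o => ww n (Sum.inl o)) none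

theorem bd_mon (a b : ℕ) : Bd (wl n) (ww n) 0 (a + b) 1 (mon n a b) := by
  have := ((Bd.X (ω := wl n) (ω' := ww n) (Sum.inr 0)).pow a).mul
    ((Bd.X (ω := wl n) (ω' := ww n) (Sum.inr 1)).pow b)
  simpa [wl, ww, mon] using this

/-- The factor of a monomial that depends on `λ` and `p`. -/
def outer (m : Var n →₀ ℕ) : MvPolynomial (Option (Idx n)) ℤ := ∏ o, X o ^ m (Sum.inl o)

theorem monomial_eq_outer_mul (m : Var n →₀ ℕ) :
    monomial m (1 : ℤ) = embP n (outer m) * mon n (m (Sum.inr 0)) (m (Sum.inr 1)) := by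
  rw [monomial_eq, C_1, one_mul, Finsupp.prod_fintype _ _ (fun _ => pow_zero _),
    Fintype.prod_sum_type, Fin.prod_univ_two, outer, map_prod]
  simp [embP, mon]

theorem weight_wl (m : Var n →₀ ℕ) :
    Finsupp.weight (wl n) m = ∑ o, m (Sum.inl o) * wl n (Sum.inl o) := by
  rw [Finsupp.weight_apply, Finsupp.sum_fintype _ _ (fun _ => by simp),
    Fintype.sum_sum_type, Fin.sum_univ_two]
  simp [wl]

theorem weight_ww (m : Var n →₀ ℕ) :
    Finsupp.weight (ww n) m =
      ∑ o, m (Sum.inl o) * ww n (Sum.inl o) + (m (Sum.inr 0) + m (Sum.inr 1)) := by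
  rw [Finsupp.weight_apply, Finsupp.sum_fintype _ _ (fun _ => by simp),
    Fintype.sum_sum_type, Fin.sum_univ_two]
  simp [ww]

theorem bd_outer (m : Var n →₀ ℕ) :
    Bd (fun o => wl n (Sum.inl o)) (fun o => ww n (Sum.inl o)) (Finsupp.weight (wl n) m)
      (∑ o, m (Sum.inl o) * ww n (Sum.inl o)) 1 (outer m) := by
  have := Bd.prod (ω := fun o => wl n (Sum.inl o)) (ω' := fun o => ww n (Sum.inl o)) Finset.univ
    fun o _ => (Bd.X (ω := fun o => wl n (Sum.inl o)) (ω' := fun o => ww n (Sum.inl o)) o).pow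
      (m (Sum.inl o))
  simp only [one_pow, Finset.prod_const_one] at this
  rwa [weight_wl]

/-- The determinants of the systems for all degrees up to `D` are multiplied together, so that one
`L` serves every monomial; a solution for degree `s` is multiplied by the remaining determinants.
Its degree in `λ` is one less than that of `L` because cofactors have one degree less than
determinants. -/
theorem exists_monomial_solution (hn : 1 ≤ n) (D : ℕ) {M N : ℕ → ℕ}
    (hM : ∀ s, M s = Fintype.card (Mon (s + 3 * n)))
    (hN : ∀ s ≤ D, M s * ((M s).factorial *
      (Fintype.card (Idx n) * ((s + 2 * n + 1) * (n + 1))) ^ M s) ≤ N s) :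
    ∃ L : MvPolynomial (Idx n) ℤ, L ≠ 0 ∧
      Bd (fun _ => 1) (fun _ => 0) (∑ s ∈ Finset.range (D + 1), M s) 0
        (∏ s ∈ Finset.range (D + 1), N s) L ∧
      ∀ a b, a + b ≤ D → ∃ (c : Fin n × Fin n → MvPolynomial (Idx n) ℤ) (f q : Pol n),
        emb n L * mon n a b = ∑ j, emb n (c j) * (coeffPol n j * dY n (genHam n)) + brk n f +
          q * genHam n ∧
        (∀ j, Bd (fun _ => 1) (fun _ => 0) (∑ s ∈ Finset.range (D + 1), M s - 1) 0
          (∏ s ∈ Finset.range (D + 1), N s) (c j)) ∧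
        Bd (wl n) (ww n) (∑ s ∈ Finset.range (D + 1), M s - 1) (a + b + 2 * n + 1)
          ((D + 2 * n + 2) ^ 2 * ∏ s ∈ Finset.range (D + 1), N s) f := by
  have hM1 : ∀ s, 1 ≤ M s := by
    intro s
    rw [hM]
    exact Fintype.card_pos_iff.2 ⟨Mon.mk 0 0 (by omega)⟩
  choose Δ Y h0 h1 h2 h3 using exists_scaled_solution hn
  have hΔ : ∀ s ≤ D, Bd (fun _ => 1) (fun _ => 0) (M s) 0 (N s) (Δ s) := by
    intro s hs
    have := h1 s
    rw [← hM] at this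
    refine this.mono le_rfl (le_trans ?_ (hN s hs))
    exact Nat.le_mul_of_pos_left _ (hM1 s)
  have hY : ∀ s ≤ D, ∀ c i, Bd (fun _ => 1) (fun _ => 0) (M s - 1) 0 (N s) (Y s c i) := by
    intro s hs c i
    have := h2 s c i
    rw [← hM] at this
    exact this.mono le_rfl (hN s hs)
  refine ⟨∏ s ∈ Finset.range (D + 1), Δ s, Finset.prod_ne_zero_iff.2 fun s _ => h0 s, ?_, ?_⟩
  · have := Bd.prod (Finset.range (D + 1)) fun s hs =>
      hΔ s (Nat.lt_succ_iff.1 (Finset.mem_range.1 hs))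
    simpa using this
  intro a b hab
  obtain ⟨s, hs⟩ : ∃ s, a + b = s := ⟨_, rfl⟩
  rw [hs] at hab ⊢
  have hsD : s ∈ Finset.range (D + 1) := Finset.mem_range.2 (by omega)
  set cof := ∏ s' ∈ (Finset.range (D + 1)).erase s, Δ s' with hcof
  have bcof : ∀ c i, Bd (fun _ => 1) (fun _ => 0) (∑ s ∈ Finset.range (D + 1), M s - 1) 0
      (∏ s ∈ Finset.range (D + 1), N s) (cof * Y s c i) := by
    intro c i
    have e1 := Bd.prod ((Finset.range (D + 1)).erase s) fun s' hs' =>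
      hΔ s' (Nat.lt_succ_iff.1 (Finset.mem_range.1 (Finset.mem_of_mem_erase hs')))
    have e2 := e1.mul (hY s hab c i)
    rw [Finset.prod_erase_mul _ _ hsD, Finset.sum_const_zero, ← Nat.add_sub_assoc (hM1 s),
      Finset.sum_erase_add _ _ hsD] at e2
    exact e2
  obtain ⟨m0, hm0⟩ : ∃ m0 : Mon (s + 3 * n), mon n m0.1.1 m0.1.2 = mon n a b :=
    ⟨Mon.mk a b (by omega), rfl⟩
  have hL : ∏ s ∈ Finset.range (D + 1), Δ s = cof * Δ s :=
    (Finset.prod_erase_mul _ _ hsD).symm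
  refine ⟨fun j => cof * Y s (.inl j) m0,
    ∑ μ : Mon (s + 2 * n + 1), emb n (cof * Y s (.inr (.inl μ)) m0) *
      mon n μ.1.1 μ.1.2,
    ∑ μ : Mon (s + 2 * n - 1), emb n (cof * Y s (.inr (.inr μ)) m0) * mon n μ.1.1 μ.1.2,
    ?_, fun j => bcof _ _, ?_⟩
  · have e := emb_mul_mon hn (h3 s) m0
    rw [hL, map_mul, mul_assoc]
    rw [← hm0, e, Fintype.sum_sum_type, Fintype.sum_sum_type, mul_add, mul_add, ← add_assoc]
    simp only [opPol, map_sum, Finset.mul_sum, Finset.sum_mul, map_mul]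
    refine congrArg₂ (· + ·) (congrArg₂ (· + ·) ?_ ?_) ?_
    · refine Finset.sum_congr rfl fun j _ => ?_
      ring
    · refine Finset.sum_congr rfl fun μ _ => ?_
      have hz : ∀ P : MvPolynomial (Idx n) ℤ, brk n (emb n P) = 0 := by
        intro P
        rw [brk_apply, dX_emb, dY_emb]
        ring
      rw [brk_mul, brk_mul, hz, hz]
      ring
    · refine Finset.sum_congr rfl fun μ _ => ?_
      ring
  · have e1 : ∀ μ ∈ (Finset.univ : Finset (Mon (s + 2 * n + 1))), Bd (wl n) (ww n)
        (∑ s ∈ Finset.range (D + 1), M s - 1) (s + 2 * n + 1)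
        (∏ s ∈ Finset.range (D + 1), N s)
        (emb n (cof * Y s (.inr (.inl μ)) m0) * mon n μ.1.1 μ.1.2) := by
      intro μ _
      have := (bcof (.inr (.inl μ)) m0).emb.mul (bd_mon (n := n) μ.1.1 μ.1.2)

      rw [add_zero, zero_add, mul_one] at this
      exact this.mono μ.2 le_rfl
    -- The factor `(D + 2n + 2) ^ 2` bounds the number of monomials in `f`.
    refine (Bd.sum_const _ e1).mono le_rfl (Nat.mul_le_mul_right _ ?_)
    rw [Finset.card_univ]
    exact (card_mon_le _).trans (Nat.pow_le_pow_left (by omega) 2)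

theorem constr_monomial {τ : Type} {E : Type} [AddCommGroup E] (φ : (τ →₀ ℕ) → E) (m : τ →₀ ℕ) :
    (basisMonomials τ ℤ).constr ℤ φ (monomial m 1) = φ m := by
  have := (basisMonomials τ ℤ).constr_basis ℤ φ m
  rwa [coe_basisMonomials] at this

/-- Linear extension from monomials in `x, y`: a general monomial is such a monomial times `outer
m`, which the bracket annihilates. In particular the `c j` still depend on `λ` and `p` only, which
is recorded as `brk n (c j) = 0`. -/
theorem exists_solution_of_bounds (hn : 1 ≤ n) (D : ℕ) {M N : ℕ → ℕ}
    (hM : ∀ s, M s = Fintype.card (Mon (s + 3 * n)))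
    (hN : ∀ s ≤ D, M s * ((M s).factorial *
      (Fintype.card (Idx n) * ((s + 2 * n + 1) * (n + 1))) ^ M s) ≤ N s) {ℓ A : ℕ}
    (hℓ : ℓ = ∑ s ∈ Finset.range (D + 1), M s)
    (hA : 2 * (D + 2 * n + 2) ^ 2 * ∏ s ∈ Finset.range (D + 1), N s ≤ A) :
    ∃ L : MvPolynomial (Idx n) ℤ, L ≠ 0 ∧ Bd (fun _ => 1) (fun _ => 0) ℓ 0 A L ∧
      ∀ (t d B : ℕ) (h : Pol n), Bd (wl n) (ww n) t d B h → d ≤ D →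
        ∃ (c : Fin n × Fin n → Pol n) (f q : Pol n),
          emb n L * h = ∑ j, c j * (coeffPol n j * dY n (genHam n)) + brk n f +
            q * genHam n ∧
          (∀ j, Bd (wl n) (ww n) (t + ℓ - 1) d (A * B) (c j) ∧ brk n (c j) = 0) ∧
          Bd (wl n) (ww n) (t + ℓ - 1) (d + 2 * n + 1) (A * B) f ∧ baseVal n f = 0 := by
  obtain ⟨L, hL0, hLb, hL⟩ := exists_monomial_solution hn D hM hN
  have hA1 : ∏ s ∈ Finset.range (D + 1), N s ≤ A := by
    refine le_trans (Nat.le_mul_of_pos_left _ ?_) hA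
    positivity
  have hℓ1 : 1 ≤ ℓ := by
    rw [hℓ]
    refine le_trans ?_ (Finset.single_le_sum (f := M) (fun _ _ => Nat.zero_le _)
      (Finset.mem_range.2 (Nat.succ_pos D)))
    rw [hM]
    exact Fintype.card_pos_iff.2 ⟨Mon.mk 0 0 (by omega)⟩
  rw [← hℓ] at hLb
  refine ⟨L, hL0, hLb.mono le_rfl hA1, ?_⟩
  rw [← hℓ] at hL
  choose! c f q h1 h2 h3 using hL
  intro t d B h hh hd
  let Φc : Fin n × Fin n → Pol n →ₗ[ℤ] Pol n := fun j =>
    (basisMonomials (Var n) ℤ).constr ℤ fun m =>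
      embP n (outer m) * emb n (c (m (Sum.inr 0)) (m (Sum.inr 1)) j)
  let Φf : Pol n →ₗ[ℤ] Pol n :=
    (basisMonomials (Var n) ℤ).constr ℤ fun m =>
      embP n (outer m) * (f (m (Sum.inr 0)) (m (Sum.inr 1)))
  let Φq : Pol n →ₗ[ℤ] Pol n :=
    (basisMonomials (Var n) ℤ).constr ℤ fun m =>
      embP n (outer m) * (q (m (Sum.inr 0)) (m (Sum.inr 1)))
  have hΦc : ∀ j m, Φc j (monomial m 1) =
      embP n (outer m) * emb n (c (m (Sum.inr 0)) (m (Sum.inr 1)) j) :=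
    fun j m => constr_monomial _ m
  have hΦf : ∀ m, Φf (monomial m 1) = embP n (outer m) * (f (m (Sum.inr 0)) (m (Sum.inr 1))) :=
    fun m => constr_monomial _ m
  have hΦq : ∀ m, Φq (monomial m 1) = embP n (outer m) * (q (m (Sum.inr 0)) (m (Sum.inr 1))) :=
    fun m => constr_monomial _ m
  have hbz : ∀ P, brk n (embP n P) = 0 := by
    intro P
    rw [brk_apply, dX_embP, dY_embP]
    ring
  have hdeg : ∀ m, h.coeff m ≠ 0 →
      ∑ o, m (Sum.inl o) * ww n (Sum.inl o) + (m (Sum.inr 0) + m (Sum.inr 1)) ≤ d := by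
    intro m hm
    have := hh.deg m hm
    rwa [weight_ww] at this
  have expand : ∀ Φ : Pol n →ₗ[ℤ] Pol n, Φ h = ∑ m ∈ h.support, h.coeff m • Φ (monomial m 1) := by
    intro Φ
    conv_lhs => rw [h.as_sum, map_sum]
    refine Finset.sum_congr rfl fun m _ => ?_
    rw [← map_smul, smul_monomial, smul_eq_mul, mul_one]
  have bf : Bd (wl n) (ww n) (t + ℓ - 1) (d + 2 * n + 1)
      (B * ((D + 2 * n + 2) ^ 2 * ∏ s ∈ Finset.range (D + 1), N s)) (Φf h) := by
    refine Bd.map Φf hh.norm fun m hm => ?_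
    rw [hΦf]
    have := (bd_outer m).embP.mul (h3 (m (Sum.inr 0)) (m (Sum.inr 1)) (by have := hdeg m hm; omega))
    rw [hh.hom m hm, one_mul, ← Nat.add_sub_assoc hℓ1] at this
    exact this.mono (by have := hdeg m hm; omega) le_rfl
  -- Subtracting from `f` its value at `(0, p)` leaves the bracket unchanged and gives `baseVal n f
  -- = 0`; the norm at most doubles, whence the factor `2` in `hA`.
  refine ⟨fun j => Φc j h, Φf h - embP n (baseVal n (Φf h)), Φq h, ?_, fun j => ⟨?_, ?_⟩, ?_, ?_⟩
  · rw [map_sub, hbz, sub_zero]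
    have key : emb n L * h = LinearMap.mulLeft ℤ (emb n L) h := rfl
    rw [key, expand]
    simp only [expand (Φc _), expand Φf, expand Φq, Finset.sum_mul, map_sum]
    rw [Finset.sum_comm, ← Finset.sum_add_distrib, ← Finset.sum_add_distrib]
    refine Finset.sum_congr rfl fun m hm => ?_
    have hm' := hdeg m (mem_support_iff.1 hm)
    simp only [hΦc]
    rw [hΦf, hΦq, LinearMap.mulLeft_apply, monomial_eq_outer_mul, mul_left_comm,
      h1 (m (Sum.inr 0)) (m (Sum.inr 1)) (by omega), map_smul, brk_mul, hbz]
    simp only [mul_add, smul_add, Finset.mul_sum, Finset.smul_sum, zero_mul, add_zero,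
      smul_mul_assoc, mul_assoc]
  · rw [mul_comm A]
    refine Bd.map (Φc j) hh.norm fun m hm => ?_
    rw [hΦc]
    have hm' := hdeg m hm
    have := (bd_outer m).embP.mul (h2 (m (Sum.inr 0)) (m (Sum.inr 1)) (by omega) j).emb
    rw [hh.hom m hm, one_mul, ← Nat.add_sub_assoc hℓ1] at this
    exact this.mono (by omega) hA1
  · change brk n (Φc j h) = 0
    rw [expand, map_sum]
    refine Finset.sum_eq_zero fun m _ => ?_
    rw [map_smul, hΦc, emb_eq_embP, ← map_mul, hbz, smul_zero]
  · have e := bf.add bf.baseVal.embP.neg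
    rw [← sub_eq_add_neg] at e
    refine e.mono le_rfl ?_
    rw [mul_comm A]
    refine le_trans (le_of_eq ?_) (Nat.mul_le_mul_left B hA)
    ring
  · rw [map_sub, baseVal_embP, sub_self]

end

end

section

/-! ## Integration along the fibres -/

open MvPolynomial

section
variable {n : ℕ}

/-- The linear equation with the determinant `L` can be solved for right hand sides of degree at
most `D`. -/
def Solvable (n D ℓ A : ℕ) (L : MvPolynomial (Idx n) ℤ) : Prop :=
  ∀ (t d B : ℕ) (h : Pol n), Bd (wl n) (ww n) t d B h → d ≤ D →
    ∃ (c : Fin n × Fin n → Pol n) (f q : Pol n),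
      emb n L * h = ∑ j, c j * (coeffPol n j * dY n (genHam n)) + brk n f + q * genHam n ∧
      (∀ j, Bd (wl n) (ww n) (t + ℓ - 1) d (A * B) (c j) ∧ brk n (c j) = 0) ∧
      Bd (wl n) (ww n) (t + ℓ - 1) (d + 2 * n + 1) (A * B) f ∧ baseVal n f = 0

theorem bd_dY_genHam :
    Bd (wl n) (ww n) 1 n (Fintype.card (Idx n) * (n + 1)) (dY n (genHam n)) := by
  rw [dY_genHam, ← Finset.card_univ]
  refine Bd.sum_const _ fun α _ => ?_
  have h := α.2
  rcases Nat.eq_zero_or_pos (α.1.2 : ℕ) with h0 | h0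
  · rw [h0, Nat.cast_zero, zero_mul, mul_zero]
    exact Bd.zero
  · have := (Bd.X (ω := wl n) (ω' := ww n) (Sum.inl (some α))).mul
      ((Bd.intCast (ω := wl n) (ω' := ww n) (α.1.2 : ℕ)).mul
        (bd_mon (n := n) α.1.1 (α.1.2 - 1)))
    simp only [wl, ww, Int.natAbs_natCast, Int.cast_natCast, add_zero, zero_add, one_mul,
      mul_one] at this
    exact this.mono (by omega) (by omega)

theorem bd_coeffPol_mul_dY_genHam (i : Fin n × Fin n) :
    Bd (wl n) (ww n) 1 (3 * n) (Fintype.card (Idx n) * (n + 1))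
      (coeffPol n i * dY n (genHam n)) := by
  have := (bd_mon (n := n) i.1 (i.2 + 1)).mul (bd_dY_genHam (n := n))
  rw [zero_add, one_mul] at this
  exact this.mono (by omega) le_rfl

/-- One solution of the linear equation at the word `u` puts `f` at `u` and the `c j` at the words
`j :: u`. If `u` is empty this is all. If `u = i :: u'`, the equation at `u'` receives the unwanted
term `f` times the basic term of `i`, which is removed by the induction hypothesis for `u'` with
this term as right hand side. There are `|u| + 1` divisions by `L` in all, hence its exponent. -/
theorem exists_integral {D ℓ A : ℕ} {L : MvPolynomial (Idx n) ℤ} (hn : 1 ≤ n) (hℓ : 1 ≤ ℓ)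
    (hA : 1 ≤ A) (hL : Bd (fun _ => 1) (fun _ => 0) ℓ 0 A L) (hS : Solvable n D ℓ A L) {β : ℕ}
    (hβ : A * (Fintype.card (Idx n) * (n + 1) + 2) ≤ β) (u : List (Fin n × Fin n)) :
    ∀ (t d B : ℕ) (h : Pol n), Bd (wl n) (ww n) t d B h → d + 6 * n * u.length ≤ D →
    ∃ Q : List (Fin n × Fin n) → Pol n,
      (∀ v, ∃ q, brk n (Q v) + ∑ j, Q (j :: v) * (coeffPol n j * dY n (genHam n)) =
        (if v = u then emb n L ^ (u.length + 1) * h else 0) + q * genHam n) ∧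
      (∀ v, u.length + 1 < v.length → Q v = 0) ∧ baseVal n (Q []) = 0 ∧
      ∀ v, Bd (wl n) (ww n) (t + (u.length + 1) * ℓ - 1)
        (d + 6 * n * u.length + 6 * n - 6 * n * v.length) (β ^ (u.length + 1) * B) (Q v) := by
  have hAβ : A * 2 ≤ β := le_trans (Nat.mul_le_mul_left _ (by omega)) hβ
  have hAβ' : A ≤ β := by omega
  induction u with
  | nil =>
    intro t d B h hh hd
    obtain ⟨c, f, q, e, hc, hf, hf0⟩ := hS t d B h hh (by simpa using hd)
    let Q : List (Fin n × Fin n) → Pol n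
      | [] => f
      | [j] => c j
      | _ => 0
    refine ⟨Q, ?_, ?_, hf0, ?_⟩
    · rintro (_ | ⟨j, _ | ⟨j', v⟩⟩)
      · refine ⟨-q, ?_⟩
        simp only [if_true, List.length_nil, zero_add, pow_one, e, Q]
        ring
      · refine ⟨0, ?_⟩
        simp [Q, (hc j).2]
      · refine ⟨0, ?_⟩
        simp [Q]
    · rintro (_ | ⟨j, _ | ⟨j', v⟩⟩) hv
      · simp at hv
      · simp at hv
      · rfl
    · rintro (_ | ⟨j, _ | ⟨j', v⟩⟩)
      · simp only [List.length_nil, zero_add, one_mul, pow_one, mul_zero, add_zero, Q, Nat.sub_zero]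
        exact hf.mono (by omega) (Nat.mul_le_mul_right _ hAβ')
      · simp only [List.length_nil, List.length_cons, zero_add, one_mul, pow_one, mul_zero,
          add_zero, mul_one, Q, Nat.add_sub_cancel]
        exact (hc j).1.mono le_rfl (Nat.mul_le_mul_right _ hAβ')
      · exact Bd.zero
  | cons i u ih =>
    intro t d B h hh hd
    have hlen : 6 * n * (i :: u).length = 6 * n * u.length + 6 * n := by
      rw [List.length_cons]
      ring
    rw [hlen] at hd
    obtain ⟨c, f, q, e, hc, hf, hf0⟩ := hS t d B h hh (by omega)
    have hf1 := hf.mul (bd_coeffPol_mul_dY_genHam i)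
    -- The new right hand side has degree at most `d + (2n + 1) + 3n`, which is at most `d + 6n`
    -- since `n ≥ 1`.
    obtain ⟨Q', h1, h2, h3, h4⟩ := ih _ _ _ _ (hf1.mono (d' := d + 6 * n) (by omega) le_rfl)
      (by omega)
    have et : t + ℓ - 1 + 1 = t + ℓ := by omega
    rw [et] at h4
    have hLp := (hL.emb.pow (u.length + 1))
    rw [mul_zero] at hLp
    have hbΛ : brk n (emb n L ^ (u.length + 1)) = 0 := by
      rw [← map_pow, brk_apply, dX_emb, dY_emb]
      ring
    have hpow : emb n L ^ ((i :: u).length + 1) = emb n L ^ (u.length + 1) * emb n L := by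
      rw [List.length_cons, pow_succ]
    rw [hpow]
    generalize emb n L ^ (u.length + 1) = Λ at hLp hbΛ h1
    obtain ⟨g, hg0, hg1⟩ : ∃ g : List (Fin n × Fin n) → Pol n, g [] = 0 ∧
        ∀ j v, g (j :: v) = if v = i :: u then Λ * c j else 0 :=
      ⟨fun v => match v with
        | [] => 0
        | j :: v => if v = i :: u then Λ * c j else 0, rfl, fun _ _ => rfl⟩
    obtain ⟨Q, hQ⟩ : ∃ Q : List (Fin n × Fin n) → Pol n,
        ∀ v, Q v = (if v = i :: u then Λ * f else 0) + g v - Q' v := ⟨_, fun _ => rfl⟩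
    have hbg : ∀ v, brk n (g v) = 0 := by
      rintro (_ | ⟨j, v⟩)
      · rw [hg0, map_zero]
      · rw [hg1]
        split_ifs
        · rw [brk_mul, hbΛ, zero_mul, add_zero, (hc j).2, mul_zero]
        · exact map_zero _
    refine ⟨Q, ?_, ?_, ?_, ?_⟩
    · intro v
      obtain ⟨q', hq'⟩ := h1 v
      have e1 : brk n (Q v) = (if v = i :: u then Λ * brk n f else 0) - brk n (Q' v) := by
        rw [hQ, map_sub, map_add, hbg, add_zero]
        split_ifs
        · rw [brk_mul, hbΛ, zero_mul, add_zero]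
        · rw [map_zero]
      have e2 : ∀ j, Q (j :: v) = (if j :: v = i :: u then Λ * f else 0) +
          (if v = i :: u then Λ * c j else 0) - Q' (j :: v) := fun j => by rw [hQ, hg1]
      -- This is the unwanted term at the word `u`, which `- Q'` compensates.
      have e3 : ∑ j, (if j :: v = i :: u then Λ * f else 0) * (coeffPol n j * dY n (genHam n)) =
          if v = u then Λ * (f * (coeffPol n i * dY n (genHam n))) else 0 := by
        by_cases hv : v = u
        · rw [if_pos hv, Finset.sum_eq_single i]
          · rw [if_pos (by rw [hv]), mul_assoc]
          · intro j _ hj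
            rw [if_neg (fun h => hj (List.cons.inj h).1), zero_mul]
          · simp
        · rw [if_neg hv]
          refine Finset.sum_eq_zero fun j _ => ?_
          rw [if_neg (fun h => hv (List.cons.inj h).2), zero_mul]
      simp only [e1, e2, sub_mul, add_mul, Finset.sum_sub_distrib, Finset.sum_add_distrib, e3]
      by_cases hv : v = i :: u
      · have hvu : v ≠ u := by
          rw [hv]
          exact List.cons_ne_self i u
        refine ⟨-(Λ * q) - q', ?_⟩
        simp only [if_neg hvu] at hq'
        simp only [if_pos hv, if_neg hvu]
        rw [mul_assoc, e]
        simp only [mul_assoc]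
        rw [← Finset.mul_sum]
        linear_combination -hq'
      · refine ⟨-q', ?_⟩
        simp only [if_neg hv, zero_mul, Finset.sum_const_zero]
        linear_combination -hq'
    · intro v hv
      rw [List.length_cons] at hv
      have hg : g v = 0 := by
        rcases v with _ | ⟨j, v⟩
        · exact hg0
        · rw [hg1, if_neg]
          rintro rfl
          simp at hv
      rw [hQ, h2 v (by omega), if_neg, hg, add_zero, sub_zero]
      rintro rfl
      simp at hv
    · rw [hQ, hg0, if_neg (by simp), map_sub, h3]
      simp
    · intro v
      have et2 : (u.length + 1) * ℓ + (t + ℓ - 1) = t + ((i :: u).length + 1) * ℓ - 1 := by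
        rw [List.length_cons, ← Nat.add_sub_assoc (by omega)]
        congr 1
        ring
      have et3 : t + ℓ + (u.length + 1) * ℓ - 1 = t + ((i :: u).length + 1) * ℓ - 1 := by
        rw [List.length_cons]
        congr 1
        ring
      have b1 : Bd (wl n) (ww n) (t + ((i :: u).length + 1) * ℓ - 1)
          (d + 6 * n * (i :: u).length + 6 * n - 6 * n * v.length) (β ^ (u.length + 1) * (A * B))
          (if v = i :: u then Λ * f else 0) := by
        split_ifs with hv
        · have := hLp.mul hf
          rw [et2] at this
          refine this.mono ?_ (Nat.mul_le_mul_right _ (Nat.pow_le_pow_left hAβ' _))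
          rw [hv]
          omega
        · exact Bd.zero
      have b2 : Bd (wl n) (ww n) (t + ((i :: u).length + 1) * ℓ - 1)
          (d + 6 * n * (i :: u).length + 6 * n - 6 * n * v.length) (β ^ (u.length + 1) * (A * B))
          (g v) := by
        rcases v with _ | ⟨j, v⟩
        · rw [hg0]
          exact Bd.zero
        rw [hg1]
        split_ifs with hv
        · have := hLp.mul (hc j).1
          rw [et2] at this
          refine this.mono ?_ (Nat.mul_le_mul_right _ (Nat.pow_le_pow_left hAβ' _))
          have : 6 * n * (j :: v).length = 6 * n * (i :: u).length + 6 * n := by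
            rw [hv, List.length_cons (as := i :: u)]
            ring
          omega
        · exact Bd.zero
      have b3 := h4 v
      rw [et3] at b3
      have := (b1.add b2).add (b3.mono (d' := d + 6 * n * (i :: u).length + 6 * n -
        6 * n * v.length) (by omega) le_rfl).neg
      rw [← sub_eq_add_neg, ← hQ] at this
      refine this.mono le_rfl ?_
      calc _ = β ^ (u.length + 1) * (A * (Fintype.card (Idx n) * (n + 1) + 2)) * B := by ring
        _ ≤ β ^ (u.length + 1) * β * B := by gcongr
        _ = _ := by rw [List.length_cons, pow_succ β (u.length + 1)]

end

end

section

/-! ## The coefficients of the flat sections -/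

open MvPolynomial

/-- Recursive choice along a list, where the existence of the next value requires the invariant `P`
of the previous one. -/
theorem exists_list_rec {ι E : Type} [Nonempty E] {P : List ι → E → Prop}
    {R : ι → List ι → E → E → Prop} {e : E} (h0 : P [] e)
    (h : ∀ i w x, P w x → ∃ y, P (i :: w) y ∧ R i w x y) :
    ∃ B : List ι → E, (∀ w, P w (B w)) ∧ ∀ i w, R i w (B w) (B (i :: w)) := by
  choose! F hF using h
  let B : List ι → E := fun w => w.rec e fun i w x => F i w x
  have hB : ∀ w, P w (B w) := by
    intro w
    induction w with
    | nil => exact h0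
    | cons i w ih => exact (hF i w _ ih).1
  exact ⟨B, hB, fun i w => (hF i w _ (hB w)).2⟩

section
variable {n : ℕ}

/-- The exponents of the denominators: `expo (l + 1) = expo l + l + 1`. -/
def expo : ℕ → ℕ
  | 0 => 0
  | l + 1 => expo l + l + 1

theorem expo_mono : Monotone expo := monotone_nat_of_le_succ fun l => by
  rw [expo]
  omega

theorem expo_le (l : ℕ) : expo l ≤ l * l := by
  induction l with
  | zero => simp [expo]
  | succ l ih =>
    rw [expo]
    nlinarith

theorem one_le_expo {l : ℕ} (h : 1 ≤ l) : 1 ≤ expo l := expo_mono h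

/-- The inhomogeneous term in the direction of `λ_α`. -/
def source (α : Idx n) (i : Fin n × Fin n) : Pol n :=
  -(dY n (coeffPol n i) * mon n α.1.1 α.1.2)

theorem bd_source (α : Idx n) (i : Fin n × Fin n) :
    Bd (wl n) (ww n) 0 (3 * n) n (source α i) := by
  rw [source, coeffPol, dY_mon, mul_assoc, mon_mul_mon]
  have := (Bd.intCast (ω := wl n) (ω' := ww n) ((i.2 : ℕ) + 1 : ℕ)).mul
    (bd_mon (n := n) (i.1 + α.1.1) (i.2 + 1 - 1 + α.1.2))
  have h := α.2
  simp only [Int.natAbs_natCast, Int.cast_natCast, zero_add, mul_one] at this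
  exact (this.mono (by omega) (by omega)).neg

/-- `B w u` is the numerator of `A w u` over `L ^ expo |w|`. In passing from `w` to `i :: w`, each
term on the right of the flatness equation is integrated separately: the homogeneous term at every
`u` of length at most `|w|`, multiplied by `L ^ (|w| - |u|)` to reach a common power of `L`, and the
source at `w`, multiplied by `L ^ expo |w|`. The loss of `6n|u|` in the degree of `B w u` pays for
the growth `6n|u|` in `exists_integral`, so each letter costs only `3n + 6n = 9n`. -/
theorem exists_coefficients {K ℓ A : ℕ} {L : MvPolynomial (Idx n) ℤ} (hn : 1 ≤ n) (hℓ : 1 ≤ ℓ)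
    (hA : 1 ≤ A) (hL : Bd (fun _ => 1) (fun _ => 0) ℓ 0 A L) (hS : Solvable n (9 * (n * K)) ℓ A L)
    {β Z : ℕ} (hβ : A * (Fintype.card (Idx n) * (n + 1) + 2) ≤ β)
    (hZ : (wordsLE (Fin n × Fin n) K).card *
      (A ^ K * (β ^ K * (Fintype.card (Idx n) * (n + 1)))) + A ^ (K * K) * (β ^ K * n) ≤ Z)
    (α : Idx n) :
    ∃ B : List (Fin n × Fin n) → List (Fin n × Fin n) → Pol n,
      (∀ w, (w = [] → ∀ u, B w u = 0) ∧ (∀ u, w.length < u.length → B w u = 0) ∧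
        baseVal n (B w []) = 0 ∧
        ∀ u, Bd (wl n) (ww n) (expo w.length * ℓ - 1)
          (9 * n * w.length - 6 * n * u.length) (Z ^ w.length) (B w u)) ∧
      ∀ i w, w.length < K → ∀ u, ∃ q,
        brk n (B (i :: w) u) + ∑ j, B (i :: w) (j :: u) * (coeffPol n j * dY n (genHam n)) =
          emb n L ^ (w.length + 1) * (coeffPol n i * dY n (genHam n)) * B w u +
            (if u = w then emb n L ^ expo (w.length + 1) * source α i else 0) +
            q * genHam n := by
  have hG : 1 ≤ Fintype.card (Idx n) * (n + 1) :=
    Nat.mul_pos (Fintype.card_pos_iff.2 ⟨idx00 n⟩) (Nat.succ_pos n)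
  have hβ1 : 1 ≤ β := le_trans (Nat.mul_pos hA (by omega)) hβ
  have hZ1 : 1 ≤ Z := by
    have : 1 ≤ A ^ (K * K) * (β ^ K * n) :=
      Nat.mul_pos (Nat.pow_pos hA) (Nat.mul_pos (Nat.pow_pos hβ1) hn)
    exact this.trans (le_trans (Nat.le_add_left _ _) hZ)
  refine exists_list_rec (P := fun w x => (w = [] → ∀ u, x u = 0) ∧
    (∀ u, w.length < u.length → x u = 0) ∧ baseVal n (x []) = 0 ∧
        ∀ u, Bd (wl n) (ww n) (expo w.length * ℓ - 1)
          (9 * n * w.length - 6 * n * u.length) (Z ^ w.length) (x u))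
    (R := fun i w x y => w.length < K → ∀ u, ∃ q,
        brk n (y u) + ∑ j, y (j :: u) * (coeffPol n j * dY n (genHam n)) =
          emb n L ^ (w.length + 1) * (coeffPol n i * dY n (genHam n)) * x u +
            (if u = w then emb n L ^ expo (w.length + 1) * source α i else 0) +
            q * genHam n)
    (e := fun _ => 0) ⟨fun _ _ => rfl, fun _ _ => rfl, map_zero _, fun _ => Bd.zero⟩ ?_
  rintro i w x ⟨hx0, hx1, hx2, hx3⟩
  -- No equation is required from words of length `K` on, and zero satisfies the invariant.
  by_cases hw : w.length < K
  swap
  · exact ⟨fun _ => 0, ⟨fun h => absurd h (by simp), fun _ _ => rfl, map_zero _, fun _ => Bd.zero⟩,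
      fun h => absurd h hw⟩
  obtain ⟨l, hl⟩ : ∃ l, w.length = l := ⟨_, rfl⟩
  simp only [List.length_cons, hl] at hw hx1 hx3 ⊢
  have hwK : 9 * n * l + 9 * n ≤ 9 * (n * K) := by
    have : n * (l + 1) ≤ n * K := Nat.mul_le_mul_left n hw
    nlinarith
  -- the integrals of the homogeneous terms
  have hint : ∀ u, ∃ Q : List (Fin n × Fin n) → Pol n, u.length ≤ l →
      (∀ v, ∃ q, brk n (Q v) + ∑ j, Q (j :: v) * (coeffPol n j * dY n (genHam n)) =
        (if v = u then emb n L ^ (l + 1) * (coeffPol n i * dY n (genHam n)) * x v else 0) +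
          q * genHam n) ∧
      (∀ v, l + 1 < v.length → Q v = 0) ∧ baseVal n (Q []) = 0 ∧
      ∀ v, Bd (wl n) (ww n) (expo (l + 1) * ℓ - 1) (9 * n * (l + 1) - 6 * n * v.length)
        (A ^ K * (β ^ K * (Fintype.card (Idx n) * (n + 1))) * Z ^ l) (Q v) := by
    intro u
    by_cases hu : u.length ≤ l
    swap
    · exact ⟨fun _ => 0, fun h => absurd h hu⟩
    -- For the empty word `expo 0 * ℓ - 1` is a truncated difference and the degree count breaks
    -- down, but there the homogeneous term is zero.
    rcases Nat.eq_zero_or_pos l with hl0 | hl0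
    · have hw0 : w = [] := List.length_eq_zero_iff.1 (hl.trans hl0)
      refine ⟨fun _ => 0, fun _ => ⟨fun v => ⟨0, ?_⟩, fun _ _ => rfl, map_zero _, fun _ => Bd.zero⟩⟩
      simp [hx0 hw0]
    have hE := one_le_expo hl0
    have hEℓ : 1 ≤ expo l * ℓ := Nat.mul_pos hE hℓ
    have b1 := (bd_coeffPol_mul_dY_genHam i).mul (hx3 u)
    have hnu : 6 * n * u.length ≤ 6 * n * l := Nat.mul_le_mul_left _ hu
    have hnl : 6 * n * l ≤ 9 * n * l := Nat.mul_le_mul_right _ (by omega)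
    obtain ⟨Q, h1, h2, h3, h4⟩ := exists_integral hn hℓ hA hL hS hβ u _ _ _ _ b1 (by omega)
    refine ⟨fun v => emb n L ^ (l - u.length) * Q v, fun _ => ⟨fun v => ?_, fun v hv => ?_, ?_,
      fun v => ?_⟩⟩
    · obtain ⟨q, hq⟩ := h1 v
      refine ⟨emb n L ^ (l - u.length) * q, ?_⟩
      have hz : brk n (emb n L ^ (l - u.length)) = 0 := by
        rw [← map_pow, brk_apply, dX_emb, dY_emb]
        ring
      simp only [brk_mul, hz, zero_mul, add_zero, mul_assoc]
      rw [← Finset.mul_sum, ← mul_add, hq]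
      split_ifs with hv
      · rw [hv, show l + 1 = (l - u.length) + (u.length + 1) by omega, pow_add]
        ring
      · ring
    · simp only [h2 v (by omega), mul_zero]
    · simp only [map_mul, h3, mul_zero]
    · have := (hL.emb.pow (l - u.length)).mul (h4 v)
      have et : (l - u.length) * ℓ + (1 + (expo l * ℓ - 1) + (u.length + 1) * ℓ - 1) =
          expo (l + 1) * ℓ - 1 := by
        have : expo (l + 1) = expo l + (l - u.length) + (u.length + 1) := by
          rw [expo]
          omega
        have e : expo (l + 1) * ℓ = expo l * ℓ + (l - u.length) * ℓ + (u.length + 1) * ℓ := by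
          rw [this]
          ring
        omega
      rw [et, mul_zero, zero_add] at this
      refine this.mono ?_ ?_
      · rw [mul_add (9 * n), mul_one]
        omega
      · calc A ^ (l - u.length) * (β ^ (u.length + 1) *
            (Fintype.card (Idx n) * (n + 1) * Z ^ l))
            ≤ A ^ K * (β ^ K * (Fintype.card (Idx n) * (n + 1) * Z ^ l)) :=
              Nat.mul_le_mul (Nat.pow_le_pow_right hA (by omega))
                (Nat.mul_le_mul_right _ (Nat.pow_le_pow_right hβ1 (by omega)))
          _ = _ := by ring
  choose Q hQ using hint
  -- the integral of the inhomogeneous term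
  obtain ⟨Q', g1, g2, g3, g4⟩ := exists_integral hn hℓ hA hL hS hβ w _ _ _ _ (bd_source α i)
    (by
      have : 6 * n * l ≤ 9 * n * l := Nat.mul_le_mul_right _ (by omega)
      rw [hl]
      omega)
  rw [hl] at g1 g2 g4
  have hzE : brk n (emb n L ^ expo l) = 0 := by
    rw [← map_pow, brk_apply, dX_emb, dY_emb]
    ring
  obtain ⟨y, hy⟩ : ∃ y : List (Fin n × Fin n) → Pol n, ∀ v, y v =
    ∑ u ∈ wordsLE (Fin n × Fin n) l, Q u v + emb n L ^ expo l * Q' v := ⟨_, fun _ => rfl⟩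
  refine ⟨y, ⟨fun h => absurd h (by simp), fun v hv => ?_, ?_, fun v => ?_⟩, fun _ v => ?_⟩
  · rw [hy, g2 v hv, mul_zero, add_zero]
    exact Finset.sum_eq_zero fun u hu => (hQ u (mem_wordsLE.1 hu)).2.1 v hv
  · rw [hy, map_add, map_mul, g3, mul_zero, add_zero, map_sum]
    exact Finset.sum_eq_zero fun u hu => (hQ u (mem_wordsLE.1 hu)).2.2.1
  · have b1 := Bd.sum_const (wordsLE (Fin n × Fin n) l) fun u hu =>
      (hQ u (mem_wordsLE.1 hu)).2.2.2 v
    have b2 := (hL.emb.pow (expo l)).mul (g4 v)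
    have et : expo l * ℓ + (0 + (l + 1) * ℓ - 1) = expo (l + 1) * ℓ - 1 := by
      have h1 : 1 ≤ (l + 1) * ℓ := Nat.mul_pos (Nat.succ_pos l) hℓ
      have e : expo (l + 1) * ℓ = expo l * ℓ + (l + 1) * ℓ := by
        rw [expo]
        ring
      omega
    rw [et, mul_zero, zero_add] at b2
    have b3 := b1.add (b2.mono (d' := 9 * n * (l + 1) - 6 * n * v.length) (by
      have : 6 * n * l ≤ 9 * n * l := Nat.mul_le_mul_right _ (by omega)
      rw [mul_add (9 * n), mul_one]
      omega) le_rfl)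
    rw [← hy] at b3
    refine b3.mono le_rfl ?_
    have hZl : 1 ≤ Z ^ l := Nat.pow_pos hZ1
    have hcard : (wordsLE (Fin n × Fin n) l).card ≤ (wordsLE (Fin n × Fin n) K).card :=
      Finset.card_le_card fun u hu => mem_wordsLE.2 ((mem_wordsLE.1 hu).trans hw.le)
    have hexp : expo l ≤ K * K := (expo_mono hw.le).trans (expo_le K)
    calc _ ≤ (wordsLE (Fin n × Fin n) K).card *
          (A ^ K * (β ^ K * (Fintype.card (Idx n) * (n + 1))) * Z ^ l) +
          A ^ (K * K) * (β ^ K * n) :=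
          Nat.add_le_add (Nat.mul_le_mul_right _ hcard)
            (Nat.mul_le_mul (Nat.pow_le_pow_right hA hexp)
              (Nat.mul_le_mul_right _ (Nat.pow_le_pow_right hβ1 (by omega))))
      _ ≤ (wordsLE (Fin n × Fin n) K).card *
          (A ^ K * (β ^ K * (Fintype.card (Idx n) * (n + 1))) * Z ^ l) +
          A ^ (K * K) * (β ^ K * n) * Z ^ l :=
          Nat.add_le_add_left (Nat.le_mul_of_pos_right _ hZl) _
      _ = ((wordsLE (Fin n × Fin n) K).card *
          (A ^ K * (β ^ K * (Fintype.card (Idx n) * (n + 1)))) +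
          A ^ (K * K) * (β ^ K * n)) * Z ^ l := by ring
      _ ≤ Z * Z ^ l := Nat.mul_le_mul_right _ hZ
      _ = Z ^ (l + 1) := by ring
  · have e1 : ∀ u ∈ wordsLE (Fin n × Fin n) l, ∃ q, brk n (Q u v) +
        ∑ j, Q u (j :: v) * (coeffPol n j * dY n (genHam n)) =
        (if v = u then emb n L ^ (l + 1) * (coeffPol n i * dY n (genHam n)) * x v else 0) +
          q * genHam n := fun u hu => (hQ u (mem_wordsLE.1 hu)).1 v
    choose! q hq using e1
    obtain ⟨q', hq'⟩ := g1 v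
    refine ⟨∑ u ∈ wordsLE (Fin n × Fin n) l, q u + emb n L ^ expo l * q', ?_⟩
    have e2 : ∑ u ∈ wordsLE (Fin n × Fin n) l,
        (if v = u then emb n L ^ (l + 1) * (coeffPol n i * dY n (genHam n)) * x v else 0) =
        emb n L ^ (l + 1) * (coeffPol n i * dY n (genHam n)) * x v := by
      rw [Finset.sum_ite_eq]
      split_ifs with h
      · rfl
      · rw [mem_wordsLE, not_le] at h
        rw [hx1 v h, mul_zero]
    have e3 := Finset.sum_congr rfl hq
    rw [Finset.sum_add_distrib, Finset.sum_add_distrib, e2, ← Finset.sum_mul] at e3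
    have e4 : ∑ j, y (j :: v) * (coeffPol n j * dY n (genHam n)) =
        ∑ u ∈ wordsLE (Fin n × Fin n) l, ∑ j, Q u (j :: v) * (coeffPol n j * dY n (genHam n)) +
        emb n L ^ expo l * ∑ j, Q' (j :: v) * (coeffPol n j * dY n (genHam n)) := by
      rw [Finset.sum_comm, Finset.mul_sum, ← Finset.sum_add_distrib]
      refine Finset.sum_congr rfl fun j _ => ?_
      rw [hy, add_mul, Finset.sum_mul, mul_assoc]
    rw [e4, hy, map_add, map_sum, brk_mul, hzE, zero_mul, add_zero]
    have e5 : (if v = w then emb n L ^ expo (l + 1) * source α i else 0) =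
        emb n L ^ expo l * (if v = w then emb n L ^ (l + 1) * source α i else 0) := by
      split_ifs
      · rw [expo, add_assoc, pow_add]
        ring
      · rw [mul_zero]
    rw [e5]
    linear_combination e3 + emb n L ^ expo l * hq'

/-! ## Numerical bounds -/

/-- Each of the three factors is at most `(T ^ 10) ^ M`. -/
theorem factorial_bound {T M b : ℕ} (hM : 1 ≤ M) (h1 : M ≤ T ^ 10) (h2 : b ≤ T ^ 10) :
    M * (M.factorial * b ^ M) ≤ T ^ (30 * M) := by
  have e1 : M ≤ (T ^ 10) ^ M := h1.trans (Nat.le_self_pow (by omega) _)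
  have e2 : M.factorial ≤ (T ^ 10) ^ M :=
    (Nat.factorial_le_pow M).trans (Nat.pow_le_pow_left h1 _)
  have e3 : b ^ M ≤ (T ^ 10) ^ M := Nat.pow_le_pow_left h2 _
  calc M * (M.factorial * b ^ M) ≤ (T ^ 10) ^ M * ((T ^ 10) ^ M * (T ^ 10) ^ M) := by gcongr
    _ = T ^ (30 * M) := by
      rw [← pow_mul, ← pow_add, ← pow_add]
      congr 1
      omega

theorem card_idx_le : Fintype.card (Idx n) ≤ (n + 2) ^ 2 := card_mon_le (n + 1)

/-- With `m = nK` there are at most `(13m)^2` monomials in each of the `9m + 1 ≤ 10m` systems,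
whence `1690 m^3`. In the exponent `41ℓ`, the product of the determinant bounds accounts for `30ℓ`,
and the factor `2 (9m + 2n + 2)^2 ≤ T ^ 11` is absorbed in the other `11ℓ`. -/
theorem exists_solvable {K : ℕ} (hn : 1 ≤ n) (hK : 1 ≤ K) :
    ∃ (ℓ : ℕ) (L : MvPolynomial (Idx n) ℤ), 1 ≤ ℓ ∧ ℓ ≤ 1690 * (n * K) ^ 3 ∧ L ≠ 0 ∧
      Bd (fun _ => 1) (fun _ => 0) ℓ 0 ((K * n + 1) ^ (41 * ℓ)) L ∧
      Solvable n (9 * (n * K)) ℓ ((K * n + 1) ^ (41 * ℓ)) L := by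
  obtain ⟨m, hm⟩ : ∃ m, n * K = m := ⟨_, rfl⟩
  have hnm : n ≤ m := hm ▸ Nat.le_mul_of_pos_right n hK
  rw [mul_comm K n, hm]
  set T := m + 1 with hT
  have hT2 : 2 ≤ T := by omega
  have hTp : ∀ k, 2 ^ k ≤ T ^ k := fun k => Nat.pow_le_pow_left hT2 k
  let M : ℕ → ℕ := fun s => Fintype.card (Mon (s + 3 * n))
  have hM1 : ∀ s, 1 ≤ M s := fun s => Fintype.card_pos_iff.2 ⟨Mon.mk 0 0 (by omega)⟩
  have h13 : 13 * T ≤ T ^ 5 := by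
    have := hTp 4
    calc 13 * T ≤ T ^ 4 * T := Nat.mul_le_mul_right _ (by omega)
      _ = T ^ 5 := by ring
  have hMs : ∀ s ≤ 9 * m, M s ≤ (13 * m) ^ 2 := fun s hs =>
    (card_mon_le _).trans (Nat.pow_le_pow_left (by omega) 2)
  have hMT : ∀ s ≤ 9 * m, M s ≤ T ^ 10 := by
    intro s hs
    refine (hMs s hs).trans ?_
    calc (13 * m) ^ 2 ≤ (T ^ 5) ^ 2 := Nat.pow_le_pow_left (by omega) 2
      _ = T ^ 10 := by ring
  have hb : ∀ s ≤ 9 * m, Fintype.card (Idx n) * ((s + 2 * n + 1) * (n + 1)) ≤ T ^ 10 := by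
    intro s hs
    have e1 : (n + 2) ^ 2 ≤ T ^ 4 := by
      calc (n + 2) ^ 2 ≤ (T * T) ^ 2 := Nat.pow_le_pow_left (by nlinarith) 2
        _ = T ^ 4 := by ring
    have e2 : s + 2 * n + 1 ≤ T ^ 5 := by omega
    calc _ ≤ T ^ 4 * (T ^ 5 * T) :=
        Nat.mul_le_mul (card_idx_le.trans e1) (Nat.mul_le_mul e2 (by omega))
      _ = T ^ 10 := by ring
  obtain ⟨ℓ, hℓ⟩ : ∃ ℓ, ℓ = ∑ s ∈ Finset.range (9 * m + 1), M s := ⟨_, rfl⟩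
  have hℓ1 : 1 ≤ ℓ := by
    rw [hℓ]
    exact (hM1 0).trans (Finset.single_le_sum (f := M) (fun _ _ => Nat.zero_le _)
      (Finset.mem_range.2 (Nat.succ_pos _)))
  have hℓ2 : ℓ ≤ 1690 * m ^ 3 := by
    rw [hℓ]
    refine (Finset.sum_le_card_nsmul _ _ ((13 * m) ^ 2) fun s hs => hMs s
      (Nat.lt_succ_iff.1 (Finset.mem_range.1 hs))).trans ?_
    rw [Finset.card_range, smul_eq_mul]
    calc (9 * m + 1) * (13 * m) ^ 2 ≤ (10 * m) * (13 * m) ^ 2 :=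
          Nat.mul_le_mul_right _ (by omega)
      _ = 1690 * m ^ 3 := by ring
  obtain ⟨L, hL0, hL1, hL2⟩ := exists_solution_of_bounds hn (9 * m) (M := M)
    (N := fun s => T ^ (30 * M s)) (fun _ => rfl)
    (fun s hs => factorial_bound (hM1 s) (hMT s hs) (hb s hs)) hℓ (A := T ^ (41 * ℓ)) (by
      rw [Finset.prod_pow_eq_pow_sum, ← Finset.mul_sum, ← hℓ]
      have e : 9 * m + 2 * n + 2 ≤ T ^ 5 := by omega
      calc 2 * (9 * m + 2 * n + 2) ^ 2 * T ^ (30 * ℓ) ≤ T * (T ^ 5) ^ 2 * T ^ (30 * ℓ) := by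
            gcongr
        _ = T ^ (30 * ℓ + 11) := by ring
        _ ≤ T ^ (41 * ℓ) := Nat.pow_le_pow_right (by omega) (by omega))
  exact ⟨ℓ, L, hℓ1, hℓ2, hL0, hL1, hL2⟩

end

end

section

/-! ## Flat sections from polynomial identities -/

open MvPolynomial

section
variable {n : ℕ}

/-- The point `(λ, p) = (b, p)`. -/
def optPt (b : Idx n → ℂ) (p : ℂ) : Option (Idx n) → ℂ := fun o => o.elim p b

/-- The value at `(λ, p, x, y) = (b, p, q)`. -/
def evalPol (b : Idx n → ℂ) (p : ℂ) (q : ℂ × ℂ) : Pol n →ₐ[ℤ] ℂ :=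
  aeval (Sum.elim (optPt b p) ![q.1, q.2])

theorem evalPol_emb (b : Idx n → ℂ) (p : ℂ) (q : ℂ × ℂ) (P : MvPolynomial (Idx n) ℤ) :
    evalPol b p q (emb n P) = aeval b P := by
  rw [evalPol, emb, aeval_rename]
  rfl

theorem evalPol_mon (b : Idx n → ℂ) (p : ℂ) (q : ℂ × ℂ) (k l : ℕ) :
    evalPol b p q (mon n k l) = q.1 ^ k * q.2 ^ l := by
  simp [evalPol, mon]

theorem evalPol_coeffPol (b : Idx n → ℂ) (p : ℂ) (q : ℂ × ℂ) (i : Fin n × Fin n) :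
    evalPol b p q (coeffPol n i) = basicCoeff i q := by
  rw [coeffPol, evalPol_mon, basicCoeff]

theorem evalPol_genHam (b : Idx n → ℂ) (p : ℂ) (q : ℂ × ℂ) :
    evalPol b p q (genHam n) = hamFn n (b, q) := by
  rw [genHam, map_sum, hamFn]
  refine Finset.sum_congr rfl fun α _ => ?_
  rw [map_mul, evalPol_mon, evalPol, aeval_X]
  rfl

theorem evalPol_dX_genHam (b : Idx n → ℂ) (p : ℂ) (q : ℂ × ℂ) :
    evalPol b p q (dX n (genHam n)) = hamFnX n (b, q) := by
  rw [dX_genHam, map_sum, hamFnX]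
  refine Finset.sum_congr rfl fun α _ => ?_
  rw [map_mul, map_mul, evalPol_mon, map_natCast, evalPol, aeval_X]
  simp [optPt, mul_assoc]

theorem evalPol_dY_genHam (b : Idx n → ℂ) (p : ℂ) (q : ℂ × ℂ) :
    evalPol b p q (dY n (genHam n)) = hamFnY n (b, q) := by
  rw [dY_genHam, map_sum, hamFnY]
  refine Finset.sum_congr rfl fun α _ => ?_
  rw [map_mul, map_mul, evalPol_mon, map_natCast, evalPol, aeval_X]
  simp only [optPt, Sum.elim_inl, Option.elim_some]
  ring

theorem evalPol_base (b : Idx n → ℂ) (p : ℂ) (P : Pol n) :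
    evalPol b p ((0 : ℂ), p) P = aeval (optPt b p) (baseVal n P) := by
  have : evalPol b p ((0 : ℂ), p) =
      ((aeval (optPt b p) : MvPolynomial (Option (Idx n)) ℤ →ₐ[ℤ] ℂ).comp (baseVal n)) := by
    apply algHom_ext
    rintro (o | k)
    · simp [evalPol, baseVal]
    · fin_cases k <;> simp [evalPol, baseVal, optPt]
  rw [this, AlgHom.comp_apply]

theorem hasFDerivAt_evalPol (b : Idx n → ℂ) (p : ℂ) (q : ℂ × ℂ) (P : Pol n) :
    HasFDerivAt (fun q => evalPol b p q P)
      (evalPol b p q (dX n P) • ContinuousLinearMap.fst ℂ ℂ ℂ +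
        evalPol b p q (dY n P) • ContinuousLinearMap.snd ℂ ℂ ℂ) q := by
  induction P using MvPolynomial.induction_on with
  | C a =>
    have : (fun q : ℂ × ℂ => evalPol b p q (C a)) = fun _ => (a : ℂ) := by
      funext q
      simp [evalPol]
    rw [this]
    exact (hasFDerivAt_const _ _).congr_fderiv (by ext <;> simp [dX, dY])
  | add P Q hP hQ =>
    simp only [map_add]
    exact (hP.add hQ).congr_fderiv (by ext <;> simp)
  | mul_X P v hP =>
    have hX : HasFDerivAt (fun q => evalPol b p q (X v))
        (evalPol b p q (dX n (X v)) • ContinuousLinearMap.fst ℂ ℂ ℂ +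
          evalPol b p q (dY n (X v)) • ContinuousLinearMap.snd ℂ ℂ ℂ) q := by
      match v with
      | .inl o =>
        have : (fun q : ℂ × ℂ => evalPol b p q (X (Sum.inl o))) = fun _ => optPt b p o := by
          funext q
          simp [evalPol]
        rw [this, dX, dY, pderiv_X_of_ne (by simp), pderiv_X_of_ne (by simp)]
        exact (hasFDerivAt_const _ _).congr_fderiv (by ext <;> simp)
      | .inr 0 =>
        have : (fun q : ℂ × ℂ => evalPol b p q (X (Sum.inr 0))) = fun q => q.1 := by
          funext q
          simp [evalPol]
        rw [this, dX, dY, pderiv_X_self, pderiv_X_of_ne (by simp)]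
        exact (hasFDerivAt_fst (𝕜 := ℂ) (p := q)).congr_fderiv (by ext <;> simp)
      | .inr 1 =>
        have : (fun q : ℂ × ℂ => evalPol b p q (X (Sum.inr 1))) = fun q => q.2 := by
          funext q
          simp [evalPol]
        rw [this, dX, dY, pderiv_X_self, pderiv_X_of_ne (by simp)]
        exact (hasFDerivAt_snd (𝕜 := ℂ) (p := q)).congr_fderiv (by ext <;> simp)
    simp only [map_mul, Derivation.leibniz, map_add, smul_eq_mul]
    exact (hP.mul hX).congr_fderiv (by ext <;> simp)

theorem fderiv_basicCoeff (b : Idx n → ℂ) (p : ℂ) (q η : ℂ × ℂ) (i : Fin n × Fin n) :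
    fderiv ℂ (basicCoeff i) q η = evalPol b p q (dX n (coeffPol n i)) * η.1 +
      evalPol b p q (dY n (coeffPol n i)) * η.2 := by
  have h := hasFDerivAt_evalPol b p q (coeffPol n i)
  simp only [evalPol_coeffPol] at h
  have h2 : HasFDerivAt (basicCoeff i) _ q := h
  rw [h2.fderiv]
  simp

theorem fderiv_hamFn_zero_left (b : Idx n → ℂ) (q η : ℂ × ℂ) :
    fderiv ℂ (hamFn n) (b, q) (0, η) = hamFnX n (b, q) * η.1 + hamFnY n (b, q) * η.2 := by
  rw [fderiv_hamFn]
  simp [hamFn]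

theorem hamFn_single [DecidableEq (Idx n)] (α : Idx n) (q : ℂ × ℂ) :
    hamFn n (Pi.single α 1, q) = q.1 ^ (α.1.1 : ℕ) * q.2 ^ (α.1.2 : ℕ) := by
  rw [hamFn, Finset.sum_eq_single α]
  · simp
  · intro β _ h
    simp [Pi.single_eq_of_ne h]
  · simp

/-- The directions in which the Hamiltonian is multiplied by a constant. -/
theorem flatData_euler (K : ℕ) (b : Idx n → ℂ) (q₀ : ℂ × ℂ) :
    FlatData (hamFn n) (basicCoeff (n := n)) K b b q₀ (fun _ _ _ => 0) where
  diff _ _ := differentiable_const 0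
  nil _ _ := rfl
  supp _ _ _ _ := rfl
  base _ := rfl
  flat i w _ u q hq hreg ξ η hξ hη := by
    rw [fderiv_hamFn_zero_left, fderiv_hamFn_zero_left] at hreg
    rw [fderiv_hamFn_zero_left] at hη
    rw [fderiv_hamFn] at hξ
    simp only [hq, zero_add, mul_one, mul_zero, add_zero] at hξ hreg
    -- On the curve `hamFn n (b, q) = 0`, so `ξ` is itself tangent to the curve. At a smooth point
    -- it is then proportional to `η`, and the curvature term vanishes.
    have hdet : ξ.1 * η.2 - ξ.2 * η.1 = 0 := by
      by_contra h0
      apply hreg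
      constructor
      · have : hamFnX n (b, q) * (ξ.1 * η.2 - ξ.2 * η.1) = 0 := by
          linear_combination η.2 * hξ - ξ.2 * hη
        exact (mul_eq_zero.1 this).resolve_right h0
      · have : hamFnY n (b, q) * (ξ.1 * η.2 - ξ.2 * η.1) = 0 := by
          linear_combination ξ.1 * hη - η.1 * hξ
        exact (mul_eq_zero.1 this).resolve_right h0
    rw [fderiv_basicCoeff b 0, fderiv_basicCoeff b 0]
    have : ∀ X Y : ℂ, (X * ξ.1 + Y * ξ.2) * η.1 - (X * η.1 + Y * η.2) * ξ.1 = 0 := by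
      intro X Y
      linear_combination -Y * hdet
    simp [this]

/-- A vector `η` tangent to the curve is `κ (H_y, -H_x)`, so `κ` times the polynomial identity,
evaluated on the curve where the multiple of `H` drops out, is the flatness equation. The source is
the curvature term because tangency of `(Pi.single α 1, ξ)` means `H_x ξ.1 + H_y ξ.2 = -x^a y^b`,
where `x^a y^b` is the monomial of `α`. -/
theorem flatData_of_coefficients [DecidableEq (Idx n)] {K : ℕ} {L : MvPolynomial (Idx n) ℤ} {α : Idx n}
    {B : List (Fin n × Fin n) → List (Fin n × Fin n) → Pol n}
    (h0 : ∀ u, B [] u = 0) (h1 : ∀ w u, w.length < u.length → B w u = 0)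
    (h2 : ∀ w, baseVal n (B w []) = 0)
    (h3 : ∀ i w, w.length < K → ∀ u, ∃ q,
        brk n (B (i :: w) u) + ∑ j, B (i :: w) (j :: u) * (coeffPol n j * dY n (genHam n)) =
          emb n L ^ (w.length + 1) * (coeffPol n i * dY n (genHam n)) * B w u +
            (if u = w then emb n L ^ expo (w.length + 1) * source α i else 0) +
            q * genHam n)
    {b : Idx n → ℂ} (p : ℂ) (hb : aeval b L ≠ 0) :
    FlatData (hamFn n) basicCoeff K b (Pi.single α 1) ((0 : ℂ), p) fun w u q =>
      ((aeval b L) ^ expo w.length)⁻¹ * evalPol b p q (B w u) where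
  diff w u q := (hasFDerivAt_evalPol b p q (B w u)).differentiableAt.const_mul _
  nil u q := by simp only [h0, map_zero, mul_zero]
  supp w u q h := by simp only [h1 w u h, map_zero, mul_zero]
  base w := by simp only [evalPol_base, h2, map_zero, mul_zero]
  flat i w hw u q hq hreg ξ η hξ hη := by
    rw [fderiv_hamFn_zero_left, fderiv_hamFn_zero_left] at hreg
    rw [fderiv_hamFn_zero_left] at hη
    rw [fderiv_hamFn, hamFn_single] at hξ
    simp only [mul_one, mul_zero, add_zero, zero_add] at hξ hreg
    obtain ⟨κ, hκ1, hκ2⟩ : ∃ κ, η.1 = κ * hamFnY n (b, q) ∧ η.2 = -(κ * hamFnX n (b, q)) := by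
      by_cases hY : hamFnY n (b, q) = 0
      · have hX : hamFnX n (b, q) ≠ 0 := fun h => hreg ⟨h, hY⟩
        refine ⟨-η.2 / hamFnX n (b, q), ?_, ?_⟩
        · rw [hY, mul_zero]
          rw [hY, zero_mul, add_zero] at hη
          exact (mul_eq_zero.1 hη).resolve_left hX
        · rw [div_mul_cancel₀ _ hX, neg_neg]
      · refine ⟨η.1 / hamFnY n (b, q), ?_, ?_⟩
        · rw [div_mul_cancel₀ _ hY]
        · rw [div_mul_eq_mul_div, eq_neg_iff_add_eq_zero, add_div' _ _ _ hY, div_eq_zero_iff]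
          left
          linear_combination hη
    obtain ⟨Q, hQ⟩ := h3 i w hw u
    have hQ' := congrArg (evalPol b p q) hQ
    have e1 : ∀ j : Fin n × Fin n, evalPol b p q (B (i :: w) (j :: u) *
        (coeffPol n j * dY n (genHam n))) =
        evalPol b p q (B (i :: w) (j :: u)) * basicCoeff j q * hamFnY n (b, q) := by
      intro j
      rw [map_mul, map_mul, evalPol_coeffPol, evalPol_dY_genHam, mul_assoc]
    have e2 : evalPol b p q (if u = w then emb n L ^ expo (w.length + 1) * source α i else 0) =
        -(aeval b L ^ expo (w.length + 1) * if u = w then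
          evalPol b p q (dY n (coeffPol n i)) * (q.1 ^ (α.1.1 : ℕ) * q.2 ^ (α.1.2 : ℕ)) else 0) := by
      split_ifs
      · rw [source, map_mul, map_pow, evalPol_emb, map_neg, map_mul, evalPol_mon, mul_neg]
      · rw [map_zero, mul_zero, neg_zero]
    simp only [map_add, map_sum, e1, e2, brk_apply, map_sub, map_mul, map_pow, evalPol_emb,
      evalPol_dX_genHam, evalPol_dY_genHam, evalPol_genHam, evalPol_coeffPol, hq, mul_zero,
      add_zero, ← Finset.sum_mul] at hQ'
    have e3 : fderiv ℂ (fun q => ((aeval b L) ^ expo (i :: w).length)⁻¹ *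
        evalPol b p q (B (i :: w) u)) q η = ((aeval b L) ^ expo (i :: w).length)⁻¹ *
        (evalPol b p q (dX n (B (i :: w) u)) * η.1 + evalPol b p q (dY n (B (i :: w) u)) * η.2) := by
      rw [((hasFDerivAt_evalPol b p q (B (i :: w) u)).const_mul _).fderiv]
      simp [mul_add]
    have e4 : ∑ j, ((aeval b L) ^ expo (i :: w).length)⁻¹ * evalPol b p q (B (i :: w) (j :: u)) *
        (basicCoeff j q * η.1) = ((aeval b L) ^ expo (i :: w).length)⁻¹ *
        (∑ j, evalPol b p q (B (i :: w) (j :: u)) * basicCoeff j q) * η.1 := by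
      rw [Finset.mul_sum, Finset.sum_mul]
      refine Finset.sum_congr rfl fun j _ => ?_
      ring
    rw [e3, e4, fderiv_basicCoeff b p, fderiv_basicCoeff b p, hκ1, hκ2, List.length_cons]
    have hE : aeval b L ^ expo (w.length + 1) =
        aeval b L ^ expo w.length * aeval b L ^ (w.length + 1) := by
      rw [← pow_add]
      rfl
    have hL1 : aeval b L ^ expo (w.length + 1) ≠ 0 := pow_ne_zero _ hb
    have hL2 : aeval b L ^ expo w.length ≠ 0 := pow_ne_zero _ hb
    have hL3 : aeval b L ^ (w.length + 1) ≠ 0 := pow_ne_zero _ hb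
    generalize ∑ j, evalPol b p q (B (i :: w) (j :: u)) * basicCoeff j q = s₀ at hQ' ⊢
    rw [hE] at hQ' hL1 ⊢
    generalize aeval b L ^ expo w.length = l1 at *
    generalize aeval b L ^ (w.length + 1) = l2 at *
    by_cases huw : u = w
    · simp only [if_pos huw] at hQ' ⊢
      field_simp
      linear_combination κ * hQ' - κ * l1 * l2 * evalPol b p q (dY n (coeffPol n i)) * hξ
    · simp only [if_neg huw, mul_zero, neg_zero, add_zero] at hQ' ⊢
      field_simp
      linear_combination κ * hQ'

end

end

section

/-! ## The connection matrix as a quotient of polynomials -/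

open MvPolynomial

section
variable {n : ℕ}

theorem card_wordsLE_le (n K : ℕ) (hn : 1 ≤ n) :
    (wordsLE (Fin n × Fin n) K).card ≤ (K + 1) * (n * n) ^ K := by
  have h := sum_wordsLE_eq_sum_word (n := n) (K := K) fun _ => 1
  rw [Finset.sum_const, smul_eq_mul, mul_one] at h
  rw [h, Finset.sum_const, smul_eq_mul, mul_one, Finset.card_univ, Fintype.card_sigma]
  refine (Finset.sum_le_card_nsmul _ _ ((n * n) ^ K) fun k _ => ?_).trans (by simp)
  simp only [Fintype.card_fun, Fintype.card_prod, Fintype.card_fin]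
  exact Nat.pow_le_pow_right (Nat.mul_pos hn hn) (by omega)

theorem card_word_le (n K : ℕ) (hn : 1 ≤ n) :
    Fintype.card (Word n K) ≤ (K + 1) * (n * n) ^ K := by
  have h := sum_wordsLE_eq_sum_word (n := n) (K := K) fun _ => 1
  simp only [Finset.sum_const, smul_eq_mul, mul_one, Finset.card_univ] at h
  rw [← h]
  exact card_wordsLE_le n K hn

theorem card_word_le_pow {n K : ℕ} (hn : 1 ≤ n) (hK : 1 ≤ K) :
    (K + 1) * (n * n) ^ K ≤ (K * n + 1) ^ (3 * K) := by
  have hnT : n ≤ K * n + 1 := by nlinarith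
  have hKT : K + 1 ≤ K * n + 1 := by nlinarith
  calc (K + 1) * (n * n) ^ K ≤ (K * n + 1) ^ K * ((K * n + 1) * (K * n + 1)) ^ K := by
        gcongr
        exact hKT.trans (Nat.le_self_pow (by omega) _)
    _ = (K * n + 1) ^ (3 * K) := by
      rw [← mul_pow, pow_mul]
      congr 1
      ring

/-- The numerators are the values of the `B w u` at `(0, p)`. Each letter multiplies norms by at
most `T ^ (105 ℓ K²)`: both summands of `hZ` are at most `T ^ (104 ℓ K²)`, and the doubling is
absorbed by one more power of `T`. The direction `b` is treated with the zero connection of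
`flatData_euler`. -/
theorem exists_connection_coefficients {K : ℕ} (hn : 1 ≤ n) (hK : 1 ≤ K) :
    ∃ (ℓ : ℕ) (L : MvPolynomial (Idx n) ℤ)
      (P : Idx n → List (Fin n × Fin n) → List (Fin n × Fin n) →
        MvPolynomial (Option (Idx n)) ℤ),
      1 ≤ ℓ ∧ ℓ ≤ 1690 * (n * K) ^ 3 ∧ L ≠ 0 ∧
      Bd (fun _ => 1) (fun _ => 0) ℓ 0 ((K * n + 1) ^ (41 * ℓ)) L ∧
      (∀ α u, P α [] u = 0) ∧
      (∀ α w u, w.length ≤ K → Bd (fun o => wl n (Sum.inl o)) (fun o => ww n (Sum.inl o))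
        (expo w.length * ℓ - 1) (9 * n * K) ((K * n + 1) ^ (105 * ℓ * K ^ 3)) (P α w u)) ∧
      ∀ a : Idx n → ℂ, SmoothCurve a → TransversalToAxis a → ∀ F : CycleFamily a,
        ∀ᶠ b in 𝓝 a, b ∈ F.U ∧ ∀ w v : Word n K, ContDiffAt ℂ 2 (fun b => F.S K b w v) b ∧
          fderiv ℂ (fun b => F.S K b w v) b b = 0 ∧
          (aeval b L ≠ 0 → ∀ α, fderiv ℂ (fun b => F.S K b w v) b (Pi.single α 1) =
            ∑ u : Word n K, (aeval b L ^ expo w.letters.length)⁻¹ *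
              aeval (optPt b (F.base b)) (P α w.letters u.letters) * F.S K b u v) := by
  obtain ⟨ℓ, L, hℓ1, hℓ2, hL0, hL, hS⟩ := exists_solvable hn hK
  obtain ⟨T, hT⟩ : ∃ T, T = K * n + 1 := ⟨_, rfl⟩
  rw [← hT] at hL hS
  have hT2 : 2 ≤ T := by
    rw [hT]
    have := Nat.mul_pos hK hn
    omega
  have hT1 : 1 ≤ T := by omega
  have hnT : n + 1 ≤ T := by nlinarith
  have hG : Fintype.card (Idx n) * (n + 1) ≤ T ^ 5 := by
    have : (n + 2) ^ 2 ≤ (T * T) ^ 2 := Nat.pow_le_pow_left (by nlinarith) 2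
    calc _ ≤ (T * T) ^ 2 * T := Nat.mul_le_mul (card_idx_le.trans this) hnT
      _ = T ^ 5 := by ring
  have hβ : T ^ (41 * ℓ) * (Fintype.card (Idx n) * (n + 1) + 2) ≤ T ^ (48 * ℓ) := by
    have e : Fintype.card (Idx n) * (n + 1) + 2 ≤ T ^ 7 := by
      have h1 : 2 ≤ T ^ 5 := hT2.trans (Nat.le_self_pow (by omega) T)
      have h2 : T ^ 5 * 2 ≤ T ^ 5 * T ^ 2 :=
        Nat.mul_le_mul_left _ (hT2.trans (Nat.le_self_pow (by omega) T))
      calc _ ≤ T ^ 5 * 2 := by omega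
        _ ≤ T ^ 5 * T ^ 2 := h2
        _ = T ^ 7 := by ring
    calc _ ≤ T ^ (41 * ℓ) * T ^ 7 := Nat.mul_le_mul_left _ e
      _ = T ^ (41 * ℓ + 7) := by ring
      _ ≤ T ^ (48 * ℓ) := Nat.pow_le_pow_right hT1 (by omega)
  have hW : (wordsLE (Fin n × Fin n) K).card ≤ T ^ (3 * K) := by
    rw [hT]
    exact (card_wordsLE_le n K hn).trans (card_word_le_pow hn hK)
  have hKK : K ≤ K ^ 2 := Nat.le_self_pow (by omega) K
  have hℓK : ℓ * K ≤ ℓ * K ^ 2 := Nat.mul_le_mul_left _ hKK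
  have hKℓ : K ≤ ℓ * K ^ 2 := hKK.trans (Nat.le_mul_of_pos_left _ hℓ1)
  have hZ : (wordsLE (Fin n × Fin n) K).card *
      ((T ^ (41 * ℓ)) ^ K * ((T ^ (48 * ℓ)) ^ K * (Fintype.card (Idx n) * (n + 1)))) +
      (T ^ (41 * ℓ)) ^ (K * K) * ((T ^ (48 * ℓ)) ^ K * n) ≤ T ^ (105 * (ℓ * K ^ 2)) := by
    have e1 : (wordsLE (Fin n × Fin n) K).card *
        ((T ^ (41 * ℓ)) ^ K * ((T ^ (48 * ℓ)) ^ K * (Fintype.card (Idx n) * (n + 1)))) ≤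
        T ^ (104 * (ℓ * K ^ 2)) := by
      calc _ ≤ T ^ (3 * K) * ((T ^ (41 * ℓ)) ^ K * ((T ^ (48 * ℓ)) ^ K * T ^ 5)) := by gcongr
        _ = T ^ (3 * K + 89 * (ℓ * K) + 5) := by
          rw [← pow_mul, ← pow_mul, ← pow_add, ← pow_add, ← pow_add]
          congr 1
          ring
        _ ≤ _ := Nat.pow_le_pow_right hT1 (by omega)
    have e2 : (T ^ (41 * ℓ)) ^ (K * K) * ((T ^ (48 * ℓ)) ^ K * n) ≤ T ^ (104 * (ℓ * K ^ 2)) := by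
      calc _ ≤ (T ^ (41 * ℓ)) ^ (K * K) * ((T ^ (48 * ℓ)) ^ K * T) := by
            gcongr
            omega
        _ = T ^ (41 * (ℓ * K ^ 2) + 48 * (ℓ * K) + 1) := by
          rw [← pow_mul, ← pow_mul, ← pow_succ, ← pow_add]
          congr 1
          ring
        _ ≤ _ := Nat.pow_le_pow_right hT1 (by omega)
    calc _ ≤ T ^ (104 * (ℓ * K ^ 2)) * 2 := by omega
      _ ≤ T ^ (104 * (ℓ * K ^ 2)) * T := Nat.mul_le_mul_left _ hT2
      _ = T ^ (104 * (ℓ * K ^ 2) + 1) := by ring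
      _ ≤ _ := Nat.pow_le_pow_right hT1 (by omega)
  choose B hB1 hB2 using exists_coefficients hn hℓ1 (Nat.pow_pos hT1) hL hS hβ hZ
  refine ⟨ℓ, L, fun α w u => baseVal n (B α w u), hℓ1, hℓ2, hL0, hT ▸ hL, fun α u => ?_,
    fun α w u hw => ?_, fun a hs ht F => ?_⟩
  · simp only [(hB1 α []).1 rfl u, map_zero]
  · refine ((hB1 α w).2.2.2 u).baseVal.mono ?_ ?_
    · exact (Nat.sub_le _ _).trans (Nat.mul_le_mul_left _ hw)
    · rw [← hT]
      calc (T ^ (105 * (ℓ * K ^ 2))) ^ w.length ≤ (T ^ (105 * (ℓ * K ^ 2))) ^ K :=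
            Nat.pow_le_pow_right (Nat.pow_pos hT1) hw
        _ = T ^ (105 * ℓ * K ^ 3) := by
          rw [← pow_mul]
          congr 1
          ring
  · filter_upwards [F.eventually_S hn hs ht K] with b hb
    refine ⟨hb.1, fun w v => ⟨(hb.2 w v).1, ?_, fun hLb α => ?_⟩⟩
    · rw [(hb.2 w v).2 b _ (flatData_euler K b _)]
      simp
    · rw [(hb.2 w v).2 _ _ (flatData_of_coefficients (fun u => (hB1 α []).1 rfl u)
        (fun w => (hB1 α w).2.1) (fun w => (hB1 α w).2.2.1) (hB2 α) (F.base b) hLb)]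
      simp only [evalPol_base]

/-- The weights of the variables `λ`, `p` for the degree in `p`. -/
def wp (n : ℕ) (o : Option (Idx n)) : ℕ := if o = none then 1 else 0

theorem wl_inl (o : Option (Idx n)) : wl n (Sum.inl o) = lamWeight n o := by
  cases o <;> simp [wl, lamWeight]

theorem ww_inl (o : Option (Idx n)) : ww n (Sum.inl o) = wp n o := by
  cases o <;> simp [ww, wp]

theorem Bd.rename_some {t N : ℕ} {P : MvPolynomial (Idx n) ℤ}
    (h : Bd (fun _ => 1) (fun _ => 0) t 0 N P) :
    Bd (lamWeight n) (wp n) t 0 N (rename some P) := by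
  have e : (rename some : MvPolynomial (Idx n) ℤ →ₐ[ℤ] MvPolynomial (Option (Idx n)) ℤ) =
      MvPolynomial.aeval fun α => MvPolynomial.X (some α) :=
    algHom_ext fun α => by simp
  rw [e]
  exact h.aeval fun α => Bd.X (ω := lamWeight n) (ω' := wp n) (some α)

/-- All entries are brought to the denominator `λ_00 L ^ expo K`. Multiplied by this denominator,
the vanishing of the derivative of `S` in the direction `b` expresses its `λ_00`-derivative by the
others, and so defines a numerator for `dλ_00` that makes the contraction with the Euler field zero
identically and not only on solutions. -/
theorem exists_connection {K : ℕ} (hn : 1 ≤ n) (hK : 1 ≤ K) :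
    ∃ (t : ℕ) (Den : MvPolynomial (Idx n) ℤ)
      (Num : Idx n → Word n K → Word n K → MvPolynomial (Option (Idx n)) ℤ),
      t ≤ 1690 * (n ^ 3 * K ^ 5) ∧ Den ≠ 0 ∧
      Bd (fun _ => 1) (fun _ => 0) (t + 1) 0 ((K * n + 1) ^ (253500 * (n ^ 3 * K ^ 6))) Den ∧
      (∀ α w u, Bd (lamWeight n) (wp n) t (9 * n * K)
        ((K * n + 1) ^ (253500 * (n ^ 3 * K ^ 6))) (Num α w u)) ∧
      (∀ w u, ∑ α, X (some α) * Num α w u = 0) ∧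
      ∀ a : Idx n → ℂ, SmoothCurve a → TransversalToAxis a → ∀ F : CycleFamily a,
        ∀ᶠ b in 𝓝 a, b ∈ F.U ∧ ∀ w v : Word n K, ContDiffAt ℂ 2 (fun b => F.S K b w v) b ∧
          (aeval b Den ≠ 0 → ∀ z, aeval b Den * fderiv ℂ (fun b => F.S K b w v) b z =
            ∑ α, z α * ∑ u : Word n K,
              aeval (optPt b (F.base b)) (Num α w u) * F.S K b u v) := by
  obtain ⟨ℓ, L, P, hℓ1, hℓ2, hL0, hL, hP0, hP, hF⟩ := exists_connection_coefficients hn hK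
  simp only [wl_inl, ww_inl] at hP
  obtain ⟨T, hT⟩ : ∃ T, T = K * n + 1 := ⟨_, rfl⟩
  rw [← hT] at hL hP ⊢
  have hT2 : 2 ≤ T := by
    rw [hT]
    have := Nat.mul_pos hK hn
    omega
  have hT1 : 1 ≤ T := by omega
  have hIT : Fintype.card (Idx n) ≤ T ^ 4 := by
    have : (n + 2) ^ 2 ≤ (T * T) ^ 2 := Nat.pow_le_pow_left (by nlinarith) 2
    calc _ ≤ (T * T) ^ 2 := card_idx_le.trans this
      _ = T ^ 4 := by ring
  have hKK : K * K ≤ K ^ 3 := by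
    rw [pow_succ, sq]
    exact Nat.le_mul_of_pos_right _ hK
  have hexp : ∀ j, j ≤ 150 * (ℓ * K ^ 3) → T ^ j ≤ T ^ (253500 * (n ^ 3 * K ^ 6)) := by
    intro j hj
    refine Nat.pow_le_pow_right hT1 (hj.trans ?_)
    calc 150 * (ℓ * K ^ 3) ≤ 150 * (1690 * (n * K) ^ 3 * K ^ 3) := by gcongr
      _ = 253500 * (n ^ 3 * K ^ 6) := by ring
  have hℓK : 1 ≤ ℓ * K ^ 3 := Nat.mul_pos hℓ1 (Nat.pow_pos hK)
  have hEK1 := one_le_expo hK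
  have hEK2 := expo_le K
  have hEℓ : 41 * ℓ * expo K ≤ 41 * (ℓ * K ^ 3) := by
    rw [mul_assoc]
    exact Nat.mul_le_mul_left _ (Nat.mul_le_mul_left _ (hEK2.trans hKK))
  -- the reduced numerators
  obtain ⟨N', hN'⟩ : ∃ N' : Idx n → Word n K → Word n K → MvPolynomial (Option (Idx n)) ℤ,
      ∀ α w u, N' α w u = rename some (L ^ (expo K - expo w.letters.length)) *
        P α w.letters u.letters := ⟨_, fun _ _ _ => rfl⟩
  have bN' : ∀ α w u, Bd (lamWeight n) (wp n) (expo K * ℓ - 1) (9 * n * K)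
      (T ^ (41 * ℓ * expo K) * T ^ (105 * ℓ * K ^ 3)) (N' α w u) := by
    intro α w u
    have hwK := length_letters_le w
    rw [hN']
    rcases Nat.eq_zero_or_pos w.letters.length with h0 | h0
    · rw [List.length_eq_zero_iff.1 h0, hP0, mul_zero]
      exact Bd.zero
    have hEw := one_le_expo h0
    have hEwK := expo_mono hwK
    have e := hL.pow (expo K - expo w.letters.length)
    rw [mul_zero] at e
    have := e.rename_some.mul (hP α w.letters u.letters hwK)
    have hEwℓ : 1 ≤ expo w.letters.length * ℓ := Nat.mul_pos hEw hℓ1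
    rw [zero_add, ← Nat.add_sub_assoc hEwℓ, ← add_mul, Nat.sub_add_cancel hEwK] at this
    refine this.mono le_rfl (Nat.mul_le_mul_right _ ?_)
    rw [← pow_mul]
    exact Nat.pow_le_pow_right hT1 (Nat.mul_le_mul_left _ (Nat.sub_le _ _))
  have hEKℓ : 1 ≤ expo K * ℓ := Nat.mul_pos hEK1 hℓ1
  have bX : ∀ α β w u, Bd (lamWeight n) (wp n) (expo K * ℓ) (9 * n * K)
      (T ^ (41 * ℓ * expo K) * T ^ (105 * ℓ * K ^ 3)) (X (some α) * N' β w u) := by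
    intro α β w u
    have := (Bd.X (ω := lamWeight n) (ω' := wp n) (some α)).mul (bN' β w u)
    have e1 : lamWeight n (some α) = 1 := by simp [lamWeight]
    have e2 : wp n (some α) = 0 := by simp [wp]
    rw [e1, e2, zero_add, one_mul, ← Nat.add_sub_assoc hEKℓ, Nat.add_sub_cancel_left] at this
    exact this
  -- The numerator at `idx00 n` is minus the Euler contraction of the other ones; those carry the
  -- factor `λ_00`, which cancels against the denominator.
  refine ⟨expo K * ℓ, X (idx00 n) * L ^ expo K, fun α w u => if α = idx00 n then
    -∑ β ∈ Finset.univ.erase (idx00 n), X (some β) * N' β w u else X (some (idx00 n)) * N' α w u,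
    ?_, ?_, ?_, fun α w u => ?_, fun w u => ?_, fun a hs ht F => ?_⟩
  · calc expo K * ℓ ≤ K * K * (1690 * (n * K) ^ 3) := Nat.mul_le_mul hEK2 hℓ2
      _ = _ := by ring
  · exact mul_ne_zero (X_ne_zero _) (pow_ne_zero _ hL0)
  · have := (Bd.X (ω := fun _ => 1) (ω' := fun _ => 0) (idx00 n)).mul (hL.pow (expo K))
    rw [mul_zero, zero_add, one_mul, add_comm, ← pow_mul] at this
    exact this.mono le_rfl (hexp _ (by omega))
  · beta_reduce
    split_ifs with hα
    · refine ((Bd.sum_const _ fun β _ => bX β β w u).neg).mono le_rfl ?_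
      calc _ ≤ T ^ 4 * (T ^ (41 * ℓ * expo K) * T ^ (105 * ℓ * K ^ 3)) := by
            refine Nat.mul_le_mul_right _ ((Finset.card_le_univ _).trans hIT)
        _ = T ^ (4 + (41 * ℓ * expo K + 105 * ℓ * K ^ 3)) := by rw [← pow_add, ← pow_add]
        _ ≤ _ := hexp _ (by rw [mul_assoc 105]; omega)
    · refine (bX _ _ w u).mono le_rfl ?_
      rw [← pow_add]
      exact hexp _ (by rw [mul_assoc 105]; omega)
  · beta_reduce
    rw [← Finset.add_sum_erase _ _ (Finset.mem_univ (idx00 n)), if_pos rfl, mul_neg, Finset.mul_sum,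
      neg_add_eq_zero]
    refine Finset.sum_congr rfl fun β hβ => ?_
    rw [if_neg (Finset.ne_of_mem_erase hβ)]
    ring
  · filter_upwards [hF a hs ht F] with b hb
    refine ⟨hb.1, fun w v => ⟨(hb.2 w v).1, fun hD z => ?_⟩⟩
    obtain ⟨-, hEul, hder⟩ := hb.2 w v
    rw [map_mul, map_pow, aeval_X] at hD
    have hb0 : b (idx00 n) ≠ 0 := left_ne_zero_of_mul hD
    have hLb : aeval b L ≠ 0 := by
      intro h0
      rw [h0, zero_pow (by omega), mul_zero] at hD
      exact hD rfl
    have hder' := hder hLb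
    set D := fderiv ℂ (fun b => F.S K b w v) b with hDdef
    have hexpand : ∀ z : Idx n → ℂ, D z = ∑ α, z α * D (Pi.single α 1) := by
      intro z
      conv_lhs => rw [pi_eq_sum_univ' z, map_sum]
      refine Finset.sum_congr rfl fun α _ => ?_
      rw [map_smul, smul_eq_mul]
    set R : Idx n → ℂ := fun α => ∑ u : Word n K,
      aeval (optPt b (F.base b)) (N' α w u) * F.S K b u v with hR
    have hDR : ∀ α, aeval b L ^ expo K * D (Pi.single α 1) = R α := by
      intro α
      rw [hder' α, Finset.mul_sum]
      refine Finset.sum_congr rfl fun u _ => ?_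
      have e : aeval b L ^ expo K = aeval b L ^ (expo K - expo w.letters.length) *
          aeval b L ^ expo w.letters.length := by
        rw [← pow_add, Nat.sub_add_cancel (expo_mono (length_letters_le w))]
      have h1 : aeval b L ^ expo w.letters.length ≠ 0 := pow_ne_zero _ hLb
      have e2 : aeval (optPt b (F.base b)) (rename some (L ^ (expo K - expo w.letters.length)) :
          MvPolynomial (Option (Idx n)) ℤ) = aeval b L ^ (expo K - expo w.letters.length) := by
        rw [aeval_rename, map_pow]
        rfl
      rw [hN', map_mul, e2, e]
      field_simp
    have hNum : ∀ α, ∑ u : Word n K, aeval (optPt b (F.base b)) (if α = idx00 n then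
        -∑ β ∈ Finset.univ.erase (idx00 n), X (some β) * N' β w u else
          X (some (idx00 n)) * N' α w u) * F.S K b u v =
        if α = idx00 n then -∑ β ∈ Finset.univ.erase (idx00 n), b β * R β else
          b (idx00 n) * R α := by
      intro α
      split_ifs
      · simp only [hR, map_neg, map_sum, map_mul, aeval_X, neg_mul, Finset.sum_neg_distrib,
          Finset.sum_mul, Finset.mul_sum]
        rw [Finset.sum_comm]
        simp only [optPt, Option.elim_some, mul_assoc]
      · simp only [hR, map_mul, aeval_X, Finset.mul_sum, optPt, Option.elim_some, mul_assoc]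
    simp only [hNum]
    rw [hexpand] at hEul
    rw [hexpand, Finset.mul_sum]
    refine Finset.sum_congr rfl fun α _ => ?_
    rw [map_mul, map_pow, aeval_X]
    split_ifs with hα
    · rw [← Finset.add_sum_erase _ _ (Finset.mem_univ (idx00 n))] at hEul
      have e : ∑ β ∈ Finset.univ.erase (idx00 n), b β * R β = aeval b L ^ expo K *
          ∑ β ∈ Finset.univ.erase (idx00 n), b β * D (Pi.single β 1) := by
        rw [Finset.mul_sum]
        refine Finset.sum_congr rfl fun β _ => ?_
        rw [← hDR]
        ring
      rw [e, hα]
      linear_combination z (idx00 n) * aeval b L ^ expo K * hEul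
    · rw [← hDR]
      ring

end

end

section

/-! ## Forms with a common denominator -/

open MvPolynomial

section
variable {n K : ℕ}

/-- The inclusion of `ℤ[λ, p]` in `ℚ(λ)[p]`. -/
def polyHom (n : ℕ) : MvPolynomial (Option (Idx n)) ℤ →+* Polynomial (QRat (Idx n)) :=
  (Polynomial.mapRingHom (algebraMap (MvPolynomial (Idx n) ℤ) (QRat (Idx n)))).comp
    (optionEquivLeft ℤ (Idx n) : MvPolynomial (Option (Idx n)) ℤ →+* _)

theorem polyHom_X_some (α : Idx n) : polyHom n (X (some α)) =
    Polynomial.C (algebraMap (MvPolynomial (Idx n) ℤ) (QRat (Idx n)) (X α)) := by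
  simp [polyHom, optionEquivLeft_X_some]

theorem polyHom_X_none : polyHom n (X none) = Polynomial.X := by
  simp [polyHom, optionEquivLeft_X_none]

theorem coeff_polyHom (P : MvPolynomial (Option (Idx n)) ℤ) (k : ℕ) :
    (polyHom n P).coeff k = algebraMap (MvPolynomial (Idx n) ℤ) (QRat (Idx n))
      ((optionEquivLeft ℤ (Idx n) P).coeff k) := by
  simp [polyHom]

theorem toRat_polyHom (P : MvPolynomial (Option (Idx n)) ℤ) :
    toRat n (polyHom n P) = algebraMap _ (QRat (Option (Idx n))) P := by
  have : (toRat n).comp (polyHom n) =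
      algebraMap (MvPolynomial (Option (Idx n)) ℤ) (QRat (Option (Idx n))) := by
    apply ringHom_ext
    · intro r
      simp
    · rintro (_ | α)
      · rw [RingHom.comp_apply, polyHom_X_none, toRat, Polynomial.coe_eval₂RingHom,
          Polynomial.eval₂_X]
      · rw [RingHom.comp_apply, polyHom_X_some, toRat, Polynomial.coe_eval₂RingHom,
          Polynomial.eval₂_C, inclRat, IsFractionRing.map, IsLocalization.map_eq]
        simp
  rw [← this, RingHom.comp_apply]

/-- Substitution of `ev` for `λ` and of `y` for `p`. -/
def evSub (n : ℕ) : MvPolynomial (Option (Idx n)) ℤ →ₐ[ℤ] MvPolynomial (BIdx n) ℤ :=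
  aeval fun o => o.elim (X none) evPoly

theorem evCoeff_polyHom (P : MvPolynomial (Option (Idx n)) ℤ) :
    evCoeff n (polyHom n P) = algebraMap _ (QRat (BIdx n)) (evSub n P) := by
  have : (evCoeff n).comp (polyHom n) =
      (algebraMap (MvPolynomial (BIdx n) ℤ) (QRat (BIdx n))).comp (evSub n).toRingHom := by
    apply ringHom_ext
    · intro r
      simp
    · rintro (_ | α)
      · rw [RingHom.comp_apply, polyHom_X_none, evCoeff, Polynomial.coe_eval₂RingHom,
          Polynomial.eval₂_X]
        simp [evSub]
      · rw [RingHom.comp_apply, polyHom_X_some, evCoeff, Polynomial.coe_eval₂RingHom,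
          Polynomial.eval₂_C, evRat, IsFractionRing.map, IsLocalization.map_eq]
        simp [evSub, evHom]
  have h := congrArg (fun f => f P) this
  exact h

/-- The matrix form `Num / Den`. -/
def quotForm (Den : MvPolynomial (Idx n) ℤ)
    (Num : Idx n → Word n K → Word n K → MvPolynomial (Option (Idx n)) ℤ) : MatForm n K :=
  fun α => Matrix.of fun w u =>
    Polynomial.C (algebraMap (MvPolynomial (Idx n) ℤ) (QRat (Idx n)) Den)⁻¹ * polyHom n (Num α w u)

variable {Den : MvPolynomial (Idx n) ℤ}
  {Num : Idx n → Word n K → Word n K → MvPolynomial (Option (Idx n)) ℤ}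

theorem isQuot_toRat_quotForm (hD : Den ≠ 0) (α : Idx n) (w u : Word n K) :
    IsQuot (toRat n (quotForm Den Num α w u)) (Num α w u) (rename some Den) := by
  refine ⟨fun h => hD (rename_injective _ (Option.some_injective _) (by rw [h, map_zero])), ?_⟩
  rw [quotForm, Matrix.of_apply, map_mul, toRat_polyHom, toRat, Polynomial.coe_eval₂RingHom,
    Polynomial.eval₂_C, map_inv₀, inclRat, IsFractionRing.map, IsLocalization.map_eq]
  rw [div_eq_inv_mul]
  rfl

theorem isQuot_coeff_quotForm (hD : Den ≠ 0) (α : Idx n) (w u : Word n K) (k : ℕ) :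
    IsQuot ((quotForm Den Num α w u).coeff k) ((optionEquivLeft ℤ (Idx n) (Num α w u)).coeff k)
      Den := by
  refine ⟨hD, ?_⟩
  rw [quotForm, Matrix.of_apply, Polynomial.coeff_C_mul, coeff_polyHom, div_eq_inv_mul]

/-- The numerators of the pull-back. -/
def pullNum (Num : Idx n → Word n K → Word n K → MvPolynomial (Option (Idx n)) ℤ) (β : BIdx n)
    (w u : Word n K) : MvPolynomial (BIdx n) ℤ :=
  ∑ α, evSub n (Num α w u) * pderiv β (evPoly α)

theorem isQuot_pullback_quotForm (hD : Den ≠ 0) (β : BIdx n) (w u : Word n K) :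
    IsQuot ((quotForm Den Num).pullback β w u) (pullNum Num β w u) (evHom n Den) := by
  refine ⟨fun h => hD (evHom_injective n (by rw [h, map_zero])), ?_⟩
  rw [MatForm.pullback, Matrix.of_apply, pullNum, map_sum, Finset.sum_div]
  refine Finset.sum_congr rfl fun α _ => ?_
  rw [quotForm, Matrix.of_apply, map_mul, evCoeff_polyHom, evCoeff, Polynomial.coe_eval₂RingHom,
    Polynomial.eval₂_C, map_inv₀, evRat, IsFractionRing.map, IsLocalization.map_eq, map_mul,
    div_eq_inv_mul, ← mul_assoc]
  rfl

/-- For each power of `p`, the numerator is a form of degree `t` in `λ` and the denominator one of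
degree `t + 1`. -/
theorem quotForm_isProjective {t d N N' : ℕ} (hD : Den ≠ 0)
    (hDen : Bd (fun _ => 1) (fun _ => 0) (t + 1) 0 N Den)
    (hNum : ∀ α w u, Bd (lamWeight n) (wp n) t d N' (Num α w u))
    (h0 : ∀ w u, ∑ α, X (some α) * Num α w u = 0) : (quotForm Den Num).IsProjective := by
  refine ⟨fun α w u k => ⟨t, _, _, isQuot_coeff_quotForm hD α w u k, ?_, ?_⟩, fun w u => ?_⟩
  · intro m hm
    rw [optionEquivLeft_coeff_coeff] at hm
    have := (hNum α w u).hom _ hm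
    rw [Finsupp.weight_eq_sum, Fintype.sum_option] at this
    rw [Finsupp.weight_eq_sum, ← this]
    simp [lamWeight]
  · intro m hm
    exact hDen.hom m hm
  · have := congrArg (polyHom n) (h0 w u)
    rw [map_sum, map_zero] at this
    simp only [quotForm, Matrix.of_apply, mul_left_comm _ (Polynomial.C _⁻¹)]
    rw [← Finset.mul_sum]
    simp only [map_mul, polyHom_X_some] at this
    rw [this, mul_zero]

theorem natDegree_quotForm_le {t d N : ℕ} (hNum : ∀ α w u, Bd (lamWeight n) (wp n) t d N (Num α w u))
    (α : Idx n) (w u : Word n K) : (quotForm Den Num α w u).natDegree ≤ d := by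
  rw [quotForm, Matrix.of_apply]
  refine (Polynomial.natDegree_C_mul_le _ _).trans ?_
  rw [Polynomial.natDegree_le_iff_coeff_eq_zero]
  intro k hk
  rw [coeff_polyHom]
  have : (optionEquivLeft ℤ (Idx n) (Num α w u)).coeff k = 0 := by
    ext m
    by_contra h1
    rw [optionEquivLeft_coeff_coeff, coeff_zero] at h1
    have h2 := (hNum α w u).deg _ h1
    rw [Finsupp.weight_eq_sum, Fintype.sum_option] at h2
    simp [wp] at h2
    omega
  rw [this, map_zero]

theorem Bd.weightedTotalDegree_le {τ : Type} {ω ω' : τ → ℕ} {t d N : ℕ} {P : MvPolynomial τ ℤ}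
    (h : Bd ω ω' t d N P) : weightedTotalDegree ω' P ≤ d :=
  Finset.sup_le fun m hm => h.deg m (mem_support_iff.1 hm)

theorem Bd.weightedTotalDegree_le' {τ : Type} {ω ω' : τ → ℕ} {t d N : ℕ} {P : MvPolynomial τ ℤ}
    (h : Bd ω ω' t d N P) : weightedTotalDegree ω P ≤ t :=
  Finset.sup_le fun m hm => (h.hom m (mem_support_iff.1 hm)).le

theorem ratWDegree_le {τ : Type} {r : QRat τ} {P Q : MvPolynomial τ ℤ} (h : IsQuot r P Q)
    (ω : τ → ℕ) : ratWDegree ω r ≤ weightedTotalDegree ω P + weightedTotalDegree ω Q :=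
  Nat.sInf_le ⟨P, Q, h, rfl⟩

theorem ratSize_le {τ : Type} {r : QRat τ} {P Q : MvPolynomial τ ℤ} (h : IsQuot r P Q) :
    ratSize r ≤ polyNorm P + polyNorm Q :=
  Nat.sInf_le ⟨P, Q, h, rfl⟩

theorem lamDegree_quotForm_le {t d N N' : ℕ} (hD : Den ≠ 0)
    (hDen : Bd (fun _ => 1) (fun _ => 0) (t + 1) 0 N Den)
    (hNum : ∀ α w u, Bd (lamWeight n) (wp n) t d N' (Num α w u))
    (α : Idx n) (w u : Word n K) : lamDegree (quotForm Den Num α w u) ≤ 2 * t + 1 := by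
  refine (ratWDegree_le (isQuot_toRat_quotForm hD α w u) _).trans ?_
  have h1 := (hNum α w u).weightedTotalDegree_le'
  have h2 := hDen.rename_some.weightedTotalDegree_le'
  omega

theorem ratSize_quotForm_le {t d N N' : ℕ} (hD : Den ≠ 0)
    (hDen : Bd (fun _ => 1) (fun _ => 0) (t + 1) 0 N Den)
    (hNum : ∀ α w u, Bd (lamWeight n) (wp n) t d N' (Num α w u))
    (α : Idx n) (w u : Word n K) : ratSize (toRat n (quotForm Den Num α w u)) ≤ N' + N :=
  (ratSize_le (isQuot_toRat_quotForm hD α w u)).trans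
    (Nat.add_le_add (hNum α w u).norm hDen.rename_some.norm)

/-! ## Values -/

theorem ratVal_zero {σ : Type} (z : σ → ℂ) : ratVal (0 : QRat σ) z = 0 := by
  have h : IsQuot (0 : QRat σ) 0 1 := ⟨one_ne_zero, by simp⟩
  rw [ratVal_eq h (by simp)]
  simp

theorem continuousAt_ratVal {σ : Type} [Finite σ] {r : QRat σ} {z : σ → ℂ} (h : RegularAt r z) :
    ContinuousAt (ratVal r) z := by
  obtain ⟨P, Q, hPQ, hQ⟩ := h
  have cont : ∀ P : MvPolynomial σ ℤ, Continuous fun z : σ → ℂ => aeval z P := by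
    intro P
    have : (fun z : σ → ℂ => aeval z P) = fun z => eval z (map (algebraMap ℤ ℂ) P) := by
      funext z
      rw [eval_map, aeval_def]
    rw [this]
    exact continuous_eval _
  have h1 : (fun z => aeval z P / aeval z Q : (σ → ℂ) → ℂ) =ᶠ[𝓝 z] ratVal r := by
    filter_upwards [(cont Q).continuousAt.eventually_ne hQ] with z' hz'
    exact (ratVal_eq hPQ hz').symm
  exact ((cont P).continuousAt.div (cont Q).continuousAt hQ).congr h1

/-- A polynomial that vanishes on a polydisc is zero, since the discs are infinite sets. -/
theorem frequently_aeval_ne_zero {σ : Type} [Fintype σ] {P : MvPolynomial σ ℤ} (hP : P ≠ 0)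
    (z : σ → ℂ) : ∃ᶠ z' in 𝓝 z, aeval z' P ≠ 0 := by
  intro h
  simp only [not_not] at h
  obtain ⟨ε, hε, hb⟩ := Metric.eventually_nhds_iff_ball.1 h
  rw [ball_pi z hε] at hb
  apply hP
  apply map_injective (Int.castRingHom ℂ) Int.cast_injective
  refine funext_set (fun i => Metric.ball (z i) ε) (fun i => ?_) fun x hx => ?_
  · exact infinite_of_mem_nhds (z i) (Metric.ball_mem_nhds _ hε)
  · have := hb x hx
    rw [aeval_def] at this
    rw [map_zero, map_zero, eval_map]
    exact this

theorem polyVal_eq_sum {f : Polynomial (QRat (Idx n))} {d : ℕ} (hf : f.natDegree ≤ d)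
    (b : Idx n → ℂ) (p : ℂ) : polyVal f b p = ∑ k ∈ Finset.range (d + 1), ratVal (f.coeff k) b * p ^ k :=
  Polynomial.sum_over_range' _ (fun k => by rw [ratVal_zero, zero_mul]) _ (Nat.lt_succ_of_le hf)

theorem continuousAt_polyVal {f : Polynomial (QRat (Idx n))} {b : Idx n → ℂ}
    (hb : ∀ k, RegularAt (f.coeff k) b) {p : (Idx n → ℂ) → ℂ} (hp : ContinuousAt p b) :
    ContinuousAt (fun b => polyVal f b (p b)) b := by
  simp only [polyVal_eq_sum (le_refl f.natDegree)]
  apply tendsto_finsetSum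
  intro k _
  exact (continuousAt_ratVal (hb k)).mul (hp.pow k)

theorem aeval_optPt (b : Idx n → ℂ) (p : ℂ) (P : MvPolynomial (Option (Idx n)) ℤ) :
    aeval (optPt b p) P = (optionEquivLeft ℤ (Idx n) P).eval₂ (aeval b : _ →ₐ[ℤ] ℂ).toRingHom p := by
  have : (aeval (optPt b p) : _ →ₐ[ℤ] ℂ).toRingHom =
      (Polynomial.eval₂RingHom (aeval b : _ →ₐ[ℤ] ℂ).toRingHom p).comp
        (optionEquivLeft ℤ (Idx n) : MvPolynomial (Option (Idx n)) ℤ →+* _) := by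
    apply ringHom_ext
    · intro r
      simp
    · rintro (_ | α)
      · simp [optPt, optionEquivLeft_X_none]
      · simp [optPt, optionEquivLeft_X_some]
  exact congrArg (fun f => f P) this

theorem polyVal_quotForm {b : Idx n → ℂ} (hb : aeval b Den ≠ 0) (p : ℂ) (α : Idx n)
    (w u : Word n K) : polyVal (quotForm Den Num α w u) b p =
      aeval (optPt b p) (Num α w u) / aeval b Den := by
  have hD : Den ≠ 0 := by
    rintro rfl
    exact hb (map_zero _)
  have hdeg : (quotForm Den Num α w u).natDegree ≤
      (optionEquivLeft ℤ (Idx n) (Num α w u)).natDegree := by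
    rw [quotForm, Matrix.of_apply]
    refine (Polynomial.natDegree_C_mul_le _ _).trans ?_
    exact Polynomial.natDegree_map_le
  rw [polyVal_eq_sum hdeg, aeval_optPt, Polynomial.eval₂_eq_sum_range, Finset.sum_div]
  refine Finset.sum_congr rfl fun k _ => ?_
  rw [ratVal_eq (isQuot_coeff_quotForm hD α w u k) hb, div_mul_eq_mul_div]
  rfl

theorem ratVal_pullback_quotForm {z : BIdx n → ℂ} (hz : aeval (ev z) Den ≠ 0) (β : BIdx n)
    (w u : Word n K) : ratVal ((quotForm Den Num).pullback β w u) z =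
      (∑ α, aeval (optPt (ev z) (z none)) (Num α w u) * aeval z (pderiv β (evPoly α))) /
        aeval (ev z) Den := by
  have hD : Den ≠ 0 := by
    rintro rfl
    exact hz (map_zero _)
  have e1 : ∀ P, aeval z (evHom n P) = aeval (ev z) P := by
    intro P
    rw [evHom, ← AlgHom.comp_apply, comp_aeval]
    rfl
  have e2 : ∀ P, aeval z (evSub n P) = aeval (optPt (ev z) (z none)) P := by
    intro P
    rw [evSub, ← AlgHom.comp_apply, comp_aeval]
    congr 2
    funext o
    cases o
    · simp [optPt]
    · rfl
  rw [ratVal_eq (isQuot_pullback_quotForm hD β w u) (by rwa [e1]), e1, pullNum, map_sum]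
  simp only [map_mul, e2]

end

end

section

/-! ## The Picard–Fuchs system -/

open MvPolynomial

/-- The differential equation is derived where the common denominator is nonzero but is claimed
wherever the coefficients have no pole. Continuity of both sides and density of the good points
bridge the gap. -/
theorem eq_of_frequently_eq {X : Type} [TopologicalSpace X] {f g : X → ℂ} {x : X}
    (hf : ContinuousAt f x) (hg : ContinuousAt g x) (h : ∃ᶠ y in 𝓝 x, f y = g y) : f x = g x := by
  by_contra hne
  have := (hf.sub hg).eventually_ne (sub_ne_zero.2 hne)
  exact h (this.mono fun y hy e => hy (sub_eq_zero.2 e))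

theorem hasFDerivAt_aeval {σ : Type} [Fintype σ] (z : σ → ℂ) (P : MvPolynomial σ ℤ) :
    HasFDerivAt (fun z : σ → ℂ => aeval z P)
      (∑ β, (aeval z (pderiv β P) : ℂ) • (ContinuousLinearMap.proj β : (σ → ℂ) →L[ℂ] ℂ)) z := by
  classical
  induction P using MvPolynomial.induction_on with
  | C a =>
    have : (fun z : σ → ℂ => (aeval z (C a : MvPolynomial σ ℤ) : ℂ)) = fun _ => (a : ℂ) := by
      funext z
      simp
    rw [this]
    exact (hasFDerivAt_const _ _).congr_fderiv (by ext; simp)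
  | add P Q hP hQ =>
    simp only [map_add]
    refine (hP.add hQ).congr_fderiv ?_
    rw [← Finset.sum_add_distrib]
    exact Finset.sum_congr rfl fun β _ => (add_smul _ _ _).symm
  | mul_X P i hP =>
    have hX : HasFDerivAt (fun z : σ → ℂ => (aeval z (X i : MvPolynomial σ ℤ) : ℂ))
        (ContinuousLinearMap.proj i : (σ → ℂ) →L[ℂ] ℂ) z := by
      simp only [aeval_X]
      exact (ContinuousLinearMap.proj i : (σ → ℂ) →L[ℂ] ℂ).hasFDerivAt
    simp only [map_mul]
    refine (hP.mul hX).congr_fderiv ?_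
    ext ζ
    simp only [add_apply, smul_apply, smul_eq_mul,
      sum_apply, ContinuousLinearMap.proj_apply, Derivation.leibniz, map_add,
      map_mul, pderiv_X, aeval_X, Finset.mul_sum, add_mul, Finset.sum_add_distrib]
    congr 1
    · rw [Finset.sum_eq_single i]
      · simp
      · intro β _ hβ
        simp [Pi.single_eq_of_ne hβ.symm]
      · simp
    · exact Finset.sum_congr rfl fun β _ => by ring

section
variable {n K : ℕ} {a : Idx n → ℂ} {Den : MvPolynomial (Idx n) ℤ}
  {Num : Idx n → Word n K → Word n K → MvPolynomial (Option (Idx n)) ℤ}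

theorem solvesNear_quotForm (hn : 1 ≤ n) (hD : Den ≠ 0) (F : CycleFamily a)
    (h : ∀ᶠ b in 𝓝 a, b ∈ F.U ∧ ∀ w v : Word n K, ContDiffAt ℂ 2 (fun b => F.S K b w v) b ∧
      (aeval b Den ≠ 0 → ∀ z, aeval b Den * fderiv ℂ (fun b => F.S K b w v) b z =
        ∑ α, z α * ∑ u : Word n K, aeval (optPt b (F.base b)) (Num α w u) * F.S K b u v)) :
    SolvesNear (quotForm Den Num) F.base (F.S K) a := by
  filter_upwards [eventually_eventually_nhds.2 h] with b hb w v
  have hb0 := hb.self_of_nhds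
  have hS : ∀ u v, ContinuousAt (fun b => F.S K b u v) b := fun u v =>
    (hb0.2 u v).1.continuousAt
  have hd : DifferentiableAt ℂ (fun b' => F.S K b' w v) b :=
    (hb0.2 w v).1.differentiableAt (by norm_num)
  refine ⟨hd, fun hreg => ?_⟩
  have hbase : ContinuousAt F.base b :=
    (F.continuousOn_base hn).continuousAt (F.isOpen_U.mem_nhds hb0.1)
  refine hd.hasFDerivAt.congr_fderiv ?_
  ext z
  have h1 : ContinuousAt (fun b => fderiv ℂ (fun b => F.S K b w v) b z) b :=
    (((hb0.2 w v).1.fderiv_right (m := 1) (by norm_num)).continuousAt).clm_apply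
      continuousAt_const
  have h2 : ContinuousAt (fun b => ∑ α, (∑ u, polyVal (quotForm Den Num α w u) b (F.base b) *
      F.S K b u v) * z α) b := by
    refine tendsto_finsetSum _ fun α _ => Filter.Tendsto.mul (tendsto_finsetSum _ fun u _ => ?_)
      tendsto_const_nhds
    exact (continuousAt_polyVal (hreg α w u) hbase).mul (hS u v)
  have h3 := eq_of_frequently_eq h1 h2 (by
    refine ((frequently_aeval_ne_zero hD b).and_eventually hb).mono ?_
    rintro b' ⟨hb'1, hb'2⟩
    have e := (hb'2.2 w v).2 hb'1 z
    simp only [polyVal_quotForm hb'1, div_mul_eq_mul_div, ← Finset.sum_div]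
    rw [eq_div_iff hb'1, mul_comm, e]
    exact Finset.sum_congr rfl fun α _ => mul_comm _ _)
  rw [h3]
  simp

/-! ## The system on the lifted space -/

theorem ev_of_ne (z : BIdx n → ℂ) (α : {α : Idx n // α ≠ idx00 n}) : ev z α.1 = z (some α) := by
  rw [ev, evPoly, dif_neg α.2, aeval_X]

theorem hamFn_zero_left (b : Idx n → ℂ) (y : ℂ) : hamFn n (b, ((0 : ℂ), y)) = b (idx00 n) +
    ∑ γ : {γ : Idx n // γ ≠ idx00 n}, if (γ.1.1.1 : ℕ) = 0 then b γ.1 * y ^ (γ.1.1.2 : ℕ)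
      else 0 := by
  rw [hamFn, Fintype.sum_eq_add_sum_subtype_ne _ (idx00 n)]
  congr 1
  · simp [idx00]
  · refine Finset.sum_congr rfl fun γ _ => ?_
    by_cases h : (γ.1.1.1 : ℕ) = 0
    · simp [h]
    · simp [h]

theorem hamFn_ev (z : BIdx n → ℂ) : hamFn n (ev z, ((0 : ℂ), z none)) = 0 := by
  rw [hamFn_zero_left]
  simp only [ev_of_ne]
  rw [ev, evPoly, dif_pos rfl, map_neg, map_sum, neg_add_eq_zero]
  refine Finset.sum_congr rfl fun γ _ => ?_
  split_ifs <;> simp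

theorem ev_liftPoint {p : ℂ} (h : hamFn n (a, ((0 : ℂ), p)) = 0) : ev (liftPoint a p) = a := by
  have h1 : ∀ α : {α : Idx n // α ≠ idx00 n}, ev (liftPoint a p) α.1 = a α.1 := fun α =>
    ev_of_ne _ α
  have h2 : hamFn n (ev (liftPoint a p), ((0 : ℂ), p)) = hamFn n (a, ((0 : ℂ), p)) :=
    (hamFn_ev (liftPoint a p)).trans h.symm
  rw [hamFn_zero_left, hamFn_zero_left] at h2
  simp only [h1] at h2
  funext α
  by_cases hα : α = idx00 n
  · rw [hα]
    exact add_right_cancel h2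
  · exact h1 ⟨α, hα⟩

/-- Strict differentiability: between two roots over the same `b'` the increment of the Hamiltonian
is zero and differs from `H_y (y₁ - y₂)` by at most half of `|H_y| |y₁ - y₂|`. -/
theorem eventually_simple_root {b : Idx n → ℂ} {y : ℂ}
    (hY : hamFnY n (b, ((0 : ℂ), y)) ≠ 0) :
    ∀ᶠ e : ((Idx n → ℂ) × (ℂ × ℂ)) × ((Idx n → ℂ) × (ℂ × ℂ)) in
      𝓝 ((b, ((0 : ℂ), y)), (b, ((0 : ℂ), y))), ∀ b' y₁ y₂, e = ((b', (0, y₁)), (b', (0, y₂))) →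
      hamFn n (b', ((0 : ℂ), y₁)) = 0 → hamFn n (b', ((0 : ℂ), y₂)) = 0 → y₁ = y₂ := by
  have hst := ((contDiff_hamFn n).contDiffAt (x := (b, ((0 : ℂ), y)))).hasStrictFDerivAt
    (by norm_num)
  have hpos : 0 < ‖hamFnY n (b, ((0 : ℂ), y))‖ / 2 := by positivity
  filter_upwards [hst.isLittleO.def hpos] with e he b' y₁ y₂ hb' h1 h2
  rw [hb'] at he
  have e1 : ((b', ((0 : ℂ), y₁)) - (b', ((0 : ℂ), y₂)) : (Idx n → ℂ) × (ℂ × ℂ)) =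
      (0, (0, y₁ - y₂)) := by
    simp
  simp only [e1, h1, h2, sub_zero, zero_sub, norm_neg] at he
  rw [fderiv_hamFn_zero_left] at he
  simp only [mul_zero, zero_add, norm_mul, Prod.norm_mk, norm_zero] at he
  rw [max_eq_right (norm_nonneg _), max_eq_right (norm_nonneg _)] at he
  have h3 : ‖y₁ - y₂‖ ≤ 0 := by
    by_contra h4
    push Not at h4
    nlinarith
  exact sub_eq_zero.1 (norm_le_zero_iff.1 h3)

theorem continuous_ev : Continuous (ev : (BIdx n → ℂ) → _) :=
  continuous_pi fun α => continuous_iff_continuousAt.2 fun z =>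
    (hasFDerivAt_aeval z (evPoly α)).continuousAt

/-- Both sides are roots of the restriction of `ev z` to `x = 0`, and near the lifted point both are
close to the simple root `F.base a`. -/
theorem eventually_base_ev (hn : 1 ≤ n) (ht : TransversalToAxis a) (F : CycleFamily a) :
    ∀ᶠ z in 𝓝 (liftPoint a (F.base a)), F.base (ev z) = z none := by
  have hmem : ∀ b ∈ F.U, hamFn n (b, ((0 : ℂ), F.base b)) = 0 := by
    intro b hb
    rw [← evalAt_ham]
    exact F.base_mem b hb
  have hY : hamFnY n (a, ((0 : ℂ), F.base a)) ≠ 0 := by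
    rw [← evalAt_pderiv_one_ham]
    exact ht _ (F.base_mem a F.mem_U)
  have hev := ev_liftPoint (hmem a F.mem_U)
  have hc : ContinuousAt (ev : (BIdx n → ℂ) → _) (liftPoint a (F.base a)) :=
    continuous_ev.continuousAt
  have hb : ContinuousAt (fun z : BIdx n → ℂ => F.base (ev z)) (liftPoint a (F.base a)) := by
    refine ContinuousAt.comp (g := F.base) ?_ hc
    rw [hev]
    exact (F.continuousOn_base hn).continuousAt (F.isOpen_U.mem_nhds F.mem_U)
  have hnone : ContinuousAt (fun z : BIdx n → ℂ => z none) (liftPoint a (F.base a)) :=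
    (continuous_apply none).continuousAt
  have hpair : ContinuousAt (fun z : BIdx n → ℂ =>
      ((ev z, ((0 : ℂ), F.base (ev z))), (ev z, ((0 : ℂ), z none)))) (liftPoint a (F.base a)) :=
    (hc.prodMk (continuousAt_const.prodMk hb)).prodMk (hc.prodMk (continuousAt_const.prodMk hnone))
  have h1 : ∀ᶠ z in 𝓝 (liftPoint a (F.base a)), ev z ∈ F.U := by
    apply hc.eventually_mem
    rw [hev]
    exact F.isOpen_U.mem_nhds F.mem_U
  have h2 := eventually_simple_root hY
  have hval : ((ev (liftPoint a (F.base a)), ((0 : ℂ), F.base (ev (liftPoint a (F.base a))))),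
      (ev (liftPoint a (F.base a)), ((0 : ℂ), liftPoint a (F.base a) none))) =
      ((a, ((0 : ℂ), F.base a)), (a, ((0 : ℂ), F.base a))) := by
    rw [hev]
    rfl
  rw [← hval] at h2
  filter_upwards [h1, hpair.eventually h2] with z hz1 hz2
  exact hz2 _ _ _ rfl (hmem _ hz1) (hamFn_ev z)

/-- The chain rule for `ev`. The identity `F.base (ev z) = z none` turns the values of the
coefficients at `p` into values at `y`, and the same density argument reaches all regular points. -/
theorem solvesNearB_quotForm (hn : 1 ≤ n) (hD : Den ≠ 0) (ht : TransversalToAxis a)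
    (F : CycleFamily a)
    (h : ∀ᶠ b in 𝓝 a, b ∈ F.U ∧ ∀ w v : Word n K, ContDiffAt ℂ 2 (fun b => F.S K b w v) b ∧
      (aeval b Den ≠ 0 → ∀ z, aeval b Den * fderiv ℂ (fun b => F.S K b w v) b z =
        ∑ α, z α * ∑ u : Word n K, aeval (optPt b (F.base b)) (Num α w u) * F.S K b u v)) :
    SolvesNearB (quotForm Den Num).pullback (fun z => F.S K (ev z))
      (liftPoint a (F.base a)) := by
  have hev : ev (liftPoint a (F.base a)) = a := by
    apply ev_liftPoint
    rw [← evalAt_ham]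
    exact F.base_mem a F.mem_U
  have hc : Filter.Tendsto (ev : (BIdx n → ℂ) → _) (𝓝 (liftPoint a (F.base a))) (𝓝 a) := by
    have := (continuous_ev (n := n)).tendsto (liftPoint a (F.base a))
    rwa [hev] at this
  have hD' : evHom n Den ≠ 0 := fun h0 => hD (evHom_injective n (by rw [h0, map_zero]))
  have hDv : ∀ z : BIdx n → ℂ, aeval z (evHom n Den) = aeval (ev z) Den := by
    intro z
    rw [evHom, ← AlgHom.comp_apply, comp_aeval]
    rfl
  have hder : ∀ z : BIdx n → ℂ, HasFDerivAt (ev : (BIdx n → ℂ) → _) (ContinuousLinearMap.pi fun α =>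
      ∑ β, (aeval z (pderiv β (evPoly α)) : ℂ) •
        (ContinuousLinearMap.proj β : (BIdx n → ℂ) →L[ℂ] ℂ)) z := fun z =>
    hasFDerivAt_pi.2 fun α => hasFDerivAt_aeval z (evPoly α)
  filter_upwards [eventually_eventually_nhds.2 ((hc.eventually h).and
    (eventually_base_ev hn ht F))] with z hz w v
  have hz0 := hz.self_of_nhds
  have hS : ∀ u v, ContinuousAt (fun z => F.S K (ev z) u v) z := fun u v =>
    ContinuousAt.comp (g := fun b => F.S K b u v) (hz0.1.2 u v).1.continuousAt
      continuous_ev.continuousAt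
  have hd : DifferentiableAt ℂ (fun b' => F.S K b' w v) (ev z) :=
    (hz0.1.2 w v).1.differentiableAt (by norm_num)
  have hcomp := hd.hasFDerivAt.comp z (hder z)
  refine ⟨hcomp.differentiableAt, fun hreg => hcomp.congr_fderiv ?_⟩
  ext ζ
  have hcp : ∀ P : MvPolynomial (BIdx n) ℤ, ContinuousAt (fun z : BIdx n → ℂ => (aeval z P : ℂ)) z :=
    fun P => (hasFDerivAt_aeval z P).continuousAt
  have h1 : ContinuousAt (fun z => fderiv ℂ (fun b => F.S K b w v) (ev z)
      (fun α => ∑ β, (aeval z (pderiv β (evPoly α)) : ℂ) * ζ β)) z := by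
    refine ContinuousAt.clm_apply ?_ ?_
    · exact ContinuousAt.comp (g := fderiv ℂ fun b => F.S K b w v)
        ((hz0.1.2 w v).1.fderiv_right (m := 1) (by norm_num)).continuousAt
        continuous_ev.continuousAt
    · refine continuousAt_pi.2 fun α => tendsto_finsetSum _ fun β _ => ?_
      exact (hcp _).mul continuousAt_const
  have h2 : ContinuousAt (fun z => ∑ β, (∑ u, ratVal ((quotForm Den Num).pullback β w u) z *
      F.S K (ev z) u v) * ζ β) z := by
    refine tendsto_finsetSum _ fun β _ => Filter.Tendsto.mul (tendsto_finsetSum _ fun u _ => ?_)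
      tendsto_const_nhds
    exact (continuousAt_ratVal (hreg β w u)).mul (hS u v)
  have h3 := eq_of_frequently_eq h1 h2 (by
    refine ((frequently_aeval_ne_zero hD' z).and_eventually hz).mono ?_
    rintro z' ⟨hz'1, hz'2, hz'3⟩
    rw [hDv] at hz'1
    have e := (hz'2.2 w v).2 hz'1 fun α => ∑ β, (aeval z' (pderiv β (evPoly α)) : ℂ) * ζ β
    rw [hz'3] at e
    simp only [ratVal_pullback_quotForm hz'1, div_mul_eq_mul_div, ← Finset.sum_div]
    rw [eq_div_iff hz'1, mul_comm, e]
    simp only [Finset.sum_mul]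
    rw [Finset.sum_comm]
    refine Finset.sum_congr rfl fun β _ => ?_
    rw [Finset.sum_comm]
    refine Finset.sum_congr rfl fun α _ => ?_
    rw [Finset.mul_sum]
    refine Finset.sum_congr rfl fun u _ => ?_
    ring)
  simp only [ContinuousLinearMap.comp_apply, sum_apply,
    smul_apply, ContinuousLinearMap.proj_apply, smul_eq_mul]
  rw [← h3]
  congr 1
  funext α
  simp

end

end

section

/-! ## Degrees and sizes of the lifted form -/

open MvPolynomial

/-- Upstairs only the total degree matters, so the first weight is set to zero and its homogeneity
condition is void. -/
theorem Bd.aeval_of_deg_le {σ τ : Type} {P : MvPolynomial σ ℤ} {D N e f : ℕ} (hP : polyNorm P ≤ N)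
    (hD : ∀ m, P.coeff m ≠ 0 → Finsupp.weight (fun _ => 1) m ≤ D) (hf : 1 ≤ f)
    {F : σ → MvPolynomial τ ℤ} (hF : ∀ i, Bd (fun _ => 0) (fun _ => 1) 0 e f (F i)) :
    Bd (fun _ => 0) (fun _ => 1) 0 (D * e) (N * f ^ D) (MvPolynomial.aeval F P) := by
  refine Bd.map (MvPolynomial.aeval F).toLinearMap hP fun m hm => ?_
  rw [AlgHom.toLinearMap_apply, aeval_monomial, map_one, one_mul]
  have := Bd.prod m.support fun i _ => (hF i).pow (m i)
  have e1 : ∑ i ∈ m.support, m i ≤ D := by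
    refine le_trans (le_of_eq ?_) (hD m hm)
    rw [Finsupp.weight_apply, Finsupp.sum]
    simp
  rw [Finset.prod_pow_eq_pow_sum, ← Finset.sum_mul, ← Finset.sum_mul, mul_zero] at this
  exact this.mono (Nat.mul_le_mul_right _ e1) (Nat.pow_le_pow_right hf e1)

theorem Bd.pderiv {τ : Type} [Fintype τ] {P : MvPolynomial τ ℤ} {d N : ℕ}
    (h : Bd (fun _ => 0) (fun _ => 1) 0 d N P) (i : τ) :
    Bd (fun _ => 0) (fun _ => 1) 0 d (N * d) (MvPolynomial.pderiv i P) := by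
  classical
  refine Bd.map (MvPolynomial.pderiv i).toLinearMap h.norm fun m hm => ?_
  have hd := h.deg m hm
  rw [Finsupp.weight_eq_sum] at hd
  simp only [smul_eq_mul, mul_one] at hd
  rw [Derivation.coeFn_coe, pderiv_monomial]
  refine Bd.monomial _ _ ?_ ?_ ?_
  · rw [Finsupp.weight_eq_sum]
    simp
  · rw [Finsupp.weight_eq_sum]
    refine le_trans (Finset.sum_le_sum fun j _ => ?_) hd
    simp
  · simp only [one_mul, Int.natAbs_natCast]
    exact (Finset.single_le_sum (fun j _ => Nat.zero_le (m j)) (Finset.mem_univ i)).trans hd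

section
variable {n K : ℕ}

/-- Degree `n + 2` comes from a coefficient times `y ^ (n + 1)` in `H(0, y)`; the norm counts the
monomials. -/
theorem bd_evPoly (α : Idx n) :
    Bd (fun _ => 0) (fun _ => 1) 0 (n + 2) (Fintype.card (Idx n)) (evPoly α) := by
  have h1 : 1 ≤ Fintype.card (Idx n) := Fintype.card_pos_iff.2 ⟨α⟩
  rw [evPoly]
  split_ifs with h
  · refine Bd.neg ((Bd.sum_const (N := 1) Finset.univ fun γ _ => ?_).mono le_rfl ?_)
    · split_ifs
      · have := (Bd.X (ω := fun _ => 0) (ω' := fun _ => 1) (some γ)).mul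
          ((Bd.X (none : BIdx n)).pow (γ.1.1.2 : ℕ))
        rw [one_pow, mul_one, mul_one, mul_zero, add_zero] at this
        exact this.mono (by omega) le_rfl
      · exact Bd.zero
    · rw [mul_one, Finset.card_univ]
      exact Fintype.card_subtype_le _
  · exact (Bd.X _).mono (by omega) h1

theorem card_bIdx : Fintype.card (BIdx n) = Fintype.card (Idx n) := by
  have : 1 ≤ Fintype.card (Idx n) := Fintype.card_pos_iff.2 ⟨idx00 n⟩
  rw [Fintype.card_option, Fintype.card_subtype_compl, Fintype.card_subtype_eq]
  omega

theorem weight_one_le {t d N : ℕ} {P : MvPolynomial (Option (Idx n)) ℤ}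
    (h : Bd (lamWeight n) (wp n) t d N P) (m : Option (Idx n) →₀ ℕ) (hm : P.coeff m ≠ 0) :
    Finsupp.weight (fun _ => 1) m ≤ t + d := by
  have h1 := h.hom m hm
  have h2 := h.deg m hm
  rw [Finsupp.weight_eq_sum, Fintype.sum_option] at h1 h2 ⊢
  simp [wp, lamWeight] at h1 h2 ⊢
  omega

variable {Den : MvPolynomial (Idx n) ℤ}
  {Num : Idx n → Word n K → Word n K → MvPolynomial (Option (Idx n)) ℤ} {t d N N' : ℕ}

theorem bd_pullNum (hNum : ∀ α w u, Bd (lamWeight n) (wp n) t d N (Num α w u)) (β : BIdx n)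
    (w u : Word n K) : Bd (fun _ => 0) (fun _ => 1) 0 ((t + d) * (n + 2) + (n + 2))
      (Fintype.card (Idx n) * (N * Fintype.card (Idx n) ^ (t + d) *
        (Fintype.card (Idx n) * (n + 2)))) (pullNum Num β w u) := by
  have h1 : 1 ≤ Fintype.card (Idx n) := Fintype.card_pos_iff.2 ⟨idx00 n⟩
  rw [pullNum]
  refine Bd.sum_const Finset.univ fun α _ => ?_
  refine (Bd.aeval_of_deg_le (hNum α w u).norm (weight_one_le (hNum α w u)) h1 ?_).mul
    ((bd_evPoly α).pderiv β)
  rintro (_ | γ)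
  · exact (Bd.X _).mono (by omega) h1
  · exact bd_evPoly γ

theorem bd_evHom (hDen : Bd (fun _ => 1) (fun _ => 0) t 0 N Den) :
    Bd (fun _ => 0) (fun _ => 1) 0 (t * (n + 2)) (N * Fintype.card (Idx n) ^ t) (evHom n Den) :=
  Bd.aeval_of_deg_le hDen.norm (fun m hm => (hDen.hom m hm).le)
    (Fintype.card_pos_iff.2 ⟨idx00 n⟩) bd_evPoly

/-- The Picard–Fuchs system of the basic iterated integrals, with bounds for its degree and size. -/
theorem exists_matForm (hn : 1 ≤ n) (hK : 1 ≤ K) :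
    ∃ Ω : MatForm n K,
      Ω.IsProjective ∧
      (∀ a : Idx n → ℂ, TransversalToInfinity a → SmoothCurve a → TransversalToAxis a →
        ∀ F : CycleFamily a,
          SolvesNear Ω F.base (F.S K) a ∧
          SolvesNearB Ω.pullback (fun z => F.S K (ev z)) (liftPoint a (F.base a))) ∧
      (∀ α w u, (Ω α w u).natDegree ≤ 300000 * (n * K) ∧
        lamDegree (Ω α w u) ≤ 300000 * (K ^ 6 * n ^ 7)) ∧
      Ω.size ≤ (K * n + 1) ^ (300000 * (K ^ 6 * n ^ 5)) ∧
      (∀ β w u, ratDegree (Ω.pullback β w u) ≤ 300000 * (K ^ 6 * n ^ 8)) ∧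
      Ω.pullback.size ≤ (K * n + 1) ^ (300000 * (K ^ 6 * n ^ 7)) := by
  obtain ⟨t, Den, Num, ht, hD, hDen, hNum, h0, hF⟩ := exists_connection hn hK
  have hW := (card_word_le n K hn).trans (card_word_le_pow hn hK)
  generalize hT : K * n + 1 = T at hDen hNum hW ⊢
  have hKn : 1 ≤ K * n := Nat.mul_pos hK hn
  have hnK : n ≤ K * n := Nat.le_mul_of_pos_left _ hK
  have hT2 : 2 ≤ T := by omega
  have hT1 : 1 ≤ T := by omega
  have hn2 : n + 2 ≤ T * T := by nlinarith
  have hIT : Fintype.card (Idx n) ≤ T ^ 4 := by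
    calc _ ≤ (T * T) ^ 2 := card_idx_le.trans (Nat.pow_le_pow_left hn2 2)
      _ = T ^ 4 := by ring
  -- All estimates are made in terms of `M`, which dominates `t` up to a constant as well as `Kn`;
  -- the higher powers of `n` in the stated bounds are slack.
  obtain ⟨M, hM⟩ : ∃ M, M = n ^ 3 * K ^ 6 := ⟨_, rfl⟩
  have hpow : ∀ {i j : ℕ}, i ≤ j → n ^ 3 * K ^ 6 * n ^ i ≤ n ^ 3 * K ^ 6 * n ^ j := fun h =>
    Nat.mul_le_mul_left _ (Nat.pow_le_pow_right hn h)
  have hM5 : M ≤ K ^ 6 * n ^ 5 := by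
    calc M = n ^ 3 * K ^ 6 * n ^ 0 := by rw [hM]; ring
      _ ≤ n ^ 3 * K ^ 6 * n ^ 2 := hpow (by omega)
      _ = _ := by ring
  have hM7 : M ≤ K ^ 6 * n ^ 7 := by
    calc M = n ^ 3 * K ^ 6 * n ^ 0 := by rw [hM]; ring
      _ ≤ n ^ 3 * K ^ 6 * n ^ 4 := hpow (by omega)
      _ = _ := by ring
  have hM8 : n * M ≤ K ^ 6 * n ^ 8 := by
    calc n * M = n ^ 3 * K ^ 6 * n ^ 1 := by rw [hM]; ring
      _ ≤ n ^ 3 * K ^ 6 * n ^ 5 := hpow (by omega)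
      _ = _ := by ring
  have hKM : K * n ≤ M := by
    calc K * n ≤ K ^ 6 * n ^ 3 :=
          Nat.mul_le_mul (Nat.le_self_pow (by omega) K) (Nat.le_self_pow (by omega) n)
      _ = M := by rw [hM]; ring
  have hK_le : K ≤ K * n := Nat.le_mul_of_pos_right _ hn
  have htM : t ≤ 1690 * M := by
    refine ht.trans ?_
    rw [hM]
    exact Nat.mul_le_mul_left _ (Nat.mul_le_mul_left _ (Nat.pow_le_pow_right hK (by omega)))
  have h9 : 9 * n * K = 9 * (K * n) := by ring
  rw [← hM] at hDen hNum
  refine ⟨quotForm Den Num, quotForm_isProjective hD hDen hNum h0,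
    fun a _ hs htr F => ⟨solvesNear_quotForm hn hD F (hF a hs htr F),
      solvesNearB_quotForm hn hD htr F (hF a hs htr F)⟩,
    fun α w u => ⟨?_, ?_⟩, ?_, fun β w u => ?_, ?_⟩
  · refine (natDegree_quotForm_le hNum α w u).trans ?_
    rw [h9, mul_comm n K]
    omega
  · refine (lamDegree_quotForm_le hD hDen hNum α w u).trans ?_
    omega
  · have h1 : ∀ α w u, ratSize (toRat n (quotForm Den Num α w u)) ≤ T ^ (253500 * M + 1) := by
      intro α w u
      refine (ratSize_quotForm_le hD hDen hNum α w u).trans ?_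
      rw [pow_succ]
      nlinarith [Nat.pow_pos (n := 253500 * M) hT1]
    calc (quotForm Den Num).size ≤ Fintype.card (Idx n) * (Fintype.card (Word n K) *
          (Fintype.card (Word n K) * T ^ (253500 * M + 1))) := by
          refine Finset.sum_le_card_nsmul _ _ _ fun α _ => ?_
          refine Finset.sum_le_card_nsmul _ _ _ fun w _ => ?_
          exact Finset.sum_le_card_nsmul _ _ _ fun u _ => h1 α w u
      -- `T ^ 4` counts the differentials and each `T ^ (3 * K)` the words that index rows and
      -- columns.
      _ ≤ T ^ 4 * (T ^ (3 * K) * (T ^ (3 * K) * T ^ (253500 * M + 1))) := by gcongr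
      _ = T ^ (4 + (3 * K + (3 * K + (253500 * M + 1)))) := by
          rw [← pow_add, ← pow_add, ← pow_add]
      _ ≤ _ := Nat.pow_le_pow_right hT1 (by omega)
  · have h1 := (bd_pullNum hNum β w u).weightedTotalDegree_le
    have h2 := (bd_evHom hDen).weightedTotalDegree_le
    refine (ratWDegree_le (isQuot_pullback_quotForm hD β w u) _).trans ?_
    calc _ ≤ (t + 9 * n * K) * (n + 2) + (n + 2) + (t + 1) * (n + 2) := Nat.add_le_add h1 h2
      _ = (2 * t + 9 * (K * n) + 2) * (n + 2) := by ring
      _ ≤ (3391 * M) * (3 * n) := Nat.mul_le_mul (by omega) (by omega)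
      _ = 10173 * (n * M) := by ring
      _ ≤ _ := by omega
  · have hexp : t + 9 * n * K ≤ 1699 * M := by omega
    have h1 : ∀ β w u, ratSize ((quotForm Den Num).pullback β w u) ≤
        T ^ (253500 * M + 4 * (1699 * M) + 11) := by
      intro β w u
      refine (ratSize_le (isQuot_pullback_quotForm hD β w u)).trans ?_
      have e1 : polyNorm (pullNum Num β w u) ≤ T ^ (253500 * M + 4 * (1699 * M) + 10) := by
        refine (bd_pullNum hNum β w u).norm.trans ?_
        calc _ ≤ T ^ 4 * (T ^ (253500 * M) * (T ^ 4) ^ (t + 9 * n * K) * (T ^ 4 * (T * T))) := by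
              gcongr
          _ ≤ T ^ 4 * (T ^ (253500 * M) * (T ^ 4) ^ (1699 * M) * (T ^ 4 * (T * T))) := by
              gcongr
              exact Nat.one_le_pow _ _ hT1
          _ = T ^ (253500 * M + 4 * (1699 * M) + 10) := by rw [← pow_mul]; ring
      have e2 : polyNorm (evHom n Den) ≤ T ^ (253500 * M + 4 * (1699 * M) + 10) := by
        refine (bd_evHom hDen).norm.trans ?_
        calc _ ≤ T ^ (253500 * M) * (T ^ 4) ^ (t + 1) := by gcongr
          _ = T ^ (253500 * M + 4 * (t + 1)) := by rw [← pow_mul, ← pow_add]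
          _ ≤ _ := Nat.pow_le_pow_right hT1 (by omega)
      rw [pow_succ]
      nlinarith
    calc (quotForm Den Num).pullback.size ≤ Fintype.card (BIdx n) * (Fintype.card (Word n K) *
          (Fintype.card (Word n K) * T ^ (253500 * M + 4 * (1699 * M) + 11))) := by
          refine Finset.sum_le_card_nsmul _ _ _ fun β _ => ?_
          refine Finset.sum_le_card_nsmul _ _ _ fun w _ => ?_
          exact Finset.sum_le_card_nsmul _ _ _ fun u _ => h1 β w u
      _ ≤ T ^ 4 * (T ^ (3 * K) * (T ^ (3 * K) * T ^ (253500 * M + 4 * (1699 * M) + 11))) := by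
          rw [card_bIdx]
          gcongr
      _ = T ^ (4 + (3 * K + (3 * K + (253500 * M + 4 * (1699 * M) + 11)))) := by
          rw [← pow_add, ← pow_add, ← pow_add]
      _ ≤ _ := Nat.pow_le_pow_right hT1 (by omega)

end

end

end

end PicardFuchs

theorem mainTheorem2 :
    ∃ C : ℕ, ∀ n K : ℕ, 1 ≤ n → 1 ≤ K →
      ∃ Ω : MatForm n K,
        Ω.IsProjective ∧
        (∀ a : Idx n → ℂ, TransversalToInfinity a → SmoothCurve a → TransversalToAxis a →
          ∀ F : CycleFamily a,
            SolvesNear Ω F.base (F.S K) a ∧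
            SolvesNearB Ω.pullback (fun z => F.S K (ev z)) (liftPoint a (F.base a))) ∧
        (∀ α w u, (Ω α w u).natDegree ≤ C * (n * K) ∧
          lamDegree (Ω α w u) ≤ C * (K ^ 6 * n ^ 7)) ∧
        Ω.size ≤ (K * n + 1) ^ (C * (K ^ 6 * n ^ 5)) ∧
        (∀ β w u, ratDegree (Ω.pullback β w u) ≤ C * (K ^ 6 * n ^ 8)) ∧
        Ω.pullback.size ≤ (K * n + 1) ^ (C * (K ^ 6 * n ^ 7)) := by
  -- The largest exponent, for the size of the lifted form, is at most `(253500 + 4 * 1699 + 21) M`;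
  -- the constant rounds this up.
  exact ⟨300000, fun _ _ hn hK => exists_matForm hn hK⟩
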